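/- Let $d,q\ge 1$ be integers, put $n=(q+1)d$, and let $\alpha$ be a real number with $\alpha\ge 3d(d+4)$. Then there is a linear subspace $A\subset\mathbb{R}^n$ of dimension $d$ such that - for every integer $e$ with $d\le e\le n-d$, $A$ is $(e,d)$-irrational and $$\mu_n(A|e)_d=\frac{\alpha^{q_e+1}}{r_e+(d-r_e)\alpha},$$ where $q_e$ and $r_e$ are the quotient and the remainder of the Euclidean division of $e$ by $d$; - for every integer $e$ with $1\le e\le d-1$, $A$ is $(e,e)$-irrational and $$\mu_n(A|e)_e=\frac{\alpha}{e}.$$ Here the following notation is used. All norms are Euclidean, and $\bigwedge^r\mathbb{R}^n$ is identified with $\mathbb{R}^{\binom nr}$ through its canonical basis. *Height.* A subspace $B\subset\mathbb{R}^n$ is rational if it has a basis of vectors of $\mathbb{Q}^n$; $\mathcal{R}_n(e)$ is the set of rational subspaces of dimension $e$. If $\eta=(\eta_1,\dots,\eta_N)\in\mathbb{Q}^N$, $N=\binom ne$, is the vector of maximal minors of the matrix whose columns form a rational basis of $B\in\mathcal{R}_n(e)$, then $H(B)=\|\eta\|/N(\mathfrak a)$, where $\mathfrak a=\eta_1\mathbb{Z}+\dots+\eta_N\mathbb{Z}$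 and $N(\mathfrak a)$ is the norm of this fractional ideal ($N(c\mathbb{Z})=|c|$); this does not depend on the basis. *Angles.* For nonzero $X,Y\in\mathbb{R}^n$ let $\omega(X,Y)=\|X\wedge Y\|/(\|X\|\,\|Y\|)$. For subspaces $A,B$ of dimensions $d,e$, define $\omega_1(A,B)\le\dots\le\omega_{\min(d,e)}(A,B)$ recursively: $\omega_j(A,B)=\omega(X_j,Y_j)$ is the minimum of $\omega(X,Y)$ over the nonzero $X\in A$ orthogonal to $X_1,\dots,X_{j-1}$ and the nonzero $Y\in B$ orthogonal to $Y_1,\dots,Y_{j-1}$, and $(X_j,Y_j)$ is a pair that attains it; the values do not depend on the choices. Put $g(d,e,n)=\max(0,d+e-n)$ and $\psi_j(A,B)=\omega_{j+g(d,e,n)}(A,B)$ for $1\le j\le\min(d,e)-g(d,e,n)$. *Irrationality and exponents.* A subspace $A$ of dimension $d$ is $(e,j)$-irrational if $\dim(A\cap B)<j+g(d,e,n)$ for every $B\in\mathcal{R}_n(e)$. In that case $\mu_n(A|e)_j\in[0,+\infty]$ is the supremum of the real numbers $\mu>0$ such that $\psi_j(A,B)\le H(B)^{-\mu}$ for infinitely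 many $B\in\mathcal{R}_n(e)$. -/

import Mathlib

noncomputable section

namespace DiophSub

open Module Submodule

/-- The space `ℝⁿ` with its Euclidean norm. -/
abbrev E (n : ℕ) : Type := EuclideanSpace ℝ (Fin n)

/-- The maximal minors of the `n × r` matrix whose columns are `v 0, …, v (r-1)`. The set of rows
is given by its increasing enumeration `I`. -/
def minors {K : Type*} [CommRing K] {n r : ℕ} (v : Fin r → Fin n → K) :
    (Fin r ↪o Fin n) → K :=
  fun I => Matrix.det (Matrix.of fun a b : Fin r => v b (I a))

/-- The Euclidean norm of `v 0 ∧ … ∧ v (r-1)`, where `⋀ʳ ℝⁿ` is identified with `ℝ^(n choose r)`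
through the canonical basis. -/
def wedgeNorm {n r : ℕ} (v : Fin r → Fin n → ℝ) : ℝ :=
  Real.sqrt (∑ I : Fin r ↪o Fin n, minors v I ^ 2)

/-! ### Rational subspaces and their height -/

/-- A vector with rational coordinates, seen in `ℝⁿ`. -/
def ratVec {n : ℕ} (w : Fin n → ℚ) : E n :=
  WithLp.toLp 2 fun i => (w i : ℝ)

/-- The family `w` of rational vectors is a basis of `B`. -/
def IsRationalBasis {n e : ℕ} (B : Submodule ℝ (E n)) (w : Fin e → Fin n → ℚ) : Prop :=
  LinearIndependent ℝ (fun i => ratVec (w i)) ∧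
    span ℝ (Set.range fun i => ratVec (w i)) = B

/-- The set of rational subspaces of `ℝⁿ` of dimension `e`. -/
def rationalSubspaces (n e : ℕ) : Set (Submodule ℝ (E n)) :=
  {B | ∃ w : Fin e → Fin n → ℚ, IsRationalBasis B w}

/-- The fractional ideal of `ℤ` generated by the Grassmann coordinates of a family of rational
vectors. -/
def grassmannIdeal {n e : ℕ} (w : Fin e → Fin n → ℚ) :
    FractionalIdeal (nonZeroDivisors ℤ) ℚ :=
  FractionalIdeal.spanFinset ℤ Finset.univ (minors w)

/-- The height computed from a rational basis: the Euclidean norm of the vector of Grassmann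
coordinates, divided by the norm of the fractional ideal that they generate. -/
def basisHeight {n e : ℕ} (w : Fin e → Fin n → ℚ) : ℝ :=
  wedgeNorm (fun i k => (w i k : ℝ)) / (FractionalIdeal.absNorm (grassmannIdeal w) : ℝ)

/-- The height `H(B)` of a rational subspace: the common value of `basisHeight` on all the rational
bases of `B` (it does not depend on the basis, so the set below has exactly one element). -/
def height {n : ℕ} (B : Submodule ℝ (E n)) : ℝ :=
  sInf {h : ℝ | ∃ (e : ℕ) (w : Fin e → Fin n → ℚ), IsRationalBasis B w ∧ h = basisHeight w}

/-! ### Angles between two subspaces -/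

/-- `ω(X, Y) = ‖X ∧ Y‖ / (‖X‖ ‖Y‖)`, the sine of the angle between `X` and `Y`. -/
def omegaVec {n : ℕ} (X Y : E n) : ℝ :=
  wedgeNorm ![fun k => X k, fun k => Y k] / (‖X‖ * ‖Y‖)

/-- The pairs `(X i, Y i)` are obtained by the recursive construction of the angles between `A` and
`B`: `X i` and `Y i` are nonzero vectors of `A`, resp. `B`, orthogonal to the previous `X k`,
resp. `Y k`, and among all such pairs they minimize `ω`. -/
def IsAngleSystem {n t : ℕ} (A B : Submodule ℝ (E n)) (X Y : Fin t → E n) : Prop :=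
  ∀ i : Fin t,
    (X i ∈ A ∧ X i ≠ 0 ∧ ∀ k < i, inner ℝ (X k) (X i) = 0) ∧
    (Y i ∈ B ∧ Y i ≠ 0 ∧ ∀ k < i, inner ℝ (Y k) (Y i) = 0) ∧
    ∀ x ∈ A, x ≠ 0 → (∀ k < i, inner ℝ (X k) x = 0) →
      ∀ y ∈ B, y ≠ 0 → (∀ k < i, inner ℝ (Y k) y = 0) →
        omegaVec (X i) (Y i) ≤ omegaVec x y

/-- `ω_j(A, B)` for `1 ≤ j ≤ min (dim A) (dim B)`: the value `ω(X_j, Y_j)` for pairs given by the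
recursive construction (it does not depend on the choices made, so for these `j` the set below has
exactly one element). -/
def omega {n : ℕ} (A B : Submodule ℝ (E n)) (j : ℕ) : ℝ :=
  sInf {s : ℝ | ∃ X Y : Fin (min (finrank ℝ A) (finrank ℝ B)) → E n, IsAngleSystem A B X Y ∧
    ∃ i : Fin (min (finrank ℝ A) (finrank ℝ B)),
      i.val + 1 = j ∧ s = omegaVec (X i) (Y i)}

/-- `g(d, e, n) = max (0, d + e - n)` (subtraction of natural numbers is truncated). -/
def g (d e n : ℕ) : ℕ := d + e - n

/-- `ψ_j(A, B) = ω_{j + g(d,e,n)}(A, B)` where `d = dim A` and `e = dim B`. -/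
def psi {n : ℕ} (A B : Submodule ℝ (E n)) (j : ℕ) : ℝ :=
  omega A B (j + g (finrank ℝ A) (finrank ℝ B) n)

/-! ### Irrationality and Diophantine exponents -/

/-- `A` is `(e, j)`-irrational. -/
def IsIrrational {n : ℕ} (A : Submodule ℝ (E n)) (e j : ℕ) : Prop :=
  ∀ B ∈ rationalSubspaces n e,
    finrank ℝ (A ⊓ B : Submodule ℝ (E n)) < j + g (finrank ℝ A) e n

/-- The Diophantine exponent `μ_n(A|e)_j`: the supremum, possibly infinite, of the `μ > 0` such that
`ψ_j(A, B) ≤ H(B)^(-μ)` for infinitely many rational subspaces `B` of dimension `e`. -/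
def exponent {n : ℕ} (A : Submodule ℝ (E n)) (e j : ℕ) : EReal :=
  sSup ((fun μ : ℝ => (μ : EReal)) ''
    {μ : ℝ | 0 < μ ∧ {B ∈ rationalSubspaces n e | psi A B j ≤ 1 / height B ^ μ}.Infinite})

end DiophSub

end

/-!
The subspace is `A = ℝ y ⊗ ℝ ^ d` (`limSpace`), where `ℝⁿ` is identified with `ℝ ^ (q + 1) ⊗ ℝ ^ d`
and `y` is a single point of `ℝ ^ (q + 1)`, very well approximated by rational points. Put
`T_k = 2 ^ ⌊α ^ k⌋`, so that `log T_{k+1} / log T_k` tends to `α`. Integer points `X_k` are defined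
by `X_{k+1} = (T_{k+1} / T_k) X_k + e_s`, where the index `s` runs cyclically through the
coordinates other than the one of index `0`, and `y` is the limit of `X_k / T_k`. The point `X_k` is
at distance of the order of `T_k / T_{k+1}` from the line `ℝ y`, and `q` consecutive steps involve
all the coordinates.

Angles are only used through the following fact (`psi_le`, `nearTo_psi` and their variants): the
last angle between `A` and `B` is, up to a constant factor, the least `δ` such that each vector `x`
of the smaller subspace is at distance at most `δ ‖x‖` from the larger one (`NearTo`).

Heights are controlled by one inequality (`height_sup_span_le`): if `x` is an integer vector outside
the rational subspace `B`, then `1 ≤ H(B + ℝ x) ≤ K H(B) dist(x, B)`. It bounds from above the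
heights of subspaces generated by given integer points. It shows that a rational subspace of small
height close to `A` contains many of the points `X_k ⊗ e_j` (`one_le_height_mul_of_pt_notMem`).
Finally, it bounds from below the height of a subspace which contains consecutive points `X_k` in
each block: adding the previous points, which are at distance `T_i / T_{i+1}` from it, and at last a
point given by Bézout's identity, one reaches `ℝⁿ`, of height at least `1` (`lacDen_pow_le_height`).

*Dimension `e = Q d + r ≥ d`.* The subspaces which contain `X_k, …, X_{k+Q}` in `r` blocks and
`X_{k+1}, …, X_{k+Q}` in the other ones have height about `T_k ^ r T_{k+1} ^ (d - r)` and angle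
about `1 / T_{k+Q+1}` with `A`, whence the exponent `α ^ (Q + 1) / (r + (d - r) α)`. Conversely, a
rational subspace `B` which is closer to `A` than a suitable power of its height contains
`X_{k+1}, …, X_{k+Q}` in each block, for an index `k` determined by `H(B)`. The lower bound for
heights then applies. Moreover `B` cannot be closer to `A` than `1 / T_{k+Q+1}`, up to a constant:
otherwise it would contain vectors close to `X_{k+Q+1}` in all blocks, and its dimension would be at
least `(Q + 1) d` (`one_le_of_pt_mem`).

*Dimension `e < d`.* The points `X_k ⊗ e_j` for `j < e` span subspaces of height at most about
`T_k ^ e`, at distance about `1 / T_{k+1}` from `A`. Conversely, a rational subspace `B` close to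
`A` is enlarged to a rational subspace of dimension `d`, still close to `A`, by adding `d - e` of
the points `X_k ⊗ e_j`, chosen one after the other so as to make a large angle with the subspace
already obtained (`exists_nearTo_rational_ge`). If it misses one of the points `X_k ⊗ e_j`, then `B`
is not very close to `A`. Otherwise it is the span of these points, so that `B` has height at least
about `T_k ^ e`, and it is not closer to `A` than `1 / T_{k+1}` (`height_or_of_nearTo`). The case
where a point is missed is harmless because `α` is large compared with `d ^ 2`.

In both cases the finiteness of the set of rational subspaces of bounded height (`finite_height_le`)
reduces the upper bound for the exponent to large heights, hence to large `k`. Taking logarithms,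
everything becomes a comparison of multiples of `α ^ k` (`eventually_add_lt_of_tendsto_div`).
-/

noncomputable section

namespace DiophSub

open Module Submodule

/-! ### Maximal minors -/

/-- Expansion of the maximal minors along the last column. -/
theorem minors_snoc {K : Type*} [CommRing K] {n r : ℕ} (w : Fin r → Fin n → K) (x : Fin n → K)
    (I : Fin (r + 1) ↪o Fin n) :
    minors (Fin.snoc w x : Fin (r + 1) → Fin n → K) I =
      ∑ a : Fin (r + 1), (-1) ^ ((a : ℕ) + r) * x (I a) *
        minors w ((Fin.succAboveOrderEmb a).trans I) := by
  unfold minors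
  rw [Matrix.det_succ_column _ (Fin.last r)]
  refine Finset.sum_congr rfl fun a _ => ?_
  congr 1
  · simp
  · congr 1
    ext i j
    simp [Matrix.submatrix]

theorem minors_map {K L : Type*} [CommRing K] [CommRing L] (f : K →+* L) {n r : ℕ}
    (w : Fin r → Fin n → K) (I : Fin r ↪o Fin n) :
    minors (fun i k => f (w i k)) I = f (minors w I) := by
  unfold minors
  rw [RingHom.map_det]
  congr 1

/-- A family of `r` vectors is independent exactly when one of its `r × r` minors is nonzero. -/
theorem linearIndependent_iff_minors_ne_zero {K : Type*} [Field K] {n r : ℕ}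
    (w : Fin r → Fin n → K) : LinearIndependent K w ↔ ∃ I, minors w I ≠ 0 := by
  constructor
  · intro h
    -- the rows of the matrix span `K ^ r`, so `r` of them form a basis
    let R : Fin n → (Fin r → K) := fun i b => w b i
    have hspan : span K (Set.range R) = ⊤ := by
      have h1 : (Matrix.of w).rank = r := by
        have := LinearIndependent.rank_matrix (M := Matrix.of w) h
        simpa using this
      have h2 : (Matrix.of w).rank = finrank K (span K (Set.range R)) := by
        rw [Matrix.rank_eq_finrank_span_cols]
        rfl
      apply Submodule.eq_top_of_finrank_eq
      rw [← h2, h1]; simp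
    obtain ⟨κ, a, ha, hsp, hli⟩ := exists_linearIndependent' K R
    have : Finite κ := Finite.of_injective a ha
    have := Fintype.ofFinite κ
    have hcard : Fintype.card κ = r := by
      have := finrank_span_eq_card hli
      rw [hsp, hspan] at this
      simpa using this.symm
    have hcard' : (Finset.univ.map ⟨a, ha⟩).card = r := by simpa using hcard
    let I := (Finset.univ.map ⟨a, ha⟩).orderEmbOfFin hcard'
    have hI : ∀ i, ∃ k, a k = I i := fun i => by
      obtain ⟨k, _, hk⟩ := Finset.mem_map.1 (Finset.orderEmbOfFin_mem _ hcard' i)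
      exact ⟨k, hk⟩
    choose k hk using hI
    have hkinj : Function.Injective k := fun i j hij => I.injective (by rw [← hk, ← hk, hij])
    refine ⟨I, ?_⟩
    have hli' : LinearIndependent K (Matrix.of fun a b : Fin r => w b (I a)).row := by
      have heq : (Matrix.of fun a b : Fin r => w b (I a)).row = (R ∘ a) ∘ k := by
        funext i
        simp only [Function.comp, hk]
        rfl
      rw [heq]
      exact hli.comp k hkinj
    have h3 := Matrix.linearIndependent_rows_iff_isUnit.1 hli'
    exact ((Matrix.isUnit_iff_isUnit_det _).1 h3).ne_zero
  · rintro ⟨I, hI⟩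
    unfold minors at hI
    have h1 : IsUnit (Matrix.of fun a b : Fin r => w b (I a)) :=
      (Matrix.isUnit_iff_isUnit_det _).2 (isUnit_iff_ne_zero.2 hI)
    have h2 := Matrix.linearIndependent_cols_iff_isUnit.2 h1
    let f : (Fin n → K) →ₗ[K] (Fin r → K) := LinearMap.funLeft K K I
    exact LinearIndependent.of_comp f h2

theorem sum_orderEmb_two {n : ℕ} (f : Fin n → Fin n → ℝ) :
    ∑ I : Fin 2 ↪o Fin n, f (I 0) (I 1) =
      ∑ p ∈ (Finset.univ : Finset (Fin n × Fin n)).filter (fun p => p.1 < p.2), f p.1 p.2 := by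
  refine Finset.sum_bij (fun I _ => (I 0, I 1)) ?_ ?_ ?_ ?_
  · intro I _
    simp
  · intro I _ J _ h
    simp only [Prod.mk.injEq] at h
    ext i
    fin_cases i
    · simp [h.1]
    · simp [h.2]
  · rintro ⟨a, b⟩ h
    simp only [Finset.mem_filter, Finset.mem_univ, true_and] at h
    refine ⟨OrderEmbedding.ofStrictMono ![a, b] ?_, Finset.mem_univ _, ?_⟩
    · intro i j hij
      fin_cases i <;> fin_cases j <;> simp_all
    · simp [OrderEmbedding.ofStrictMono]
  · intros; rfl

/-- Lagrange's identity. -/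
theorem wedgeNorm_pair_sq {n : ℕ} (x y : E n) :
    wedgeNorm ![fun k => x k, fun k => y k] ^ 2 = ‖x‖ ^ 2 * ‖y‖ ^ 2 - inner ℝ x y ^ 2 := by
  unfold wedgeNorm
  rw [Real.sq_sqrt (Finset.sum_nonneg fun _ _ => sq_nonneg _)]
  have h1 : ∀ I : Fin 2 ↪o Fin n, minors ![fun k => x k, fun k => y k] I ^ 2 =
      (x (I 0) * y (I 1) - x (I 1) * y (I 0)) ^ 2 := by
    intro I
    simp [minors, Matrix.det_fin_two]
    ring
  simp_rw [h1]
  rw [sum_orderEmb_two (fun i j => (x i * y j - x j * y i) ^ 2)]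
  have h2 : ∑ p : Fin n × Fin n, (x p.1 * y p.2 - x p.2 * y p.1) ^ 2 =
      2 * (‖x‖ ^ 2 * ‖y‖ ^ 2 - inner ℝ x y ^ 2) := by
    rw [EuclideanSpace.norm_sq_eq, EuclideanSpace.norm_sq_eq, PiLp.inner_apply, sq (∑ i, _),
      Finset.sum_mul_sum, Finset.sum_mul_sum, Fintype.sum_prod_type, ← Finset.sum_sub_distrib,
      Finset.mul_sum]
    have : ∀ i j, (x i * y j - x j * y i) ^ 2 =
      (‖x i‖ ^ 2 * ‖y j‖ ^ 2 - (inner ℝ (x i) (y i)) * (inner ℝ (x j) (y j)))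
       + (‖x j‖ ^ 2 * ‖y i‖ ^ 2 - (inner ℝ (x i) (y i)) * (inner ℝ (x j) (y j))) := by
      intro i j
      simp
      ring
    simp_rw [this, Finset.sum_add_distrib, two_mul, ← Finset.sum_sub_distrib]
    rw [Finset.sum_add_distrib]
    congr 1
    rw [Finset.sum_comm]
    refine Finset.sum_congr rfl fun i _ => Finset.sum_congr rfl fun j _ => ?_
    ring
  have h3 : ∑ p : Fin n × Fin n, (x p.1 * y p.2 - x p.2 * y p.1) ^ 2 =
    2 * ∑ p ∈ (Finset.univ : Finset (Fin n × Fin n)).filter (fun p => p.1 < p.2),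
      (x p.1 * y p.2 - x p.2 * y p.1) ^ 2 := by
    rw [← Finset.sum_filter_add_sum_filter_not Finset.univ (fun p : Fin n × Fin n => p.1 < p.2),
      two_mul]
    congr 1
    have h4 : ∑ p ∈ (Finset.univ : Finset (Fin n × Fin n)).filter (fun p => ¬ p.1 < p.2),
        (x p.1 * y p.2 - x p.2 * y p.1) ^ 2 =
        ∑ p ∈ (Finset.univ : Finset (Fin n × Fin n)).filter (fun p => p.2 < p.1),
        (x p.1 * y p.2 - x p.2 * y p.1) ^ 2 := by
      symm
      apply Finset.sum_subset
      · intro p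
        simp only [Finset.mem_filter, Finset.mem_univ, true_and]
        exact fun h => not_lt.2 h.le
      · intro p
        simp only [Finset.mem_filter, Finset.mem_univ, true_and, not_lt]
        intro h5 h6
        rw [le_antisymm h5 h6]
        ring
    rw [h4]
    refine Finset.sum_bij (fun p _ => (p.2, p.1)) ?_ ?_ ?_ ?_
    · simp
    · rintro ⟨a, b⟩ _ ⟨c, e⟩ _ h
      simp_all
    · rintro ⟨a, b⟩ h
      exact ⟨(b, a), by simpa using h, rfl⟩
    · intro p _
      ring
  linarith

/-- The positive generator of the fractional ideal generated by finitely many rationals is its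
norm. -/
theorem exists_generator {ι : Type*} [Fintype ι] (f : ι → ℚ) (hf : ∃ i, f i ≠ 0) :
    ∃ g : ℚ, 0 < g ∧
      FractionalIdeal.absNorm (FractionalIdeal.spanFinset ℤ Finset.univ f :
        FractionalIdeal (nonZeroDivisors ℤ) ℚ) = g ∧
      (∀ i, ∃ m : ℤ, f i = m * g) ∧ ∃ c : ι → ℤ, g = ∑ i, c i * f i := by
  set I : FractionalIdeal (nonZeroDivisors ℤ) ℚ := FractionalIdeal.spanFinset ℤ Finset.univ f
    with hI
  have hI0 : I ≠ 0 := by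
    rw [hI, FractionalIdeal.spanFinset_ne_zero]
    obtain ⟨i, hi⟩ := hf
    exact ⟨i, Finset.mem_univ _, hi⟩
  obtain ⟨x, hx⟩ := (FractionalIdeal.isPrincipal_iff I).1 inferInstance
  have hx0 : x ≠ 0 := by
    rintro rfl
    exact hI0 (by rw [hx]; simp)
  have hmem : ∀ z, z ∈ I ↔ ∃ m : ℤ, z = m * |x| := by
    intro z
    rw [hx, FractionalIdeal.mem_spanSingleton]
    rcases abs_choice x with h | h <;> rw [h]
    · constructor
      · rintro ⟨m, rfl⟩; exact ⟨m, by simp⟩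
      · rintro ⟨m, rfl⟩; exact ⟨m, by simp⟩
    · constructor
      · rintro ⟨m, rfl⟩; exact ⟨-m, by simp⟩
      · rintro ⟨m, rfl⟩; exact ⟨-m, by simp⟩
  have hmem2 : ∀ z, z ∈ I ↔ z ∈ span ℤ (Set.range f) := by
    intro z
    rw [← FractionalIdeal.mem_coe, hI, FractionalIdeal.spanFinset_coe]
    simp
  refine ⟨|x|, abs_pos.2 hx0, ?_, ?_, ?_⟩
  · rw [hx]
    rw [FractionalIdeal.absNorm_span_singleton]
    simp
  · intro i
    exact (hmem _).1 ((hmem2 _).2 (subset_span ⟨i, rfl⟩))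
  · have := (hmem2 |x|).1 ((hmem _).2 ⟨1, by simp⟩)
    rw [Submodule.mem_span_range_iff_exists_fun] at this
    obtain ⟨c, hc⟩ := this
    exact ⟨c, by rw [← hc]; simp⟩

/-! ### Rational subspaces and heights -/

/-- A vector with integer coordinates, seen in `ℝⁿ`. -/
def intVec {n : ℕ} (x : Fin n → ℤ) : E n :=
  WithLp.toLp 2 fun i => (x i : ℝ)

theorem ratVec_intCast {n : ℕ} (x : Fin n → ℤ) : ratVec (fun i => (x i : ℚ)) = intVec x := by
  simp [ratVec, intVec]

theorem card_orderEmb_le (r n : ℕ) : Fintype.card (Fin r ↪o Fin n) ≤ 2 ^ n := by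
  have h : Function.Injective (fun I : Fin r ↪o Fin n => Finset.univ.map I.toEmbedding) := by
    intro I J h
    have h1 := congrArg (fun s : Finset (Fin n) => (s : Set (Fin n))) h
    simp only [Finset.coe_map, Finset.coe_univ, Set.image_univ] at h1
    exact OrderEmbedding.range_inj.1 h1
  simpa using Fintype.card_le_of_injective _ h

/-- The constant of the inequality `H(B + ℝx) ≤ K H(B) dist(x, B)`. -/
def heightConst (n : ℕ) : ℝ := 2 ^ n * (n + 1)

theorem one_le_heightConst (n : ℕ) : 1 ≤ heightConst n := by
  unfold heightConst
  have h1 : (1 : ℝ) ≤ 2 ^ n := one_le_pow₀ (by norm_num)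
  have h2 : (0 : ℝ) ≤ n := Nat.cast_nonneg n
  nlinarith

theorem abs_minors_le_wedgeNorm {n r : ℕ} (w : Fin r → Fin n → ℝ) (I : Fin r ↪o Fin n) :
    |minors w I| ≤ wedgeNorm w := by
  unfold wedgeNorm
  rw [← Real.sqrt_sq_eq_abs]
  exact Real.sqrt_le_sqrt
    (Finset.single_le_sum (f := fun I => minors w I ^ 2) (fun _ _ => sq_nonneg _)
      (Finset.mem_univ I))

theorem wedgeNorm_le_of_abs_minors_le {n r : ℕ} (w : Fin r → Fin n → ℝ) {c : ℝ} (hc : 0 ≤ c)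
    (h : ∀ I, |minors w I| ≤ c) : wedgeNorm w ≤ 2 ^ n * c := by
  unfold wedgeNorm
  apply Real.sqrt_le_iff.2 ⟨by positivity, ?_⟩
  calc ∑ I, minors w I ^ 2 ≤ ∑ _I : Fin r ↪o Fin n, c ^ 2 :=
        Finset.sum_le_sum fun I _ => sq_le_sq.2 (by rw [abs_of_nonneg hc]; exact h I)
    _ = (Fintype.card (Fin r ↪o Fin n) : ℝ) * c ^ 2 := by simp
    _ ≤ 2 ^ n * c ^ 2 := by
        gcongr
        exact_mod_cast card_orderEmb_le r n
    _ ≤ (2 ^ n * c) ^ 2 := by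
        rw [mul_pow]
        gcongr
        exact le_self_pow₀ (one_le_pow₀ (by norm_num)) (by norm_num)

theorem minors_snoc_eq_zero {K : Type*} [Field K] {n r : ℕ} (w : Fin r → Fin n → K)
    (x : Fin n → K) (hx : x ∈ span K (Set.range w)) (I : Fin (r + 1) ↪o Fin n) :
    minors (Fin.snoc w x : Fin (r + 1) → Fin n → K) I = 0 := by
  by_contra h
  have := (linearIndependent_iff_minors_ne_zero _).2 ⟨I, h⟩
  rw [linearIndependent_finSnoc] at this
  exact this.2 hx

theorem wedgeNorm_snoc_le {n r : ℕ} (w : Fin r → Fin n → ℝ) (x : E n) (b : Fin n → ℝ)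
    (hb : b ∈ span ℝ (Set.range w)) :
    wedgeNorm (Fin.snoc w (fun i => x i) : Fin (r + 1) → Fin n → ℝ) ≤
      heightConst n * wedgeNorm w * ‖x - WithLp.toLp 2 b‖ := by
  have hw : 0 ≤ wedgeNorm w := Real.sqrt_nonneg _
  have h := wedgeNorm_le_of_abs_minors_le (Fin.snoc w (fun i => x i) : Fin (r + 1) → Fin n → ℝ)
    (c := (n + 1) * (‖x - WithLp.toLp 2 b‖ * wedgeNorm w)) (by positivity) ?_
  · refine h.trans (le_of_eq ?_)
    unfold heightConst
    ring
  intro I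
  have h0 := minors_snoc_eq_zero w b hb I
  have h1 : minors (Fin.snoc w (fun i => x i) : Fin (r + 1) → Fin n → ℝ) I =
      ∑ a : Fin (r + 1), (-1) ^ ((a : ℕ) + r) * (x - WithLp.toLp 2 b) (I a) *
        minors w ((Fin.succAboveOrderEmb a).trans I) := by
    rw [minors_snoc] at h0 ⊢
    rw [← sub_zero (∑ a, _), ← h0, ← Finset.sum_sub_distrib]
    refine Finset.sum_congr rfl fun a _ => ?_
    simp
    ring
  have hr : r + 1 ≤ n := by simpa using Fintype.card_le_of_injective I I.injective
  rw [h1]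
  calc _ ≤ ∑ a : Fin (r + 1), |(-1) ^ ((a : ℕ) + r) * (x - WithLp.toLp 2 b) (I a) *
        minors w ((Fin.succAboveOrderEmb a).trans I)| := Finset.abs_sum_le_sum_abs _ _
    _ ≤ ∑ a : Fin (r + 1), ‖x - WithLp.toLp 2 b‖ * wedgeNorm w := by
        refine Finset.sum_le_sum fun a _ => ?_
        rw [abs_mul, abs_mul, abs_pow, abs_neg, abs_one, one_pow, one_mul]
        gcongr
        · exact PiLp.norm_apply_le (x - WithLp.toLp 2 b) (I a)
        · exact abs_minors_le_wedgeNorm _ _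
    _ = (r + 1) * (‖x - WithLp.toLp 2 b‖ * wedgeNorm w) := by simp
    _ ≤ _ := by
        gcongr
        exact_mod_cast (by omega : r ≤ n)

theorem linearIndependent_ratVec_iff {n e : ℕ} (w : Fin e → Fin n → ℚ) :
    LinearIndependent ℝ (fun i => ratVec (w i)) ↔ ∃ I, minors w I ≠ 0 := by
  have h1 : LinearIndependent ℝ (fun i => ratVec (w i)) ↔
      LinearIndependent ℝ (fun (i : Fin e) (k : Fin n) => (w i k : ℝ)) := by
    rw [← LinearMap.linearIndependent_iff_of_injOn
      (WithLp.linearEquiv 2 ℝ (Fin n → ℝ)).toLinearMap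
      (LinearEquiv.injective _).injOn]
    rfl
  rw [h1, linearIndependent_iff_minors_ne_zero]
  refine exists_congr fun I => not_congr ?_
  have := minors_map (Rat.castHom ℝ) w I
  simp only [Rat.coe_castHom] at this
  rw [this]
  exact Rat.cast_eq_zero

/-- The minors of a rational basis: they are integer multiples, not all zero, of the norm `g` of the
ideal that they generate. -/
theorem IsRationalBasis.exists_generator {n e : ℕ} {B : Submodule ℝ (E n)} {w : Fin e → Fin n → ℚ}
    (h : IsRationalBasis B w) :
    ∃ g : ℚ, 0 < g ∧ FractionalIdeal.absNorm (grassmannIdeal w) = g ∧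
      (∀ I, ∃ m : ℤ, minors w I = m * g) ∧ ∃ c : (Fin e ↪o Fin n) → ℤ, g = ∑ I, c I * minors w I :=
  DiophSub.exists_generator _ ((linearIndependent_ratVec_iff w).1 h.1)

theorem minors_cast {n e : ℕ} (w : Fin e → Fin n → ℚ) (I : Fin e ↪o Fin n) :
    minors (fun i k => (w i k : ℝ)) I = ((minors w I : ℚ) : ℝ) :=
  minors_map (Rat.castHom ℝ) w I

theorem IsRationalBasis.one_le_basisHeight {n e : ℕ} {B : Submodule ℝ (E n)}
    {w : Fin e → Fin n → ℚ} (h : IsRationalBasis B w) : 1 ≤ basisHeight w := by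
  obtain ⟨g, hg, hgn, hm, -⟩ := h.exists_generator
  obtain ⟨I, hI⟩ := (linearIndependent_ratVec_iff w).1 h.1
  obtain ⟨m, hm⟩ := hm I
  unfold basisHeight
  have hg' : (0 : ℝ) < (g : ℝ) := by exact_mod_cast hg
  rw [hgn, one_le_div hg']
  refine le_trans ?_ (abs_minors_le_wedgeNorm _ I)
  rw [minors_cast, hm]
  have hm0 : m ≠ 0 := by
    rintro rfl
    simp [hm] at hI
  push_cast
  rw [abs_mul, abs_of_pos hg']
  have : (1 : ℝ) ≤ |(m : ℝ)| := by exact_mod_cast Int.one_le_abs hm0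
  nlinarith

theorem height_le_basisHeight {n e : ℕ} {B : Submodule ℝ (E n)} {w : Fin e → Fin n → ℚ}
    (h : IsRationalBasis B w) : height B ≤ basisHeight w := by
  refine csInf_le ⟨1, ?_⟩ ⟨e, w, h, rfl⟩
  rintro _ ⟨e, w, h, rfl⟩
  exact h.one_le_basisHeight

theorem IsRationalBasis.finrank {n e : ℕ} {B : Submodule ℝ (E n)} {w : Fin e → Fin n → ℚ}
    (h : IsRationalBasis B w) : finrank ℝ B = e := by
  rw [← h.2, finrank_span_eq_card h.1]
  simp

theorem finrank_of_mem_rationalSubspaces {n e : ℕ} {B : Submodule ℝ (E n)}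
    (hB : B ∈ rationalSubspaces n e) : finrank ℝ B = e :=
  hB.choose_spec.finrank

theorem le_height {n e : ℕ} {B : Submodule ℝ (E n)} (hB : B ∈ rationalSubspaces n e) {c : ℝ}
    (h : ∀ w : Fin e → Fin n → ℚ, IsRationalBasis B w → c ≤ basisHeight w) : c ≤ height B := by
  obtain ⟨w, hw⟩ := hB
  refine le_csInf ⟨_, e, w, hw, rfl⟩ ?_
  rintro _ ⟨e', w', h', rfl⟩
  obtain rfl : e = e' := hw.finrank.symm.trans h'.finrank
  exact h w' h'

theorem one_le_height {n e : ℕ} {B : Submodule ℝ (E n)} (hB : B ∈ rationalSubspaces n e) :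
    1 ≤ height B :=
  le_height hB fun _ hw => hw.one_le_basisHeight

theorem exists_basisHeight_lt {n e : ℕ} {B : Submodule ℝ (E n)} (hB : B ∈ rationalSubspaces n e)
    {c : ℝ} (h : height B < c) : ∃ w : Fin e → Fin n → ℚ, IsRationalBasis B w ∧
      basisHeight w < c := by
  by_contra! hc
  exact absurd (le_height hB hc) (not_le.2 h)

theorem IsRationalBasis.snoc {n e : ℕ} {B : Submodule ℝ (E n)} {w : Fin e → Fin n → ℚ}
    (h : IsRationalBasis B w) {x : Fin n → ℤ} (hx : intVec x ∉ B) :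
    IsRationalBasis (B ⊔ span ℝ {intVec x})
      (Fin.snoc w (fun i => (x i : ℚ)) : Fin (e + 1) → Fin n → ℚ) := by
  have h1 : (fun i => ratVec ((Fin.snoc w (fun i => (x i : ℚ)) : Fin (e + 1) → Fin n → ℚ) i)) =
      Fin.snoc (fun i => ratVec (w i)) (intVec x) := by
    funext i
    refine Fin.lastCases ?_ (fun j => ?_) i
    · simp [ratVec_intCast]
    · simp
  constructor
  · rw [h1, linearIndependent_finSnoc]
    refine ⟨h.1, ?_⟩
    rw [h.2]
    exact hx
  · rw [h1, Fin.range_snoc, span_insert, h.2, sup_comm]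

/-- Adding an integer vector `x` to a rational subspace `B` multiplies the height by at most a
constant times the distance from `x` to `B`. -/
theorem height_sup_span_le {n e : ℕ} {B : Submodule ℝ (E n)} (hB : B ∈ rationalSubspaces n e)
    {x : Fin n → ℤ} (hx : intVec x ∉ B) {b : E n} (hb : b ∈ B) :
    B ⊔ span ℝ {intVec x} ∈ rationalSubspaces n (e + 1) ∧
      height (B ⊔ span ℝ {intVec x}) ≤ heightConst n * height B * ‖intVec x - b‖ := by
  have hmem : B ⊔ span ℝ {intVec x} ∈ rationalSubspaces n (e + 1) := by
    obtain ⟨w, hw⟩ := hB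
    exact ⟨_, hw.snoc hx⟩
  refine ⟨hmem, ?_⟩
  have hK : 0 < heightConst n := lt_of_lt_of_le one_pos (one_le_heightConst n)
  have hpos : 0 < ‖intVec x - b‖ := by
    rw [norm_pos_iff, sub_ne_zero]
    rintro rfl
    exact hx hb
  suffices height (B ⊔ span ℝ {intVec x}) / (heightConst n * ‖intVec x - b‖) ≤ height B by
    rw [div_le_iff₀ (by positivity)] at this
    linarith
  refine le_height hB fun w hw => ?_
  rw [div_le_iff₀ (by positivity)]
  refine (height_le_basisHeight (hw.snoc hx)).trans ?_
  obtain ⟨g, hg, hgn, hm, -⟩ := hw.exists_generator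
  obtain ⟨g', hg', hgn', -, c, hc⟩ := (hw.snoc hx).exists_generator
  have hgg : g ≤ g' := by
    -- the minors of the larger family are integer combinations of the minors of `w`
    choose m hm using hm
    have : ∃ k : ℤ, g' = k * g := by
      refine ⟨∑ I, c I * ∑ a : Fin (e + 1), (-1) ^ ((a : ℕ) + e) * x (I a) *
        m ((Fin.succAboveOrderEmb a).trans I), ?_⟩
      rw [hc]
      push_cast
      rw [Finset.sum_mul]
      refine Finset.sum_congr rfl fun I _ => ?_
      rw [minors_snoc, mul_assoc, Finset.sum_mul]
      congr 1
      refine Finset.sum_congr rfl fun a _ => ?_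
      rw [hm]
      ring
    obtain ⟨k, rfl⟩ := this
    have hk : 0 < k := by
      by_contra! hk
      have : (k : ℚ) ≤ 0 := by exact_mod_cast hk
      nlinarith
    have : (1 : ℚ) ≤ k := by exact_mod_cast hk
    nlinarith
  have hg0 : (0 : ℝ) < g := by exact_mod_cast hg
  have hgg0 : (g : ℝ) ≤ g' := by exact_mod_cast hgg
  have hb' : b.ofLp ∈ span ℝ (Set.range fun i k => (w i k : ℝ)) := by
    have h1 := hw.2
    have h2 : (span ℝ (Set.range fun i => ratVec (w i))).map
        (WithLp.linearEquiv 2 ℝ (Fin n → ℝ)).toLinearMap =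
        span ℝ (Set.range fun i k => (w i k : ℝ)) := by
      rw [Submodule.map_span, ← Set.range_comp]
      rfl
    rw [← h2, h1]
    exact ⟨b, hb, rfl⟩
  have h3 : (fun (i : Fin (e + 1)) (k : Fin n) =>
      (((Fin.snoc w (fun i => (x i : ℚ)) : Fin (e + 1) → Fin n → ℚ) i k : ℚ) : ℝ)) =
      Fin.snoc (fun i k => (w i k : ℝ)) (fun i => intVec x i) := by
    funext i
    refine Fin.lastCases ?_ (fun j => ?_) i
    · simp [intVec]
    · simp
  have h4 := wedgeNorm_snoc_le (fun i k => (w i k : ℝ)) (intVec x) b.ofLp hb'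
  unfold basisHeight
  rw [hgn, hgn', h3]
  have hW : 0 ≤ wedgeNorm (fun i k => (w i k : ℝ)) := Real.sqrt_nonneg _
  calc _ ≤ (heightConst n * wedgeNorm (fun i k => (w i k : ℝ)) * ‖intVec x - b‖) / g := by
        gcongr
    _ = _ := by ring

/-- An integer vector outside a rational subspace `B` is not too close to it. -/
theorem one_le_height_mul_dist {n e : ℕ} {B : Submodule ℝ (E n)} (hB : B ∈ rationalSubspaces n e)
    {x : Fin n → ℤ} (hx : intVec x ∉ B) {b : E n} (hb : b ∈ B) :
    1 ≤ heightConst n * height B * ‖intVec x - b‖ :=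
  (one_le_height (height_sup_span_le hB hx hb).1).trans (height_sup_span_le hB hx hb).2

theorem bot_mem_rationalSubspaces (n : ℕ) : (⊥ : Submodule ℝ (E n)) ∈ rationalSubspaces n 0 :=
  ⟨Fin.elim0, linearIndependent_empty_type, by simp⟩

/-- Northcott's theorem for rational subspaces. -/
theorem finite_height_le (n e : ℕ) (c : ℝ) :
    {B ∈ rationalSubspaces n e | height B ≤ c}.Finite := by
  -- a subspace is determined by its primitive integral Grassmann coordinates
  let F : ((Fin e ↪o Fin n) → ℤ) → Set (E n) := fun η =>
    {x | ∀ I : Fin (e + 1) ↪o Fin n, ∑ a : Fin (e + 1), (-1) ^ ((a : ℕ) + e) * x (I a) *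
        (η ((Fin.succAboveOrderEmb a).trans I) : ℝ) = 0}
  have hfin : (Set.pi Set.univ fun _ : Fin e ↪o Fin n =>
      Set.Icc (-⌈c + 1⌉) ⌈c + 1⌉).Finite :=
    Set.Finite.pi fun _ => Set.finite_Icc _ _
  refine Set.Finite.of_finite_image (f := fun B : Submodule ℝ (E n) => (B : Set (E n)))
    ((hfin.image F).subset ?_) (SetLike.coe_injective.injOn)
  rintro _ ⟨B, ⟨hB, hBc⟩, rfl⟩
  obtain ⟨w, hw, hwc⟩ := exists_basisHeight_lt hB (lt_of_le_of_lt hBc (lt_add_one c))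
  obtain ⟨g, hg, hgn, hm, -⟩ := hw.exists_generator
  choose m hm using hm
  have hg0 : (0 : ℝ) < g := by exact_mod_cast hg
  refine ⟨m, ?_, ?_⟩
  · intro I _
    have h1 := abs_minors_le_wedgeNorm (fun i k => (w i k : ℝ)) I
    unfold basisHeight at hwc
    rw [hgn, div_lt_iff₀ hg0] at hwc
    rw [minors_cast, hm] at h1
    push_cast at h1
    rw [abs_mul, abs_of_pos hg0] at h1
    have h2 : |(m I : ℝ)| < c + 1 := lt_of_mul_lt_mul_right (h1.trans_lt hwc) hg0.le
    rw [Set.mem_Icc, ← abs_le]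
    have h3 := h2.le.trans (Int.le_ceil (c + 1))
    exact_mod_cast h3
  · ext x
    simp only [F, Set.mem_ofPred_eq, SetLike.mem_coe]
    have hli : LinearIndependent ℝ (fun (i : Fin e) (k : Fin n) => (w i k : ℝ)) := by
      rw [linearIndependent_iff_minors_ne_zero]
      obtain ⟨I, hI⟩ := (linearIndependent_ratVec_iff w).1 hw.1
      exact ⟨I, by rw [minors_cast]; exact_mod_cast hI⟩
    have hxB : x ∈ B ↔ x.ofLp ∈ span ℝ (Set.range fun i k => (w i k : ℝ)) := by
      have h2 : (span ℝ (Set.range fun i => ratVec (w i))).map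
          (WithLp.linearEquiv 2 ℝ (Fin n → ℝ)).toLinearMap =
          span ℝ (Set.range fun i k => (w i k : ℝ)) := by
        rw [Submodule.map_span, ← Set.range_comp]
        rfl
      rw [← h2, hw.2]
      exact (Submodule.mem_map_equiv (e := WithLp.linearEquiv 2 ℝ (Fin n → ℝ))
        (x := x.ofLp) B).symm
    have h5 : ∀ I, minors (Fin.snoc (fun i k => (w i k : ℝ)) x.ofLp : Fin (e + 1) → Fin n → ℝ) I =
        g * ∑ a : Fin (e + 1), (-1) ^ ((a : ℕ) + e) * x (I a) *
        (m ((Fin.succAboveOrderEmb a).trans I) : ℝ) := by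
      intro I
      rw [minors_snoc, Finset.mul_sum]
      refine Finset.sum_congr rfl fun a _ => ?_
      rw [minors_cast, hm]
      push_cast
      ring
    rw [hxB]
    constructor
    · intro h
      by_contra hx
      obtain ⟨I, hI⟩ := (linearIndependent_iff_minors_ne_zero _).1
        ((linearIndependent_finSnoc (x := x.ofLp)).2 ⟨hli, hx⟩)
      rw [h5, h I, mul_zero] at hI
      exact hI rfl
    · intro h I
      have := minors_snoc_eq_zero _ _ h I
      rw [h5] at this
      exact (mul_eq_zero.1 this).resolve_left hg0.ne'

/-! ### Angles -/

/-- Every vector `a` of `A` is at distance at most `δ ‖a‖` from `B`. -/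
def NearTo {n : ℕ} (A B : Submodule ℝ (E n)) (δ : ℝ) : Prop :=
  ∀ a ∈ A, ∃ b ∈ B, ‖a - b‖ ≤ δ * ‖a‖

theorem norm_sub_starProjection_le {n : ℕ} (B : Submodule ℝ (E n)) (a : E n) {b : E n}
    (hb : b ∈ B) : ‖a - B.starProjection a‖ ≤ ‖a - b‖ := by
  rw [Submodule.starProjection_minimal]
  exact ciInf_le ⟨0, by rintro _ ⟨x, rfl⟩; positivity⟩ (⟨b, hb⟩ : B)

theorem nearTo_iff {n : ℕ} {A B : Submodule ℝ (E n)} {δ : ℝ} :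
    NearTo A B δ ↔ ∀ a ∈ A, ‖a - B.starProjection a‖ ≤ δ * ‖a‖ := by
  constructor
  · intro h a ha
    obtain ⟨b, hb, hab⟩ := h a ha
    exact (norm_sub_starProjection_le B a hb).trans hab
  · exact fun h a ha => ⟨_, B.starProjection_apply_mem a, h a ha⟩

theorem inner_starProjection_of_mem {n : ℕ} (B : Submodule ℝ (E n)) (a : E n) {b : E n}
    (hb : b ∈ B) : inner ℝ b (B.starProjection a) = inner ℝ b a := by
  have h := Submodule.sub_starProjection_mem_orthogonal (K := B) a b hb
  rw [inner_sub_right] at h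
  linarith

theorem omegaVec_sq {n : ℕ} {x y : E n} (hx : x ≠ 0) (hy : y ≠ 0) :
    omegaVec x y ^ 2 = 1 - inner ℝ x y ^ 2 / (‖x‖ ^ 2 * ‖y‖ ^ 2) := by
  have hx' : ‖x‖ ≠ 0 := norm_ne_zero_iff.2 hx
  have hy' : ‖y‖ ≠ 0 := norm_ne_zero_iff.2 hy
  unfold omegaVec
  rw [div_pow, wedgeNorm_pair_sq]
  field_simp

theorem omegaVec_nonneg {n : ℕ} (x y : E n) : 0 ≤ omegaVec x y :=
  div_nonneg (Real.sqrt_nonneg _) (by positivity)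

theorem omegaVec_le_iff {n : ℕ} {x y x' y' : E n} (hx : x ≠ 0) (hy : y ≠ 0) (hx' : x' ≠ 0)
    (hy' : y' ≠ 0) : omegaVec x y ≤ omegaVec x' y' ↔
      inner ℝ x' y' ^ 2 / (‖x'‖ ^ 2 * ‖y'‖ ^ 2) ≤ inner ℝ x y ^ 2 / (‖x‖ ^ 2 * ‖y‖ ^ 2) := by
  rw [← sq_le_sq₀ (omegaVec_nonneg _ _) (omegaVec_nonneg _ _), omegaVec_sq hx hy,
    omegaVec_sq hx' hy']
  constructor <;> intro h <;> linarith

theorem omegaVec_comm {n : ℕ} {x y : E n} (hx : x ≠ 0) (hy : y ≠ 0) :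
    omegaVec x y = omegaVec y x := by
  apply le_antisymm
  · rw [omegaVec_le_iff hx hy hy hx, real_inner_comm, mul_comm]
  · rw [omegaVec_le_iff hy hx hx hy, real_inner_comm, mul_comm]

theorem omegaVec_le_one {n : ℕ} {x y : E n} (hx : x ≠ 0) (hy : y ≠ 0) : omegaVec x y ≤ 1 := by
  rw [← sq_le_sq₀ (omegaVec_nonneg _ _) zero_le_one, omegaVec_sq hx hy]
  have : 0 ≤ inner ℝ x y ^ 2 / (‖x‖ ^ 2 * ‖y‖ ^ 2) := by positivity
  linarith

/-- `‖x‖ ω(x, y)` is the distance from `x` to the line spanned by `y`. -/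
theorem norm_sub_proj_line {n : ℕ} {x y : E n} (hx : x ≠ 0) (hy : y ≠ 0) :
    ‖x - (inner ℝ x y / ‖y‖ ^ 2) • y‖ = omegaVec x y * ‖x‖ := by
  have hx' : ‖x‖ ≠ 0 := norm_ne_zero_iff.2 hx
  have hy' : ‖y‖ ≠ 0 := norm_ne_zero_iff.2 hy
  rw [← sq_eq_sq₀ (norm_nonneg _) (mul_nonneg (omegaVec_nonneg _ _) (norm_nonneg _)), mul_pow,
    omegaVec_sq hx hy, norm_sub_sq_real, inner_smul_right, norm_smul, mul_pow, Real.norm_eq_abs,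
    sq_abs]
  field_simp
  ring

theorem omegaVec_starProjection {n : ℕ} (B : Submodule ℝ (E n)) {x : E n} (hx : x ≠ 0)
    (hp : B.starProjection x ≠ 0) :
    omegaVec x (B.starProjection x) * ‖x‖ = ‖x - B.starProjection x‖ := by
  have h := inner_starProjection_of_mem B x (B.starProjection_apply_mem x)
  rw [← norm_sub_proj_line hx hp, real_inner_comm, ← h, real_inner_self_eq_norm_sq,
    div_self (by simpa using hp), one_smul]

theorem IsAngleSystem.symm {n t : ℕ} {A B : Submodule ℝ (E n)} {X Y : Fin t → E n}
    (h : IsAngleSystem A B X Y) : IsAngleSystem B A Y X := by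
  intro i
  obtain ⟨hX, hY, hmin⟩ := h i
  refine ⟨hY, hX, fun y hy hy0 hyo x hx hx0 hxo => ?_⟩
  rw [omegaVec_comm hY.2.1 hX.2.1, omegaVec_comm hy0 hx0]
  exact hmin x hx hx0 hxo y hy hy0 hyo

theorem exists_ne_zero_orthogonal {n t : ℕ} (A : Submodule ℝ (E n)) (X : Fin t → E n) (i : Fin t)
    (h : t ≤ finrank ℝ A) : ∃ x ∈ A, ‖x‖ = 1 ∧ ∀ k < i, inner ℝ (X k) x = 0 := by
  let f : A →ₗ[ℝ] ({k // k < i} → ℝ) :=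
    LinearMap.pi fun k => (innerSL ℝ (X k.1)).toLinearMap.comp A.subtype
  have hlt : finrank ℝ ({k // k < i} → ℝ) < finrank ℝ A := by
    rw [finrank_fintype_fun_eq_card]
    have : Fintype.card {k // k < i} = i := by
      rw [Fintype.card_subtype, ← Fin.card_Iio i]
      congr 1
      ext
      simp
    omega
  obtain ⟨x, hx, hx0⟩ := (LinearMap.ker f).ne_bot_iff.1 (LinearMap.ker_ne_bot_of_finrank_lt hlt)
  have hx1 : ‖(x : E n)‖ ≠ 0 := by simpa using hx0
  refine ⟨‖(x : E n)‖⁻¹ • (x : E n), A.smul_mem _ x.2, ?_, fun k hk => ?_⟩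
  · rw [norm_smul, norm_inv, norm_norm, inv_mul_cancel₀ hx1]
  · have := congrFun (LinearMap.mem_ker.1 hx) ⟨k, hk⟩
    rw [inner_smul_right]
    have h2 : inner ℝ (X k) (x : E n) = 0 := by simpa [f] using this
    rw [h2, mul_zero]

theorem exists_angle_step {n t : ℕ} {A B : Submodule ℝ (E n)} (hA : t ≤ finrank ℝ A)
    (hB : t ≤ finrank ℝ B) (X Y : Fin t → E n) (i : Fin t) :
    ∃ x y : E n, (x ∈ A ∧ x ≠ 0 ∧ ∀ k < i, inner ℝ (X k) x = 0) ∧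
      (y ∈ B ∧ y ≠ 0 ∧ ∀ k < i, inner ℝ (Y k) y = 0) ∧
      ∀ x' ∈ A, x' ≠ 0 → (∀ k < i, inner ℝ (X k) x' = 0) →
      ∀ y' ∈ B, y' ≠ 0 → (∀ k < i, inner ℝ (Y k) y' = 0) → omegaVec x y ≤ omegaVec x' y' := by
  have hcomp : ∀ (A : Submodule ℝ (E n)) (X : Fin t → E n),
      IsCompact {x : E n | x ∈ A ∧ ‖x‖ = 1 ∧ ∀ k < i, inner ℝ (X k) x = 0} := by
    intro A X
    apply IsCompact.of_isClosed_subset (isCompact_closedBall (0 : E n) 1)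
    · refine IsClosed.inter (Submodule.closed_of_finiteDimensional A) (IsClosed.inter
        (isClosed_eq continuous_norm continuous_const) ?_)
      have : {x : E n | ∀ k < i, inner ℝ (X k) x = 0} =
          ⋂ k, ⋂ (_ : k < i), {x : E n | inner ℝ (X k) x = 0} := by
        ext; simp
      change IsClosed {x : E n | ∀ k < i, inner ℝ (X k) x = 0}
      rw [this]
      refine isClosed_iInter fun k => isClosed_iInter fun _ => ?_
      exact isClosed_eq (by fun_prop) continuous_const
    · rintro x ⟨-, hx, -⟩
      simp [hx]
  obtain ⟨x0, hx0⟩ := exists_ne_zero_orthogonal A X i hA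
  obtain ⟨y0, hy0⟩ := exists_ne_zero_orthogonal B Y i hB
  obtain ⟨⟨x, y⟩, ⟨hx, hy⟩, hmax⟩ := ((hcomp A X).prod (hcomp B Y)).exists_isMaxOn
    ⟨(x0, y0), hx0, hy0⟩ (f := fun p : E n × E n => inner ℝ p.1 p.2 ^ 2)
    (Continuous.continuousOn (by fun_prop))
  have ne : ∀ z : E n, ‖z‖ = 1 → z ≠ 0 := by
    rintro z hz rfl
    simp at hz
  refine ⟨x, y, ⟨hx.1, ne x hx.2.1, hx.2.2⟩, ⟨hy.1, ne y hy.2.1, hy.2.2⟩, ?_⟩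
  intro x' hx' hx'0 hx'o y' hy' hy'0 hy'o
  rw [omegaVec_le_iff (ne x hx.2.1) (ne y hy.2.1) hx'0 hy'0, hx.2.1, hy.2.1]
  have hnx : ‖x'‖ ≠ 0 := norm_ne_zero_iff.2 hx'0
  have hny : ‖y'‖ ≠ 0 := norm_ne_zero_iff.2 hy'0
  have h1 := hmax (a := (‖x'‖⁻¹ • x', ‖y'‖⁻¹ • y')) ⟨⟨A.smul_mem _ hx', ?_, fun k hk => ?_⟩,
    ⟨B.smul_mem _ hy', ?_, fun k hk => ?_⟩⟩
  · simp only [Set.mem_ofPred_eq, inner_smul_left, inner_smul_right] at h1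
    simp only [one_pow, mul_one, div_one]
    refine le_trans (le_of_eq ?_) h1
    simp
    field_simp
  · rw [norm_smul, norm_inv, norm_norm, inv_mul_cancel₀ hnx]
  · rw [inner_smul_right, hx'o k hk, mul_zero]
  · rw [norm_smul, norm_inv, norm_norm, inv_mul_cancel₀ hny]
  · rw [inner_smul_right, hy'o k hk, mul_zero]

theorem exists_isAngleSystem {n t : ℕ} {A B : Submodule ℝ (E n)} (hA : t ≤ finrank ℝ A)
    (hB : t ≤ finrank ℝ B) : ∃ X Y : Fin t → E n, IsAngleSystem A B X Y := by
  suffices ∀ m ≤ t, ∃ X Y : Fin t → E n, ∀ i : Fin t, i.val < m →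
      (X i ∈ A ∧ X i ≠ 0 ∧ ∀ k < i, inner ℝ (X k) (X i) = 0) ∧
      (Y i ∈ B ∧ Y i ≠ 0 ∧ ∀ k < i, inner ℝ (Y k) (Y i) = 0) ∧
      ∀ x ∈ A, x ≠ 0 → (∀ k < i, inner ℝ (X k) x = 0) →
        ∀ y ∈ B, y ≠ 0 → (∀ k < i, inner ℝ (Y k) y = 0) →
          omegaVec (X i) (Y i) ≤ omegaVec x y by
    obtain ⟨X, Y, h⟩ := this t le_rfl
    exact ⟨X, Y, fun i => h i i.2⟩
  intro m
  induction m with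
  | zero => exact fun _ => ⟨0, 0, fun i hi => absurd hi (by omega)⟩
  | succ m ih =>
    intro hm
    obtain ⟨X, Y, h⟩ := ih (by omega)
    let j : Fin t := ⟨m, hm⟩
    obtain ⟨x, y, hx, hy, hxy⟩ := exists_angle_step hA hB X Y j
    refine ⟨Function.update X j x, Function.update Y j y, fun i hi => ?_⟩
    have hne : ∀ k < i, k ≠ j := fun k hk => by
      have := Fin.lt_def.1 hk
      refine Fin.ne_of_val_ne ?_
      change (k : ℕ) ≠ m
      omega
    have e1 : ∀ k < i, Function.update X j x k = X k := fun k hk =>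
      Function.update_of_ne (hne k hk) _ _
    have e2 : ∀ k < i, Function.update Y j y k = Y k := fun k hk =>
      Function.update_of_ne (hne k hk) _ _
    have e3 : ∀ z, (∀ k < i, inner ℝ (Function.update X j x k) z = 0) ↔
        ∀ k < i, inner ℝ (X k) z = 0 := fun z =>
      forall₂_congr fun k hk => by rw [e1 k hk]
    have e4 : ∀ z, (∀ k < i, inner ℝ (Function.update Y j y k) z = 0) ↔
        ∀ k < i, inner ℝ (Y k) z = 0 := fun z =>
      forall₂_congr fun k hk => by rw [e2 k hk]
    simp only [e3, e4]
    by_cases hij : i = j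
    · subst hij
      simpa using ⟨hx, hy, hxy⟩
    · rw [Function.update_of_ne hij, Function.update_of_ne hij]
      refine h i ?_
      have : (i : ℕ) ≠ m := fun h => hij (Fin.ext h)
      omega

/-- A vector of `A` orthogonal to the first vectors of an angle system on the side of `A` is also
orthogonal to the corresponding vectors on the side of `B`: otherwise the angle could be
decreased. -/
theorem IsAngleSystem.inner_eq_zero {n t : ℕ} {A B : Submodule ℝ (E n)} {X Y : Fin t → E n}
    (h : IsAngleSystem A B X Y) (i : Fin t) {x : E n} (hx : x ∈ A)
    (hxo : ∀ k ≤ i, inner ℝ (X k) x = 0) : inner ℝ x (Y i) = 0 := by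
  obtain ⟨⟨hXA, hX0, hXo⟩, ⟨hYB, hY0, hYo⟩, hmin⟩ := h i
  by_contra hne
  have hx0 : x ≠ 0 := by
    rintro rfl
    simp at hne
  have hx' : 0 < ‖x‖ := norm_pos_iff.2 hx0
  have hX' : 0 < ‖X i‖ := norm_pos_iff.2 hX0
  have hY' : 0 < ‖Y i‖ := norm_pos_iff.2 hY0
  set α : ℝ := inner ℝ (X i) (Y i) / ‖X i‖ ^ 2 with hα
  set β : ℝ := inner ℝ x (Y i) / ‖x‖ ^ 2 with hβ
  have hXx := hxo i le_rfl
  set S : ℝ := inner ℝ (X i) (Y i) ^ 2 / ‖X i‖ ^ 2 + inner ℝ x (Y i) ^ 2 / ‖x‖ ^ 2 with hS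
  have hSpos : 0 < inner ℝ x (Y i) ^ 2 / ‖x‖ ^ 2 := by positivity
  have hSpos' : 0 < S := by
    have : 0 ≤ inner ℝ (X i) (Y i) ^ 2 / ‖X i‖ ^ 2 := by positivity
    linarith
  have e1 : inner ℝ (α • X i + β • x) (Y i) = S := by
    rw [inner_add_left, real_inner_smul_left, real_inner_smul_left, hS, hα, hβ]
    ring
  have e2 : ‖α • X i + β • x‖ ^ 2 = S := by
    rw [norm_add_sq_real, real_inner_smul_left, real_inner_smul_right, hXx, norm_smul, norm_smul,
      mul_pow, mul_pow, Real.norm_eq_abs, Real.norm_eq_abs, sq_abs, sq_abs, hS, hα, hβ]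
    field_simp
    ring
  have hz0 : α • X i + β • x ≠ 0 := by
    intro h0
    rw [h0] at e2
    simp at e2
    linarith
  have h1 := hmin (α • X i + β • x) (A.add_mem (A.smul_mem _ hXA) (A.smul_mem _ hx)) hz0
    (fun k hk => by
      rw [inner_add_right, inner_smul_right, inner_smul_right, hXo k hk, hxo k hk.le]
      simp) (Y i) hYB hY0 hYo
  rw [omegaVec_le_iff hX0 hY0 hz0 hY0, e1, e2] at h1
  have h2 : S ^ 2 / (S * ‖Y i‖ ^ 2) = S / ‖Y i‖ ^ 2 := by
    field_simp
  rw [h2, ← div_div, div_le_div_iff_of_pos_right (by positivity)] at h1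
  linarith

/-- The orthogonal projection on `B` of the vector `X i` is orthogonal to the previous `Y k`, by
`IsAngleSystem.inner_eq_zero`. It therefore competes with `Y i`, so that the closeness of `A` to `B`
bounds all the angles. -/
theorem IsAngleSystem.omegaVec_le {n t : ℕ} {A B : Submodule ℝ (E n)} {X Y : Fin t → E n}
    (h : IsAngleSystem A B X Y) {δ : ℝ} (hδ : NearTo A B δ) (i : Fin t) :
    omegaVec (X i) (Y i) ≤ δ := by
  obtain ⟨⟨hXA, hX0, hXo⟩, ⟨hYB, hY0, hYo⟩, hmin⟩ := h i
  have hX' : 0 < ‖X i‖ := norm_pos_iff.2 hX0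
  have h1 := nearTo_iff.1 hδ (X i) hXA
  by_cases hp : B.starProjection (X i) = 0
  · rw [hp, sub_zero] at h1
    have : 1 ≤ δ := by
      by_contra! h2
      nlinarith
    exact (omegaVec_le_one hX0 hY0).trans this
  · have h2 := hmin (X i) hXA hX0 hXo _ (B.starProjection_apply_mem (X i)) hp (fun k hk => by
      rw [inner_starProjection_of_mem B _ (h k).2.1.1, real_inner_comm]
      exact h.inner_eq_zero k hXA fun l hl => hXo l (lt_of_le_of_lt hl hk))
    rw [← omegaVec_starProjection B hX0 hp] at h1
    exact h2.trans (le_of_mul_le_mul_right h1 hX')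

theorem IsAngleSystem.mono {n t : ℕ} {A B : Submodule ℝ (E n)} {X Y : Fin t → E n}
    (h : IsAngleSystem A B X Y) {i j : Fin t} (hij : i ≤ j) :
    omegaVec (X i) (Y i) ≤ omegaVec (X j) (Y j) :=
  (h i).2.2 _ (h j).1.1 (h j).1.2.1 (fun k hk => (h j).1.2.2 k (hk.trans_le hij)) _ (h j).2.1.1
    (h j).2.1.2.1 (fun k hk => (h j).2.1.2.2 k (hk.trans_le hij))

/-- The vectors `X k` form an orthogonal basis of `A`, each of them being at distance at most
`ω ‖X k‖` from `B`, where `ω` is the largest angle. -/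
theorem IsAngleSystem.nearTo {n t : ℕ} {A B : Submodule ℝ (E n)} {X Y : Fin t → E n}
    (h : IsAngleSystem A B X Y) (ht : finrank ℝ A = t) (i : Fin t) (hi : i.val + 1 = t) :
    NearTo A B (t * omegaVec (X i) (Y i)) := by
  set s := omegaVec (X i) (Y i) with hs
  have hort : ∀ k l, k ≠ l → inner ℝ (X k) (X l) = 0 := by
    intro k l hkl
    rcases lt_or_gt_of_ne hkl with h1 | h1
    · exact (h l).1.2.2 k h1
    · rw [real_inner_comm]; exact (h k).1.2.2 l h1
  have hspan : span ℝ (Set.range X) = A := by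
    apply Submodule.eq_of_le_of_finrank_eq
    · rw [span_le]
      rintro _ ⟨k, rfl⟩
      exact (h k).1.1
    · rw [finrank_span_eq_card (linearIndependent_of_ne_zero_of_inner_eq_zero
        (fun k => (h k).1.2.1) (fun k l hkl => hort k l hkl)), ht]
      simp
  intro a ha
  rw [← hspan, Submodule.mem_span_range_iff_exists_fun] at ha
  obtain ⟨c, rfl⟩ := ha
  let b : Fin t → E n := fun k => (inner ℝ (X k) (Y k) / ‖Y k‖ ^ 2) • Y k
  have hb : ∀ k, ‖X k - b k‖ ≤ s * ‖X k‖ := fun k => by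
    rw [norm_sub_proj_line (h k).1.2.1 (h k).2.1.2.1]
    have : omegaVec (X k) (Y k) ≤ s := h.mono (Fin.le_def.2 (by omega))
    gcongr
  have hc : ∀ k, |c k| * ‖X k‖ ≤ ‖∑ l, c l • X l‖ := by
    intro k
    have h1 : inner ℝ (X k) (∑ l, c l • X l) = c k * ‖X k‖ ^ 2 := by
      rw [inner_sum, Finset.sum_eq_single k]
      · rw [inner_smul_right, real_inner_self_eq_norm_sq]
      · intro l _ hl
        rw [inner_smul_right, hort k l hl.symm, mul_zero]
      · simp
    have h2 := abs_real_inner_le_norm (X k) (∑ l, c l • X l)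
    rw [h1, abs_mul, abs_of_nonneg (by positivity : (0 : ℝ) ≤ ‖X k‖ ^ 2)] at h2
    have h3 : 0 < ‖X k‖ := norm_pos_iff.2 (h k).1.2.1
    nlinarith
  refine ⟨∑ k, c k • b k, B.sum_mem fun k _ => B.smul_mem _ (B.smul_mem _ (h k).2.1.1), ?_⟩
  rw [← Finset.sum_sub_distrib]
  calc _ ≤ ∑ k, ‖c k • X k - c k • b k‖ := norm_sum_le _ _
    _ ≤ ∑ k : Fin t, s * ‖∑ l, c l • X l‖ := by
        refine Finset.sum_le_sum fun k _ => ?_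
        rw [← smul_sub, norm_smul, Real.norm_eq_abs]
        have hs0 : 0 ≤ s := omegaVec_nonneg _ _
        calc |c k| * ‖X k - b k‖ ≤ |c k| * (s * ‖X k‖) := by gcongr; exact hb k
          _ = s * (|c k| * ‖X k‖) := by ring
          _ ≤ _ := by gcongr; exact hc k
    _ = _ := by simp; ring

theorem omega_eq {n : ℕ} {A B : Submodule ℝ (E n)} {t : ℕ}
    (ht : min (finrank ℝ A) (finrank ℝ B) = t) (j : ℕ) :
    omega A B j = sInf {s : ℝ | ∃ X Y : Fin t → E n, IsAngleSystem A B X Y ∧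
      ∃ i : Fin t, i.val + 1 = j ∧ s = omegaVec (X i) (Y i)} := by
  subst ht
  rfl

theorem omega_comm {n : ℕ} (A B : Submodule ℝ (E n)) (j : ℕ) : omega A B j = omega B A j := by
  rw [omega_eq (min_comm (finrank ℝ A) (finrank ℝ B)), omega]
  congr 1
  ext s
  constructor
  · rintro ⟨X, Y, h, i, hi, rfl⟩
    exact ⟨Y, X, h.symm, i, hi, omegaVec_comm (h i).1.2.1 (h i).2.1.2.1⟩
  · rintro ⟨X, Y, h, i, hi, rfl⟩
    exact ⟨Y, X, h.symm, i, hi, omegaVec_comm (h i).1.2.1 (h i).2.1.2.1⟩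

theorem omega_finrank_le {n : ℕ} {A B : Submodule ℝ (E n)} (hAB : finrank ℝ A ≤ finrank ℝ B)
    {δ : ℝ} (hδ : NearTo A B δ) (hA : 0 < finrank ℝ A) : omega A B (finrank ℝ A) ≤ δ := by
  rw [omega_eq (min_eq_left hAB)]
  obtain ⟨X, Y, h⟩ := exists_isAngleSystem le_rfl hAB
  refine csInf_le_of_le ⟨0, ?_⟩ ⟨X, Y, h, ⟨finrank ℝ A - 1, by omega⟩, ?_, rfl⟩
    (h.omegaVec_le hδ _)
  · rintro _ ⟨X, Y, -, i, -, rfl⟩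
    exact omegaVec_nonneg _ _
  · dsimp only
    omega

theorem nearTo_omega_finrank {n : ℕ} {A B : Submodule ℝ (E n)} (hAB : finrank ℝ A ≤ finrank ℝ B)
    (hA : 0 < finrank ℝ A) : NearTo A B (finrank ℝ A * omega A B (finrank ℝ A)) := by
  rw [omega_eq (min_eq_left hAB)]
  obtain ⟨X, Y, h⟩ := exists_isAngleSystem le_rfl hAB
  rw [nearTo_iff]
  intro a ha
  have hA' : (0 : ℝ) < finrank ℝ A := by exact_mod_cast hA
  by_cases ha0 : a = 0
  · simp [ha0]
  have ha' : 0 < ‖a‖ := norm_pos_iff.2 ha0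
  rw [mul_assoc, ← div_le_iff₀' hA', ← div_le_iff₀ ha']
  refine le_csInf ⟨_, X, Y, h, ⟨finrank ℝ A - 1, by omega⟩, ?_, rfl⟩ ?_
  · dsimp only
    omega
  · rintro _ ⟨X, Y, h, i, hi, rfl⟩
    rw [div_le_iff₀ ha', div_le_iff₀' hA', ← mul_assoc]
    exact nearTo_iff.1 (h.nearTo rfl i hi) a ha

theorem psi_eq_omega_of_le {n d e : ℕ} {A B : Submodule ℝ (E n)} (hA : finrank ℝ A = d)
    (hB : finrank ℝ B = e) (hde : d + e ≤ n) (j : ℕ) : psi A B j = omega A B j := by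
  unfold psi g
  rw [hA, hB, Nat.sub_eq_zero_of_le hde, add_zero]

theorem psi_nonneg {n : ℕ} (A B : Submodule ℝ (E n)) (j : ℕ) : 0 ≤ psi A B j := by
  refine Real.sInf_nonneg ?_
  rintro _ ⟨X, Y, -, i, -, rfl⟩
  exact omegaVec_nonneg _ _

/-- Together with `nearTo_psi`, this translates the last angle into the distance of the unit
vectors of the smaller subspace to the larger one: the two quantities agree up to the factor `d`. No
independence of the angles from the choices made in their construction is needed. -/
theorem psi_le {n d e : ℕ} {A B : Submodule ℝ (E n)} (hA : finrank ℝ A = d)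
    (hB : finrank ℝ B = e) (hn : d + e ≤ n) (hd : 0 < d) (hde : d ≤ e) {δ : ℝ}
    (hδ : NearTo A B δ) : psi A B d ≤ δ := by
  rw [psi_eq_omega_of_le hA hB hn]
  subst hA hB
  exact omega_finrank_le hde hδ hd

theorem nearTo_psi {n d e : ℕ} {A B : Submodule ℝ (E n)} (hA : finrank ℝ A = d)
    (hB : finrank ℝ B = e) (hn : d + e ≤ n) (hd : 0 < d) (hde : d ≤ e) :
    NearTo A B (d * psi A B d) := by
  rw [psi_eq_omega_of_le hA hB hn]
  subst hA hB
  exact nearTo_omega_finrank hde hd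

theorem psi_le' {n d e : ℕ} {A B : Submodule ℝ (E n)} (hA : finrank ℝ A = d)
    (hB : finrank ℝ B = e) (hn : d + e ≤ n) (he : 0 < e) (hed : e ≤ d) {δ : ℝ}
    (hδ : NearTo B A δ) : psi A B e ≤ δ := by
  rw [psi_eq_omega_of_le hA hB hn, omega_comm]
  subst hA hB
  exact omega_finrank_le hed hδ he

theorem nearTo_psi' {n d e : ℕ} {A B : Submodule ℝ (E n)} (hA : finrank ℝ A = d)
    (hB : finrank ℝ B = e) (hn : d + e ≤ n) (he : 0 < e) (hed : e ≤ d) :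
    NearTo B A (e * psi A B e) := by
  rw [psi_eq_omega_of_le hA hB hn, omega_comm]
  subst hA hB
  exact nearTo_omega_finrank hed he

/-! ### A lacunary sequence of integer points -/

/-- The exponents `⌊α ^ k⌋`. -/
def lacExp (α : ℝ) (k : ℕ) : ℕ := ⌊α ^ k⌋₊

/-- The denominators `2 ^ ⌊α ^ k⌋`. -/
def lacDen (α : ℝ) (k : ℕ) : ℝ := 2 ^ lacExp α k

theorem two_mul_lacExp_le {α : ℝ} (hα : 15 ≤ α) (k : ℕ) :
    2 * lacExp α k ≤ lacExp α (k + 1) := by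
  unfold lacExp
  apply Nat.le_floor
  have h1 : (⌊α ^ k⌋₊ : ℝ) ≤ α ^ k := Nat.floor_le (by positivity)
  have h2 : 0 ≤ α ^ k := by positivity
  push_cast
  rw [pow_succ]
  nlinarith

theorem one_le_lacExp {α : ℝ} (hα : 15 ≤ α) (k : ℕ) : 1 ≤ lacExp α k := by
  unfold lacExp
  apply Nat.le_floor
  simpa using one_le_pow₀ (by linarith)

theorem lacExp_mono {α : ℝ} (hα : 15 ≤ α) : Monotone (lacExp α) :=
  monotone_nat_of_le_succ fun k => by
    have := two_mul_lacExp_le hα k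
    omega

theorem lacDen_pos (α : ℝ) (k : ℕ) : 0 < lacDen α k := by
  unfold lacDen; positivity

theorem one_le_lacDen (α : ℝ) (k : ℕ) : 1 ≤ lacDen α k :=
  one_le_pow₀ (by norm_num)

theorem lacDen_mono {α : ℝ} (hα : 15 ≤ α) : Monotone (lacDen α) := fun _ _ h =>
  pow_le_pow_right₀ (by norm_num) (lacExp_mono hα h)

theorem lacDen_sq_le {α : ℝ} (hα : 15 ≤ α) (k : ℕ) : lacDen α k ^ 2 ≤ lacDen α (k + 1) := by
  unfold lacDen
  rw [← pow_mul]
  exact pow_le_pow_right₀ (by norm_num) (by linarith [two_mul_lacExp_le hα k])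

theorem two_le_lacDen {α : ℝ} (hα : 15 ≤ α) (k : ℕ) : 2 ≤ lacDen α k := by
  unfold lacDen
  exact le_self_pow₀ (by norm_num) (by have := one_le_lacExp hα k; omega)

theorem two_mul_lacDen_le {α : ℝ} (hα : 15 ≤ α) (k : ℕ) :
    2 * lacDen α k ≤ lacDen α (k + 1) := by
  have := lacDen_sq_le hα k
  have := two_le_lacDen hα k
  nlinarith

/-- The ratios of successive denominators. -/
def lacRatio (α : ℝ) (k : ℕ) : ℝ := lacDen α (k + 1) / lacDen α k

theorem lacRatio_pos (α : ℝ) (k : ℕ) : 0 < lacRatio α k :=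
  div_pos (lacDen_pos _ _) (lacDen_pos _ _)

theorem lacDen_mul_lacRatio (α : ℝ) (k : ℕ) : lacDen α k * lacRatio α k = lacDen α (k + 1) := by
  unfold lacRatio
  field_simp [(lacDen_pos α k).ne']

theorem lacDen_le_lacRatio {α : ℝ} (hα : 15 ≤ α) (k : ℕ) : lacDen α k ≤ lacRatio α k := by
  unfold lacRatio
  rw [le_div_iff₀ (lacDen_pos _ _), ← sq]
  exact lacDen_sq_le hα k

theorem lacRatio_mono {α : ℝ} (hα : 15 ≤ α) : Monotone (lacRatio α) :=
  monotone_nat_of_le_succ fun k => by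
    have h1 : lacRatio α k ≤ lacDen α (k + 1) :=
      div_le_self (lacDen_pos _ _).le (one_le_lacDen _ _)
    exact h1.trans (lacDen_le_lacRatio hα (k + 1))

theorem one_le_lacRatio {α : ℝ} (hα : 15 ≤ α) (k : ℕ) : 1 ≤ lacRatio α k :=
  (one_le_lacDen α k).trans (lacDen_le_lacRatio hα k)

variable (q : ℕ) [NeZero q]

/-- The coordinate which is modified at step `k`: the coordinates other than the one of index `0`
are taken in turn. -/
def slot (k : ℕ) : Fin (q + 1) := Fin.succ (Fin.ofNat q k)

/-- The integer points `X_k`, given by `X_{k+1} = (T_{k+1} / T_k) X_k + e_{slot (k+1)}` where `T_k`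
is the `k`-th denominator. -/
def lacPoint (α : ℝ) : ℕ → Fin (q + 1) → ℤ
  | 0 => Pi.single 0 (2 ^ lacExp α 0)
  | k + 1 => (2 : ℤ) ^ (lacExp α (k + 1) - lacExp α k) • lacPoint α k + Pi.single (slot q (k + 1)) 1

theorem slot_ne_zero (k : ℕ) : slot q k ≠ 0 := Fin.succ_ne_zero _

/-- Any `q` consecutive steps modify all the coordinates of index different from `0`. -/
theorem exists_slot_eq (l : ℕ) {s : Fin (q + 1)} (hs : s ≠ 0) :
    ∃ i < q, slot q (l + i) = s := by
  obtain ⟨s, rfl⟩ := Fin.exists_succ_eq.2 hs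
  have hq : 0 < q := Nat.pos_of_ne_zero (NeZero.ne q)
  have h1 : l % q < q := Nat.mod_lt _ hq
  have hs : (s : ℕ) < q := s.2
  suffices ∃ i < q, (l + i) % q = s by
    obtain ⟨i, hi, h⟩ := this
    refine ⟨i, hi, ?_⟩
    unfold slot
    congr 1
    ext
    simpa using h
  rcases le_or_gt (l % q) s with h | h
  · refine ⟨s - l % q, by omega, ?_⟩
    rw [← Nat.mod_add_mod, Nat.add_sub_cancel' h, Nat.mod_eq_of_lt hs]
  · refine ⟨s + q - l % q, by omega, ?_⟩
    rw [← Nat.mod_add_mod, Nat.add_sub_cancel' (by omega), Nat.add_mod_right, Nat.mod_eq_of_lt hs]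

theorem slot_eq_slot_iff {k l : ℕ} : slot q k = slot q l ↔ k % q = l % q := by
  unfold slot
  rw [Fin.succ_inj, Fin.ext_iff]
  simp

theorem lacPoint_zero_right {α : ℝ} (hα : 15 ≤ α) (k : ℕ) :
    lacPoint q α k 0 = 2 ^ lacExp α k := by
  induction k with
  | zero => simp [lacPoint]
  | succ k ih =>
    have := two_mul_lacExp_le hα k
    simp only [lacPoint, Pi.add_apply, Pi.smul_apply, ih, smul_eq_mul]
    rw [Pi.single_eq_of_ne (slot_ne_zero q _).symm, add_zero, ← pow_add]
    congr 1
    omega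

theorem lacPoint_succ_cast {α : ℝ} (hα : 15 ≤ α) (k : ℕ) (s : Fin (q + 1)) :
    (lacPoint q α (k + 1) s : ℝ) =
      lacRatio α k * lacPoint q α k s + (if s = slot q (k + 1) then 1 else 0) := by
  have := two_mul_lacExp_le hα k
  have h : lacRatio α k = 2 ^ (lacExp α (k + 1) - lacExp α k) := by
    unfold lacRatio lacDen
    rw [div_eq_iff (by positivity), ← pow_add]
    congr 1
    omega
  rw [h]
  simp only [lacPoint, Pi.add_apply, Pi.smul_apply, smul_eq_mul, Pi.single_apply]
  push_cast
  congr 1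

theorem lacPoint_zero_right_cast {α : ℝ} (hα : 15 ≤ α) (k : ℕ) :
    (lacPoint q α k 0 : ℝ) = lacDen α k := by
  rw [lacPoint_zero_right q hα]
  simp [lacDen]

/-- The limit of the points `X_k / T_k`. -/
def lacLimit (α : ℝ) (s : Fin (q + 1)) : ℝ := ⨆ k, (lacPoint q α k s : ℝ) / lacDen α k

theorem lacPoint_succ_div {α : ℝ} (hα : 15 ≤ α) (k : ℕ) (s : Fin (q + 1)) :
    (lacPoint q α (k + 1) s : ℝ) / lacDen α (k + 1) = lacPoint q α k s / lacDen α k +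
      (if s = slot q (k + 1) then 1 / lacDen α (k + 1) else 0) := by
  have h1 := (lacDen_pos α k).ne'
  have h2 := (lacRatio_pos α k).ne'
  rw [lacPoint_succ_cast q hα, ← lacDen_mul_lacRatio]
  split_ifs
  · field_simp
  · rw [add_zero, add_zero]
    field_simp

theorem lacLimit_mem {α : ℝ} (hα : 15 ≤ α) (k : ℕ) (s : Fin (q + 1)) :
    (lacPoint q α k s : ℝ) / lacDen α k ≤ lacLimit q α s ∧
      lacLimit q α s ≤ (lacPoint q α k s : ℝ) / lacDen α k + 2 / lacDen α (k + 1) := by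
  have hmono : Monotone fun k => (lacPoint q α k s : ℝ) / lacDen α k := by
    refine monotone_nat_of_le_succ fun k => ?_
    rw [lacPoint_succ_div q hα]
    have := lacDen_pos α (k + 1)
    split_ifs
    · simp [this.le]
    · simp
  have hanti : Antitone fun k => (lacPoint q α k s : ℝ) / lacDen α k + 2 / lacDen α (k + 1) := by
    refine antitone_nat_of_succ_le fun k => ?_
    rw [lacPoint_succ_div q hα]
    have h1 := lacDen_pos α (k + 1)
    have h2 : 2 / lacDen α (k + 1 + 1) ≤ 1 / lacDen α (k + 1) := by
      rw [div_le_div_iff₀ (lacDen_pos _ _) h1, one_mul]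
      exact two_mul_lacDen_le hα (k + 1)
    have h3 : 2 / lacDen α (k + 1) = 1 / lacDen α (k + 1) + 1 / lacDen α (k + 1) := by ring
    have h4 : 0 < 1 / lacDen α (k + 1) := by positivity
    split_ifs <;> linarith
  have h := hmono.ciSup_mem_iInter_Icc_of_antitone hanti (fun k => by
    have := lacDen_pos α (k + 1)
    simp only [le_add_iff_nonneg_right]
    positivity)
  exact Set.mem_iInter.1 h k

theorem lacLimit_zero {α : ℝ} (hα : 15 ≤ α) : lacLimit q α 0 = 1 := by
  unfold lacLimit
  simp_rw [lacPoint_zero_right_cast q hα, div_self (lacDen_pos α _).ne']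
  simp

/-- `X_k` is very close to `T_k` times the limit point. -/
theorem abs_lacDen_mul_lacLimit_sub_le {α : ℝ} (hα : 15 ≤ α) (k : ℕ) (s : Fin (q + 1)) :
    |lacDen α k * lacLimit q α s - lacPoint q α k s| ≤ 2 / lacRatio α k := by
  obtain ⟨h1, h2⟩ := lacLimit_mem q hα k s
  have hk := lacDen_pos α k
  have hR := lacRatio_pos α k
  rw [div_le_iff₀ hk] at h1
  have h3 : lacDen α k * lacLimit q α s ≤ lacPoint q α k s + 2 / lacRatio α k := by
    calc _ ≤ lacDen α k * ((lacPoint q α k s : ℝ) / lacDen α k + 2 / lacDen α (k + 1)) := by gcongr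
      _ = _ := by
        rw [← lacDen_mul_lacRatio]
        field_simp
  rw [abs_le]
  have : 0 < 2 / lacRatio α k := by positivity
  constructor <;> linarith

theorem lacLimit_nonneg {α : ℝ} (hα : 15 ≤ α) (s : Fin (q + 1)) : 0 ≤ lacLimit q α s := by
  have h1 := (lacLimit_mem q hα 0 s).1
  refine le_trans ?_ h1
  have : (0 : ℝ) ≤ lacPoint q α 0 s := by
    simp only [lacPoint, Pi.single_apply]
    split_ifs <;> simp
  have := lacDen_pos α 0
  positivity

theorem lacLimit_le_one {α : ℝ} (hα : 15 ≤ α) (s : Fin (q + 1)) : lacLimit q α s ≤ 1 := by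
  by_cases hs : s = 0
  · rw [hs, lacLimit_zero q hα]
  · have h1 := (lacLimit_mem q hα 0 s).2
    refine h1.trans ?_
    have h2 : lacPoint q α 0 s = 0 := by simp [lacPoint, hs]
    rw [h2, Int.cast_zero, zero_div, zero_add, div_le_one (lacDen_pos _ _)]
    exact two_le_lacDen hα _

theorem abs_lacPoint_le {α : ℝ} (hα : 15 ≤ α) (k : ℕ) (s : Fin (q + 1)) :
    |(lacPoint q α k s : ℝ)| ≤ 2 * lacDen α k := by
  have h1 := abs_lacDen_mul_lacLimit_sub_le q hα k s
  have h2 : 2 / lacRatio α k ≤ lacDen α k := by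
    rw [div_le_iff₀ (lacRatio_pos _ _), lacDen_mul_lacRatio]
    exact two_le_lacDen hα _
  have h3 := lacLimit_le_one q hα s
  have h4 := lacLimit_nonneg q hα s
  have h5 := lacDen_pos α k
  have h6 := abs_le.1 h1
  rw [abs_le]
  constructor <;> nlinarith

/-- The coordinate modified at step `k + 1` is odd, while the coordinate of index `0` is a power
of `2`. -/
theorem isCoprime_lacPoint {α : ℝ} (hα : 15 ≤ α) (k : ℕ) :
    IsCoprime (lacPoint q α (k + 1) (slot q (k + 1))) (lacPoint q α (k + 1) 0) := by
  rw [lacPoint_zero_right q hα]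
  apply IsCoprime.pow_right
  simp only [lacPoint, Pi.add_apply, Pi.smul_apply, smul_eq_mul, Pi.single_eq_same]
  obtain ⟨m, hm⟩ : ∃ m, lacExp α (k + 1) - lacExp α k = m + 1 := ⟨_, (Nat.succ_pred_eq_of_pos (by
    have := two_mul_lacExp_le hα k
    have := one_le_lacExp hα k
    omega)).symm⟩
  rw [hm]
  refine ⟨1, -(2 ^ m * lacPoint q α k (slot q (k + 1))), ?_⟩
  ring

open Filter Topology in
/-- `⌊α ^ (k + i)⌋ / α ^ k` tends to `α ^ i`: the logarithm of the denominator `T_{k+i}`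
is equivalent to `α ^ (k + i) log 2`. -/
theorem tendsto_lacExp_div {α : ℝ} (hα : 15 ≤ α) (i : ℕ) :
    Tendsto (fun k => (lacExp α (k + i) : ℝ) / α ^ k) atTop (𝓝 (α ^ i)) := by
  have h0 : Tendsto (fun k => α ^ (k + i)) atTop atTop :=
    (tendsto_pow_atTop_atTop_of_one_lt (by linarith)).comp (tendsto_add_atTop_nat i)
  have h1 := (tendsto_nat_floor_div_atTop (R := ℝ)).comp h0
  have h2 := h1.mul_const (α ^ i)
  rw [one_mul] at h2
  refine h2.congr fun k => ?_
  have : α ≠ 0 := by linarith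
  simp only [Function.comp, lacExp, pow_add]
  field_simp

/-! ### Blocks of coordinates -/

/-- The coordinates of `ℝ ^ ((q + 1) * d)` are indexed by pairs `(s, j)`; `blk q d j v` is the
vector whose coordinate of index `(s, j)` is `v s` for each `s`, and whose other coordinates are
zero. In terms of the identification of `ℝ ^ ((q + 1) * d)` with `ℝ ^ (q + 1) ⊗ ℝ ^ d`, this is
`v ⊗ e_j`. -/
def blk (q d : ℕ) (j : Fin d) : (Fin (q + 1) → ℝ) →ₗ[ℝ] E ((q + 1) * d) where
  toFun v := WithLp.toLp 2 fun i => if i.modNat = j then v i.divNat else 0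
  map_add' u v := by
    ext i
    simp only [PiLp.add_apply, Pi.add_apply]
    split_ifs <;> simp
  map_smul' c v := by
    ext i
    simp

/-- The integer vector `x ⊗ e_j`. -/
def intBlk {q d : ℕ} (j : Fin d) (x : Fin (q + 1) → ℤ) : Fin ((q + 1) * d) → ℤ :=
  fun i => if i.modNat = j then x i.divNat else 0

theorem intVec_intBlk {q d : ℕ} (j : Fin d) (x : Fin (q + 1) → ℤ) :
    intVec (intBlk j x) = blk q d j fun s => (x s : ℝ) := by
  ext i
  simp only [intVec, intBlk, blk, LinearMap.coe_mk, AddHom.coe_mk]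
  split_ifs <;> simp

theorem blk_apply {q d : ℕ} (j j' : Fin d) (v : Fin (q + 1) → ℝ) (s : Fin (q + 1)) :
    blk q d j v (finProdFinEquiv (s, j')) = if j' = j then v s else 0 := by
  have h := finProdFinEquiv.symm_apply_apply (s, j')
  simp only [finProdFinEquiv_symm_apply, Prod.mk.injEq] at h
  simp [blk, h.1, h.2]

theorem norm_blk_sq {q d : ℕ} (j : Fin d) (v : Fin (q + 1) → ℝ) :
    ‖blk q d j v‖ ^ 2 = ∑ s, v s ^ 2 := by
  rw [EuclideanSpace.norm_sq_eq, ← finProdFinEquiv.sum_comp, Fintype.sum_prod_type]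
  refine Finset.sum_congr rfl fun s _ => ?_
  rw [Finset.sum_eq_single j]
  · rw [blk_apply, if_pos rfl]; simp
  · intro j' _ h
    rw [blk_apply, if_neg h]; simp
  · simp

theorem norm_blk_le {q d : ℕ} (j : Fin d) (v : Fin (q + 1) → ℝ) {c : ℝ} (h : ∀ s, |v s| ≤ c) :
    ‖blk q d j v‖ ≤ (q + 1) * c := by
  have hc : 0 ≤ c := (abs_nonneg _).trans (h 0)
  refine le_of_sq_le_sq ?_ (by positivity)
  rw [norm_blk_sq]
  calc ∑ s, v s ^ 2 ≤ ∑ _s : Fin (q + 1), c ^ 2 :=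
        Finset.sum_le_sum fun s _ => sq_le_sq.2 (by rw [abs_of_nonneg hc]; exact h s)
    _ = (q + 1) * c ^ 2 := by simp
    _ ≤ ((q + 1) * c) ^ 2 := by
        rw [mul_pow]
        gcongr
        exact le_self_pow₀ (by linarith [Nat.cast_nonneg (α := ℝ) q]) (by norm_num)

theorem eq_top_of_blk_mem {q d : ℕ} {B : Submodule ℝ (E ((q + 1) * d))}
    (h : ∀ j s, blk q d j (Pi.single s 1) ∈ B) : B = ⊤ := by
  rw [eq_top_iff]
  intro x _
  have hx : x = ∑ j, ∑ s, x (finProdFinEquiv (s, j)) • blk q d j (Pi.single s 1) := by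
    ext i
    obtain ⟨⟨s, j⟩, rfl⟩ := finProdFinEquiv.surjective i
    simp only [WithLp.ofLp_sum, WithLp.ofLp_smul, Finset.sum_apply, Pi.smul_apply, blk_apply,
      smul_eq_mul, Pi.single_apply]
    simp
  rw [hx]
  exact B.sum_mem fun j _ => B.sum_mem fun s _ => B.smul_mem _ (h j s)

/-! ### The subspace and the integer points close to it -/

/-- The integer points `X_k ⊗ e_j`. -/
def pt (α : ℝ) (d : ℕ) (j : Fin d) (k : ℕ) : Fin ((q + 1) * d) → ℤ := intBlk j (lacPoint q α k)

/-- The vectors `y ⊗ e_j` where `y` is the limit of the points `X_k / T_k`. -/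
def limVec (α : ℝ) (d : ℕ) (j : Fin d) : E ((q + 1) * d) := blk q d j (lacLimit q α)

/-- The subspace `ℝ y ⊗ ℝ ^ d`, which is the subspace with the prescribed exponents. -/
def limSpace (α : ℝ) (d : ℕ) : Submodule ℝ (E ((q + 1) * d)) :=
  span ℝ (Set.range (limVec q α d))

theorem intVec_pt (α : ℝ) {d : ℕ} (j : Fin d) (k : ℕ) :
    intVec (pt q α d j k) = blk q d j fun s => (lacPoint q α k s : ℝ) := intVec_intBlk _ _

theorem intVec_pt_succ {α : ℝ} (hα : 15 ≤ α) {d : ℕ} (j : Fin d) (k : ℕ) :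
    intVec (pt q α d j (k + 1)) =
      lacRatio α k • intVec (pt q α d j k) + blk q d j (Pi.single (slot q (k + 1)) 1) := by
  rw [intVec_pt, intVec_pt, ← map_smul, ← map_add]
  congr 1
  funext s
  rw [lacPoint_succ_cast q hα]
  simp [Pi.single_apply]

theorem norm_limVec_le {α : ℝ} (hα : 15 ≤ α) {d : ℕ} (j : Fin d) : ‖limVec q α d j‖ ≤ q + 1 := by
  have := norm_blk_le j (lacLimit q α) (c := 1) fun s => by
    rw [abs_of_nonneg (lacLimit_nonneg q hα s)]
    exact lacLimit_le_one q hα s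
  rw [mul_one] at this
  exact this

theorem norm_intVec_pt_le {α : ℝ} (hα : 15 ≤ α) {d : ℕ} (j : Fin d) (k : ℕ) :
    ‖intVec (pt q α d j k)‖ ≤ (q + 1) * (2 * lacDen α k) := by
  rw [intVec_pt]
  exact norm_blk_le _ _ (abs_lacPoint_le q hα k)

theorem norm_smul_limVec_sub_le {α : ℝ} (hα : 15 ≤ α) {d : ℕ} (j : Fin d) (k : ℕ) :
    ‖lacDen α k • limVec q α d j - intVec (pt q α d j k)‖ ≤ (q + 1) * (2 / lacRatio α k) := by
  rw [intVec_pt, limVec, ← map_smul, ← map_sub]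
  exact norm_blk_le _ _ fun s => abs_lacDen_mul_lacLimit_sub_le q hα k s

theorem mem_limSpace {α : ℝ} {d : ℕ} {a : E ((q + 1) * d)} :
    a ∈ limSpace q α d ↔ ∃ v : Fin d → ℝ, a = ∑ j, v j • limVec q α d j := by
  unfold limSpace
  rw [Submodule.mem_span_range_iff_exists_fun]
  exact exists_congr fun _ => eq_comm

theorem limVec_mem (α : ℝ) {d : ℕ} (j : Fin d) : limVec q α d j ∈ limSpace q α d :=
  subset_span ⟨j, rfl⟩

theorem sum_blk_apply {q d : ℕ} (u : Fin d → Fin (q + 1) → ℝ) (s : Fin (q + 1)) (j : Fin d) :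
    (∑ i, blk q d i (u i)) (finProdFinEquiv (s, j)) = u j s := by
  rw [WithLp.ofLp_sum, Finset.sum_apply]
  simp only [blk_apply]
  simp

theorem sum_smul_limVec_apply {α : ℝ} (hα : 15 ≤ α) {d : ℕ} (v : Fin d → ℝ) (j : Fin d) :
    (∑ i, v i • limVec q α d i) (finProdFinEquiv (0, j)) = v j := by
  have : ∑ i, v i • limVec q α d i = ∑ i, blk q d i (v i • lacLimit q α) := by
    simp [limVec]
  rw [this, sum_blk_apply]
  simp [lacLimit_zero q hα]

theorem abs_le_norm_sum_limVec {α : ℝ} (hα : 15 ≤ α) {d : ℕ} (v : Fin d → ℝ) (j : Fin d) :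
    |v j| ≤ ‖∑ i, v i • limVec q α d i‖ := by
  have := PiLp.norm_apply_le (∑ i, v i • limVec q α d i) (finProdFinEquiv (0, j))
  rwa [sum_smul_limVec_apply q hα] at this

theorem finrank_limSpace {α : ℝ} (hα : 15 ≤ α) (d : ℕ) : finrank ℝ (limSpace q α d) = d := by
  have h : LinearIndependent ℝ (limVec q α d) := by
    rw [Fintype.linearIndependent_iff]
    intro v hv j
    have := abs_le_norm_sum_limVec q hα v j
    rw [hv, norm_zero] at this
    exact abs_nonpos_iff.1 this
  unfold limSpace
  rw [finrank_span_eq_card h]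
  simp

/-- If `limSpace` is close to `B`, then so is `X_k ⊗ e_j`, which is close to
`T_k (y ⊗ e_j)`. -/
theorem exists_mem_norm_intVec_pt_sub_le {α : ℝ} (hα : 15 ≤ α) {d : ℕ}
    {B : Submodule ℝ (E ((q + 1) * d))} {δ : ℝ} (hδ0 : 0 ≤ δ) (hδ : NearTo (limSpace q α d) B δ)
    (j : Fin d) (k : ℕ) : ∃ b ∈ B, ‖intVec (pt q α d j k) - b‖ ≤
      (q + 1) * (lacDen α k * δ + 2 / lacRatio α k) := by
  obtain ⟨b, hb, hyb⟩ := hδ _ (limVec_mem q α j)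
  refine ⟨lacDen α k • b, B.smul_mem _ hb, ?_⟩
  have h1 := norm_smul_limVec_sub_le q hα j k
  have h2 : ‖lacDen α k • limVec q α d j - lacDen α k • b‖ ≤ lacDen α k * (δ * (q + 1)) := by
    rw [← smul_sub, norm_smul, Real.norm_eq_abs, abs_of_pos (lacDen_pos α k)]
    have := lacDen_pos α k
    have h3 := norm_limVec_le q hα j
    gcongr
    exact hyb.trans (by gcongr)
  have h3 : intVec (pt q α d j k) - lacDen α k • b =
      (lacDen α k • limVec q α d j - lacDen α k • b) -
        (lacDen α k • limVec q α d j - intVec (pt q α d j k)) := by abel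
  rw [h3]
  refine (norm_sub_le _ _).trans ((add_le_add h2 h1).trans (le_of_eq ?_))
  ring

/-- If the rational subspace `B` is close to `limSpace` but does not contain `X_k ⊗ e_j`, then its
height is large. -/
theorem one_le_height_mul_of_pt_notMem {α : ℝ} (hα : 15 ≤ α) {d e : ℕ}
    {B : Submodule ℝ (E ((q + 1) * d))} (hB : B ∈ rationalSubspaces ((q + 1) * d) e) {δ : ℝ}
    (hδ0 : 0 ≤ δ) (hδ : NearTo (limSpace q α d) B δ) {j : Fin d} {k : ℕ}
    (h : intVec (pt q α d j k) ∉ B) :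
    1 ≤ heightConst ((q + 1) * d) * height B *
      ((q + 1) * (lacDen α k * δ + 2 / lacRatio α k)) := by
  obtain ⟨b, hb, hbx⟩ := exists_mem_norm_intVec_pt_sub_le q hα hδ0 hδ j k
  refine (one_le_height_mul_dist hB h hb).trans ?_
  have := one_le_heightConst ((q + 1) * d)
  have := one_le_height hB
  gcongr

theorem blk_single_slot_mem {α : ℝ} (hα : 15 ≤ α) {d : ℕ} {B : Submodule ℝ (E ((q + 1) * d))}
    {j : Fin d} {k : ℕ} (h : intVec (pt q α d j k) ∈ B) (h' : intVec (pt q α d j (k + 1)) ∈ B) :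
    blk q d j (Pi.single (slot q (k + 1)) 1) ∈ B := by
  rw [intVec_pt_succ q hα] at h'
  exact (B.add_mem_iff_right (B.smul_mem _ h)).1 h'

theorem blk_mem_of_single_mem {q d : ℕ} {B : Submodule ℝ (E ((q + 1) * d))} {j : Fin d}
    {v : Fin (q + 1) → ℝ} (h : ∀ s, v s = 0 ∨ blk q d j (Pi.single s 1) ∈ B) :
    blk q d j v ∈ B := by
  have hv : v = ∑ s, v s • (Pi.single s 1 : Fin (q + 1) → ℝ) := by
    ext t
    simp [Finset.sum_apply, Pi.single_apply]
  rw [hv, map_sum]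
  refine B.sum_mem fun s _ => ?_
  rw [map_smul]
  rcases h s with h | h
  · rw [h, zero_smul]; exact B.zero_mem
  · exact B.smul_mem _ h

/-- The points `X_i` for `i ≥ k` span the whole space, since the difference
`X_{i+1} - (T_{i+1} / T_i) X_i` is a canonical basis vector. -/
theorem eq_top_of_pt_mem {α : ℝ} (hα : 15 ≤ α) {d : ℕ} {B : Submodule ℝ (E ((q + 1) * d))}
    {k : ℕ} (h : ∀ i ≥ k, ∀ j, intVec (pt q α d j i) ∈ B) : B = ⊤ := by
  have h1 : ∀ j, ∀ s ≠ 0, blk q d j (Pi.single s 1) ∈ B := by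
    intro j s hs
    obtain ⟨i, -, rfl⟩ := exists_slot_eq q (k + 1) hs
    rw [show k + 1 + i = (k + i) + 1 by ring]
    exact blk_single_slot_mem q hα (h _ (by omega) j) (h _ (by omega) j)
  refine eq_top_of_blk_mem fun j s => ?_
  by_cases hs : s = 0
  · subst hs
    have h2 : intVec (pt q α d j k) - blk q d j
        (fun s => if s = 0 then 0 else (lacPoint q α k s : ℝ)) =
        lacDen α k • blk q d j (Pi.single 0 1) := by
      rw [intVec_pt, ← map_sub, ← map_smul]
      congr 1
      funext s
      by_cases hs : s = 0
      · subst hs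
        simp [lacPoint_zero_right_cast q hα]
      · simp [hs]
    have h3 : lacDen α k • blk q d j (Pi.single 0 1) ∈ B := by
      rw [← h2]
      refine B.sub_mem (h k le_rfl j) (blk_mem_of_single_mem fun s => ?_)
      by_cases hs : s = 0
      · simp [hs]
      · exact Or.inr (h1 j s hs)
    exact (B.smul_mem_iff (lacDen_pos α k).ne').1 h3
  · exact h1 j s hs

open Filter Topology in
theorem tendsto_lacDen {α : ℝ} (hα : 15 ≤ α) : Tendsto (lacDen α) atTop atTop := by
  refine tendsto_atTop_mono (fun k => ?_) (tendsto_pow_atTop_atTop_of_one_lt one_lt_two)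
  refine pow_le_pow_right₀ (by norm_num) ?_
  induction k with
  | zero => simp
  | succ k ih =>
    have := two_mul_lacExp_le hα k
    have := one_le_lacExp hα k
    omega

open Filter Topology in
theorem tendsto_lacRatio {α : ℝ} (hα : 15 ≤ α) : Tendsto (lacRatio α) atTop atTop :=
  tendsto_atTop_mono (lacDen_le_lacRatio hα) (tendsto_lacDen hα)

/-- No proper rational subspace contains `limSpace`. -/
theorem not_limSpace_le {α : ℝ} (hα : 15 ≤ α) {d e : ℕ} {B : Submodule ℝ (E ((q + 1) * d))}
    (hB : B ∈ rationalSubspaces ((q + 1) * d) e) (he : e < (q + 1) * d) :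
    ¬ limSpace q α d ≤ B := by
  intro hle
  have hδ : NearTo (limSpace q α d) B 0 := fun a ha => ⟨a, hle ha, by simp⟩
  set M := heightConst ((q + 1) * d) * height B * ((q + 1) * 2) with hM
  obtain ⟨k, hk⟩ := Filter.eventually_atTop.1 ((tendsto_lacRatio hα).eventually_gt_atTop M)
  have htop : B = ⊤ := by
    refine eq_top_of_pt_mem q hα (k := k) fun i hi j => ?_
    by_contra h
    have h1 := one_le_height_mul_of_pt_notMem q hα hB le_rfl hδ h
    have h2 : heightConst ((q + 1) * d) * height B *
      ((q + 1) * (lacDen α i * 0 + 2 / lacRatio α i)) = M / lacRatio α i := by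
      rw [hM]; ring
    rw [h2, le_div_iff₀ (lacRatio_pos _ _), one_mul] at h1
    exact absurd (hk i hi) (not_lt.2 h1)
  have := finrank_of_mem_rationalSubspaces hB
  rw [htop] at this
  simp at this
  omega

/-! ### Lower bounds for heights -/

theorem finset_sup_span {n : ℕ} {ι : Type*} [DecidableEq ι] (V : Submodule ℝ (E n))
    (x : ι → E n) (a : ι) (s : Finset ι) :
    V ⊔ span ℝ (x '' (insert a s : Finset ι)) = (V ⊔ span ℝ (x '' s)) ⊔ span ℝ {x a} := by
  rw [Finset.coe_insert, Set.image_insert_eq, span_insert, sup_assoc,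
    sup_comm (span ℝ {x a})]

/-- Adding to a rational subspace finitely many integer vectors at distance at most `ε` multiplies
the height by at most a constant times `ε ^ δ`, where `δ` is the increase of the dimension. -/
theorem exists_height_sup_span_le {n e : ℕ} {V : Submodule ℝ (E n)}
    (hV : V ∈ rationalSubspaces n e) {ι : Type*} (s : Finset ι) (x : ι → Fin n → ℤ) {ε : ℝ}
    (hε : 0 ≤ ε) (hx : ∀ i ∈ s, ∃ b ∈ V, ‖intVec (x i) - b‖ ≤ ε) :
    ∃ f, e ≤ f ∧ f ≤ e + s.card ∧
      V ⊔ span ℝ ((fun i => intVec (x i)) '' s) ∈ rationalSubspaces n f ∧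
      height (V ⊔ span ℝ ((fun i => intVec (x i)) '' s)) ≤
        heightConst n ^ s.card * height V * ε ^ (f - e) := by
  classical
  have hK := one_le_heightConst n
  induction s using Finset.induction_on with
  | empty => exact ⟨e, le_rfl, le_rfl, by simpa using hV, by simp⟩
  | insert a s ha ih =>
    obtain ⟨f, hef, hfe, hf, hH⟩ := ih fun i hi => hx i (Finset.mem_insert_of_mem hi)
    rw [finset_sup_span]
    set W := V ⊔ span ℝ ((fun i => intVec (x i)) '' s) with hW
    have hpos := one_le_height hV
    rw [Finset.card_insert_of_notMem ha]
    by_cases h : intVec (x a) ∈ W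
    · have hW' : W ⊔ span ℝ {intVec (x a)} = W := by
        rw [sup_eq_left, span_singleton_le_iff_mem]
        exact h
      rw [hW']
      refine ⟨f, hef, by omega, hf, hH.trans ?_⟩
      gcongr
      omega
    · obtain ⟨b, hb, hba⟩ := hx a (Finset.mem_insert_self a s)
      obtain ⟨h1, h2⟩ := height_sup_span_le hf h (mem_sup_left hb : b ∈ W)
      refine ⟨f + 1, by omega, by omega, h1, h2.trans ?_⟩
      have hHW := one_le_height hf
      calc heightConst n * height W * ‖intVec (x a) - b‖
          ≤ heightConst n * (heightConst n ^ s.card * height V * ε ^ (f - e)) * ε := by gcongr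
        _ = heightConst n ^ (s.card + 1) * height V * ε ^ (f + 1 - e) := by
          rw [show f + 1 - e = (f - e) + 1 by omega, pow_succ, pow_succ]
          ring

theorem norm_blk_single {q d : ℕ} (j : Fin d) (s : Fin (q + 1)) :
    ‖blk q d j (Pi.single s 1)‖ = 1 := by
  rw [← sq_eq_sq₀ (norm_nonneg _) zero_le_one, norm_blk_sq]
  simp [Pi.single_apply]

/-- The largest of the inverses of the distances at which the missing points are added in the lower
bound for heights: `T_l` if `u = 0`, and `T_{l+u} / T_{l+u-1}` if `u > 0`. -/
def lacStep (α : ℝ) (l : ℕ) : ℕ → ℝ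
  | 0 => lacDen α l
  | u + 1 => lacRatio α (l + u)

theorem one_le_lacStep {α : ℝ} (hα : 15 ≤ α) (l u : ℕ) : 1 ≤ lacStep α l u := by
  cases u with
  | zero => exact one_le_lacDen _ _
  | succ u => exact one_le_lacRatio hα _

theorem lacStep_le_lacRatio {α : ℝ} (hα : 15 ≤ α) (l u : ℕ) :
    lacStep α l u ≤ lacRatio α (l + u) := by
  cases u with
  | zero => exact lacDen_le_lacRatio hα _
  | succ u => exact lacRatio_mono hα (by omega)

/-- The case of a subspace containing `X_l, …, X_{l+q-1}` in each block: a last integer point given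
by Bézout's identity completes these points to a basis of `ℝⁿ`. -/
theorem lacDen_pow_le_height_zero {α : ℝ} (hα : 15 ≤ α) (d : ℕ) {l v : ℕ} (hl : 1 ≤ l)
    {V : Submodule ℝ (E ((q + 1) * d))} (hV : V ∈ rationalSubspaces ((q + 1) * d) v)
    (hX : ∀ i < q, ∀ j, intVec (pt q α d j (l + i)) ∈ V) :
    q * d ≤ v ∧ lacDen α l ^ d ≤
      heightConst ((q + 1) * d) ^ d * height V * lacDen α l ^ (v - q * d) := by
  obtain ⟨m, rfl⟩ : ∃ m, l = m + 1 := ⟨l - 1, by omega⟩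
  obtain ⟨a, b, hab⟩ := isCoprime_lacPoint q hα m
  have hq : 0 < q := Nat.pos_of_ne_zero (NeZero.ne q)
  set σ := slot q (m + 1) with hσ
  have hσ0 : σ ≠ 0 := slot_ne_zero q _
  set T := lacDen α (m + 1) with hT
  have hTpos : 0 < T := lacDen_pos _ _
  set x : ℝ := ((lacPoint q α (m + 1) σ : ℤ) : ℝ) with hx
  have hT0 : (lacPoint q α (m + 1) 0 : ℝ) = T := lacPoint_zero_right_cast q hα _
  have habR : (a : ℝ) * x + b * T = 1 := by
    rw [← hT0, hx]
    exact_mod_cast hab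
  -- In the plane of the coordinates `0` and `σ`, the vector `z` completes the primitive vector
  -- `(T, x)` to a basis of the lattice.
  let z : Fin (q + 1) → ℤ := Pi.single 0 (-a) + Pi.single σ b
  have hz : ∀ j, intVec (intBlk j z) =
      (-a : ℝ) • blk q d j (Pi.single 0 1) + (b : ℝ) • blk q d j (Pi.single σ 1) := by
    intro j
    rw [intVec_intBlk, ← map_smul, ← map_smul, ← map_add]
    congr 1
    funext s
    simp only [z, Pi.add_apply, Pi.smul_apply, Pi.single_apply, smul_eq_mul]
    split_ifs <;> simp
  -- The steps from `X_l` to `X_{l+q-1}` modify all the coordinates other than `0` and `σ`.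
  have hsingle : ∀ j, ∀ s, s ≠ 0 → s ≠ σ → blk q d j (Pi.single s 1) ∈ V := by
    intro j s hs hs'
    obtain ⟨i, hi, rfl⟩ := exists_slot_eq q (m + 1) hs
    obtain ⟨i, rfl⟩ : ∃ i', i = i' + 1 := ⟨i - 1, by
      rcases Nat.eq_zero_or_pos i with h | h
      · subst h
        exact absurd rfl hs'
      · omega⟩
    have h1 := hX i (by omega) j
    have h2 := hX (i + 1) hi j
    exact blk_single_slot_mem q hα h1 h2
  have hw : ∀ j, T • blk q d j (Pi.single 0 1) + x • blk q d j (Pi.single σ 1) ∈ V := by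
    intro j
    have h1 : T • blk q d j (Pi.single 0 1) + x • blk q d j (Pi.single σ 1) =
        intVec (pt q α d j (m + 1)) - blk q d j
          (fun s => if s = 0 ∨ s = σ then 0 else (lacPoint q α (m + 1) s : ℝ)) := by
      rw [intVec_pt, ← map_sub, ← map_smul, ← map_smul, ← map_add]
      congr 1
      funext s
      simp only [Pi.add_apply, Pi.smul_apply, Pi.single_apply, smul_eq_mul, Pi.sub_apply]
      by_cases h0 : s = 0
      · subst h0
        simp [hσ0.symm, hT0]
      · by_cases h1 : s = σ
        · simp [h1, hσ0, x]
        · simp [h0, h1]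
    rw [h1]
    refine V.sub_mem (by simpa using hX 0 hq j) (blk_mem_of_single_mem fun s => ?_)
    by_cases h : s = 0 ∨ s = σ
    · simp [h]
    · push Not at h
      exact Or.inr (hsingle j s h.1 h.2)
  -- The vectors `z ⊗ e_j` are at distance at most `1 / T` from `V` and span `ℝⁿ` together with `V`,
  -- so that `1 ≤ H(ℝⁿ) ≤ K ^ d H(V) T ^ (-(n - v))`.
  obtain ⟨f, hvf, hfv, hf, hH⟩ := exists_height_sup_span_le hV Finset.univ
    (fun j : Fin d => intBlk j z) (ε := 1 / T) (by positivity) (fun j _ => by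
      refine ⟨(-a / T : ℝ) • (T • blk q d j (Pi.single 0 1) + x • blk q d j (Pi.single σ 1)),
        V.smul_mem _ (hw j), ?_⟩
      have h1 : intVec (intBlk j z) -
          (-a / T : ℝ) • (T • blk q d j (Pi.single 0 1) + x • blk q d j (Pi.single σ 1)) =
          (1 / T) • blk q d j (Pi.single σ 1) := by
        rw [hz, ← habR, smul_add, smul_smul, smul_smul, div_mul_cancel₀ _ hTpos.ne',
          add_sub_add_left_eq_sub, ← sub_smul]
        congr 1
        field_simp
        ring
      rw [h1, norm_smul, norm_blk_single, mul_one, Real.norm_eq_abs, abs_of_pos (by positivity)])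
  set V' := V ⊔ span ℝ ((fun j : Fin d => intVec (intBlk j z)) '' (Finset.univ : Finset (Fin d)))
    with hV'
  have hzV : ∀ j, intVec (intBlk j z) ∈ V' := fun j =>
    mem_sup_right (subset_span ⟨j, by simp, rfl⟩)
  have htop : V' = ⊤ := by
    refine eq_top_of_blk_mem fun j s => ?_
    by_cases h0 : s = 0
    · subst h0
      have h1 : (b : ℝ) • (T • blk q d j (Pi.single 0 1) + x • blk q d j (Pi.single σ 1)) -
          x • intVec (intBlk j z) = (a * x + b * T : ℝ) • blk q d j (Pi.single 0 1) := by
        rw [hz]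
        module
      rw [habR, one_smul] at h1
      have h2 := V'.sub_mem (V'.smul_mem (b : ℝ) (mem_sup_left (hw j))) (V'.smul_mem x (hzV j))
      rwa [h1] at h2
    · by_cases h1 : s = σ
      · rw [h1]
        have h1 : T • intVec (intBlk j z) + (a : ℝ) •
            (T • blk q d j (Pi.single 0 1) + x • blk q d j (Pi.single σ 1)) =
            (a * x + b * T : ℝ) • blk q d j (Pi.single σ 1) := by
          rw [hz]
          module
        rw [habR, one_smul] at h1
        have h2 := V'.add_mem (V'.smul_mem T (hzV j)) (V'.smul_mem (a : ℝ) (mem_sup_left (hw j)))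
        rwa [h1] at h2
      · exact mem_sup_left (hsingle j s h0 h1)
  have hfn : f = q * d + d := by
    have := finrank_of_mem_rationalSubspaces hf
    rw [htop] at this
    simp only [finrank_top, finrank_euclideanSpace, Fintype.card_fin] at this
    rw [← this]; ring
  rw [Finset.card_univ, Fintype.card_fin] at hfv hH
  have hqv : q * d ≤ v := by omega
  refine ⟨hqv, ?_⟩
  have h1 := (one_le_height hf).trans hH
  have h2 : T ^ d = T ^ (f - v) * T ^ (v - q * d) := by
    rw [← pow_add]
    congr 1
    omega
  rw [h2]
  rw [one_div, inv_pow, ← div_eq_mul_inv, one_le_div (by positivity)] at h1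
  gcongr

/-- A rational subspace which contains `X_{l+u}, …, X_{l+q-1}` in each block has a large height. The
missing points `X_{l+u-1}, …, X_l` are added one after the other. -/
theorem lacDen_pow_le_height {α : ℝ} (hα : 15 ≤ α) (d u : ℕ) (hu : u < q) :
    ∃ C : ℝ, 0 < C ∧ ∀ l v, 1 ≤ l → ∀ V ∈ rationalSubspaces ((q + 1) * d) v,
      (∀ i, u ≤ i → i < q → ∀ j, intVec (pt q α d j (l + i)) ∈ V) →
      (q - u) * d ≤ v ∧
        lacDen α (l + u) ^ d ≤ C * height V * lacStep α l u ^ (v - (q - u) * d) := by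
  have hK : 0 < heightConst ((q + 1) * d) := lt_of_lt_of_le one_pos (one_le_heightConst _)
  induction u with
  | zero =>
    refine ⟨heightConst ((q + 1) * d) ^ d, by positivity, fun l v hl V hV hX => ?_⟩
    exact lacDen_pow_le_height_zero q hα d hl hV fun i hi j => hX i (by omega) hi j
  | succ u ih =>
    obtain ⟨C, hC, ih⟩ := ih (by omega)
    refine ⟨C * heightConst ((q + 1) * d) ^ d, by positivity, fun l v hl V hV hX => ?_⟩
    set R := lacRatio α (l + u) with hR
    have hRpos : 0 < R := lacRatio_pos _ _
    -- The point `X_{l+u}` is at distance `1 / R` from the line spanned by `X_{l+u+1}`.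
    obtain ⟨f, hvf, hfv, hf, hH⟩ := exists_height_sup_span_le hV Finset.univ
      (fun j : Fin d => pt q α d j (l + u)) (ε := 1 / R) (by positivity) (fun j _ => by
        refine ⟨R⁻¹ • intVec (pt q α d j (l + (u + 1))), V.smul_mem _ (hX _ le_rfl hu j), ?_⟩
        rw [← add_assoc, intVec_pt_succ q hα, smul_add, smul_smul, inv_mul_cancel₀ hRpos.ne',
          one_smul, sub_add_cancel_left, norm_neg, norm_smul, norm_blk_single]
        simp [abs_of_pos hRpos])
    set V' := V ⊔ span ℝ ((fun j : Fin d => intVec (pt q α d j (l + u))) ''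
      (Finset.univ : Finset (Fin d))) with hV'
    obtain ⟨h1, h2⟩ := ih l f hl V' hf fun i hi hiq j => by
      rcases Nat.eq_or_lt_of_le hi with rfl | hi
      · exact mem_sup_right (subset_span ⟨j, by simp, rfl⟩)
      · exact mem_sup_left (hX i hi hiq j)
    rw [Finset.card_univ, Fintype.card_fin] at hfv hH
    have hm : (q - u) * d = (q - (u + 1)) * d + d := by
      rw [show q - u = (q - (u + 1)) + 1 by omega]
      ring
    rw [hm] at h1 h2
    set m := (q - (u + 1)) * d with hm'
    refine ⟨by omega, ?_⟩
    have h3 : lacStep α l u ^ (f - (m + d)) ≤ R ^ (f - (m + d)) := by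
      have := one_le_lacStep hα l u
      gcongr
      exact lacStep_le_lacRatio hα l u
    have hHpos := one_le_height hf
    have h4 : R ^ (f - (m + d)) * R ^ d = R ^ (f - v) * R ^ (v - m) := by
      rw [← pow_add, ← pow_add]
      congr 1
      omega
    rw [← add_assoc, ← lacDen_mul_lacRatio, mul_pow]
    change _ ≤ C * heightConst ((q + 1) * d) ^ d * height V * R ^ (v - m)
    rw [one_div, inv_pow] at hH
    calc lacDen α (l + u) ^ d * R ^ d
        ≤ (C * height V' * R ^ (f - (m + d))) * R ^ d := by
          gcongr
          exact h2.trans (by gcongr)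
      _ = C * height V' * (R ^ (f - v) * R ^ (v - m)) := by rw [← h4]; ring
      _ ≤ C * (heightConst ((q + 1) * d) ^ d * height V * (R ^ (f - v))⁻¹) *
          (R ^ (f - v) * R ^ (v - m)) := by gcongr
      _ = _ := by
        field_simp

open Filter Topology

/-! ### Comparison of growth rates -/

theorem log_lacDen (α : ℝ) (k : ℕ) : Real.log (lacDen α k) = lacExp α k * Real.log 2 := by
  unfold lacDen
  rw [Real.log_pow]

theorem tendsto_log_lacDen_div {α : ℝ} (hα : 15 ≤ α) (i : ℕ) :
    Tendsto (fun k => Real.log (lacDen α (k + i)) / α ^ k) atTop (𝓝 (α ^ i * Real.log 2)) := by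
  refine ((tendsto_lacExp_div hα i).mul_const (Real.log 2)).congr fun k => ?_
  rw [log_lacDen]
  ring

/-- Comparison of two sequences of the order of `α ^ k`: an additive constant is
negligible. -/
theorem eventually_add_lt_of_tendsto_div {α : ℝ} (hα : 15 ≤ α) {F G : ℕ → ℝ} {a b : ℝ}
    (hF : Tendsto (fun k => F k / α ^ k) atTop (𝓝 a))
    (hG : Tendsto (fun k => G k / α ^ k) atTop (𝓝 b)) (hab : a < b) (c : ℝ) :
    ∀ᶠ k in atTop, F k + c < G k := by
  have hc : Tendsto (fun k : ℕ => c / α ^ k) atTop (𝓝 0) :=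
    tendsto_const_nhds.div_atTop (tendsto_pow_atTop_atTop_of_one_lt (by linarith))
  have h := hF.add hc
  rw [add_zero] at h
  filter_upwards [h.eventually_lt hG hab] with k hk
  have : 0 < α ^ k := by positivity
  rw [← add_div, div_lt_div_iff_of_pos_right this] at hk
  exact hk

/-! ### Diophantine exponents -/

/-- The exponent is the threshold `μ₀` between the `μ` for which the set of approximations is
infinite and those for which it is finite. -/
theorem exponent_eq_of_forall {n : ℕ} {A : Submodule ℝ (E n)} {e j : ℕ} {μ₀ : ℝ} (hμ₀ : 0 < μ₀)
    (hlt : ∀ μ, 0 < μ → μ < μ₀ →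
      {B ∈ rationalSubspaces n e | psi A B j ≤ 1 / height B ^ μ}.Infinite)
    (hgt : ∀ μ, μ₀ < μ → {B ∈ rationalSubspaces n e | psi A B j ≤ 1 / height B ^ μ}.Finite) :
    exponent A e j = (μ₀ : EReal) := by
  unfold exponent
  apply le_antisymm
  · refine sSup_le ?_
    rintro _ ⟨μ, ⟨-, hμ⟩, rfl⟩
    refine EReal.coe_le_coe_iff.2 ?_
    by_contra! h
    exact hμ (hgt μ h)
  · refine le_of_forall_lt fun c hc => ?_
    obtain ⟨x, hcx, hx⟩ := EReal.lt_iff_exists_real_btwn.1 hc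
    have hx' : x < μ₀ := EReal.coe_lt_coe_iff.1 hx
    have hm : 0 < max x (μ₀ / 2) := lt_max_of_lt_right (by positivity)
    have hm' : max x (μ₀ / 2) < μ₀ := max_lt hx' (by linarith)
    refine lt_of_lt_of_le hcx (le_trans (EReal.coe_le_coe_iff.2 (le_max_left x (μ₀ / 2))) ?_)
    exact le_sSup ⟨_, ⟨hm, hlt _ hm hm'⟩, rfl⟩

/-- A set on which a positive function takes arbitrarily small values is infinite. -/
theorem infinite_of_forall_exists_lt {ι : Type*} {S : Set ι} {f : ι → ℝ} (hpos : ∀ i ∈ S, 0 < f i)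
    (h : ∀ ε > 0, ∃ i ∈ S, f i < ε) : S.Infinite := by
  intro hfin
  obtain ⟨i, hi, -⟩ := h 1 one_pos
  obtain ⟨m, hm, hmin⟩ := Set.exists_min_image S f hfin ⟨i, hi⟩
  obtain ⟨j, hj, hlt⟩ := h (f m) (hpos m hm)
  exact absurd (hmin j hj) (not_le.2 hlt)

/-! ### Enlarging rational subspaces -/

/-- A rational subspace is contained in rational subspaces of each larger dimension whose heights
are not much larger. -/
theorem exists_rational_ge {n v : ℕ} {V : Submodule ℝ (E n)} (hV : V ∈ rationalSubspaces n v)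
    (m : ℕ) (hm : v + m ≤ n) : ∃ W ∈ rationalSubspaces n (v + m), V ≤ W ∧
      height W ≤ heightConst n ^ m * height V := by
  induction m with
  | zero => exact ⟨V, hV, le_rfl, by simp⟩
  | succ m ih =>
    obtain ⟨W, hW, hVW, hH⟩ := ih (by omega)
    have hex : ∃ i, intVec (Pi.single i 1 : Fin n → ℤ) ∉ W := by
      by_contra! h
      have htop : W = ⊤ := by
        rw [eq_top_iff]
        intro x _
        have hx : x = ∑ i, x i • intVec (Pi.single i 1 : Fin n → ℤ) := by
          ext k
          simp [intVec, Pi.single_apply]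
        rw [hx]
        exact W.sum_mem fun i _ => W.smul_mem _ (h i)
      have := finrank_of_mem_rationalSubspaces hW
      rw [htop] at this
      simp at this
      omega
    obtain ⟨i, hi⟩ := hex
    obtain ⟨h1, h2⟩ := height_sup_span_le hW hi W.zero_mem
    refine ⟨_, h1, hVW.trans le_sup_left, h2.trans ?_⟩
    have hnorm : ‖intVec (Pi.single i 1 : Fin n → ℤ) - 0‖ = 1 := by
      have : intVec (Pi.single i 1 : Fin n → ℤ) = EuclideanSpace.single i (1 : ℝ) := by
        ext k
        simp [intVec, Pi.single_apply]
      rw [sub_zero, this]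
      simp
    have := one_le_heightConst n
    rw [hnorm, mul_one, pow_succ]
    calc heightConst n * height W ≤ heightConst n * (heightConst n ^ m * height V) := by gcongr
      _ = _ := by ring

theorem norm_limVec_sub_le {α : ℝ} (hα : 15 ≤ α) {d : ℕ} (j : Fin d) (k : ℕ) :
    ‖limVec q α d j - (lacDen α k)⁻¹ • intVec (pt q α d j k)‖ ≤
      (q + 1) * (2 / lacDen α (k + 1)) := by
  have hT := lacDen_pos α k
  have hR := lacRatio_pos α k
  have h1 : limVec q α d j - (lacDen α k)⁻¹ • intVec (pt q α d j k) =
      (lacDen α k)⁻¹ • (lacDen α k • limVec q α d j - intVec (pt q α d j k)) := by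
    rw [smul_sub, smul_smul, inv_mul_cancel₀ hT.ne', one_smul]
  rw [h1, norm_smul, norm_inv, Real.norm_eq_abs, abs_of_pos hT, ← lacDen_mul_lacRatio]
  calc (lacDen α k)⁻¹ * _ ≤ (lacDen α k)⁻¹ * ((q + 1) * (2 / lacRatio α k)) := by
        gcongr
        exact norm_smul_limVec_sub_le q hα j k
    _ = _ := by field_simp

theorem norm_sum_limVec_sub_le {α : ℝ} (hα : 15 ≤ α) {d : ℕ} (v : Fin d → ℝ) (k : ℕ) :
    ‖∑ j, v j • limVec q α d j - ∑ j, (v j * (lacDen α k)⁻¹) • intVec (pt q α d j k)‖ ≤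
      d * ((q + 1) * (2 / lacDen α (k + 1))) * ‖∑ j, v j • limVec q α d j‖ := by
  have hT := lacDen_pos α (k + 1)
  rw [← Finset.sum_sub_distrib]
  refine (norm_sum_le _ _).trans ?_
  calc _ ≤ ∑ j : Fin d, ‖∑ j, v j • limVec q α d j‖ * ((q + 1) * (2 / lacDen α (k + 1))) := by
        refine Finset.sum_le_sum fun j _ => ?_
        rw [mul_smul, ← smul_sub, norm_smul, Real.norm_eq_abs]
        gcongr
        · exact abs_le_norm_sum_limVec q hα v j
        · exact norm_limVec_sub_le q hα j k
    _ = _ := by simp; ring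

/-- A subspace which contains `X_k` in each block is within a constant times `1 / T_{k+1}` of
`limSpace`. -/
theorem nearTo_of_pt_mem {α : ℝ} (hα : 15 ≤ α) {d : ℕ} {B : Submodule ℝ (E ((q + 1) * d))} {k : ℕ}
    (h : ∀ j, intVec (pt q α d j k) ∈ B) :
    NearTo (limSpace q α d) B (d * ((q + 1) * (2 / lacDen α (k + 1)))) := by
  intro a ha
  obtain ⟨v, rfl⟩ := (mem_limSpace q).1 ha
  exact ⟨_, B.sum_mem fun j _ => B.smul_mem _ (h j), norm_sum_limVec_sub_le q hα v k⟩

/-! ### The exponents in dimension at least `d` -/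

/-- A matrix close to the identity has independent rows, being strictly diagonally dominant. -/
theorem linearIndependent_of_near_one {d : ℕ} (w : Fin d → Fin d → ℝ) {η : ℝ}
    (h : ∀ i j, |w i j - (if j = i then 1 else 0)| ≤ η) (hη : d * η < 1) :
    LinearIndependent ℝ w := by
  rw [Fintype.linearIndependent_iff]
  intro c hc i
  obtain ⟨m, -, hm⟩ := Finset.exists_max_image Finset.univ (fun i => |c i|) ⟨i, Finset.mem_univ i⟩
  have h1 : c m = ∑ i, c i * ((if m = i then 1 else 0) - w i m) := by
    have h2 := congrFun hc m
    simp only [Finset.sum_apply, Pi.smul_apply, smul_eq_mul, Pi.zero_apply] at h2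
    simp_rw [mul_sub]
    rw [Finset.sum_sub_distrib, h2]
    simp
  have h2 : |c m| ≤ d * η * |c m| := by
    conv_lhs => rw [h1]
    refine (Finset.abs_sum_le_sum_abs _ _).trans ?_
    calc _ ≤ ∑ _i : Fin d, |c m| * η := by
          refine Finset.sum_le_sum fun i _ => ?_
          rw [abs_mul, abs_sub_comm]
          exact mul_le_mul (hm i (Finset.mem_univ i)) (h i m) (abs_nonneg _) (abs_nonneg _)
      _ = _ := by simp; ring
  have h3 : |c m| ≤ 0 := by
    by_contra! h4
    nlinarith
  have h4 := (hm i (Finset.mem_univ i)).trans h3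
  exact abs_nonpos_iff.1 h4

/-- The linear forms `v_{s,j} - c v_{0,j}`, for all `j`. -/
def coordForm {q : ℕ} (d : ℕ) (s : Fin (q + 1)) (c : ℝ) : E ((q + 1) * d) →ₗ[ℝ] (Fin d → ℝ) where
  toFun v j := v (finProdFinEquiv (s, j)) - c * v (finProdFinEquiv (0, j))
  map_add' u v := by
    ext j
    simp
    ring
  map_smul' a v := by
    ext j
    simp
    ring

theorem coordForm_blk {q d : ℕ} (s : Fin (q + 1)) (c : ℝ) (j j' : Fin d) (v : Fin (q + 1) → ℝ) :
    coordForm d s c (blk q d j v) j' = if j' = j then v s - c * v 0 else 0 := by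
  simp only [coordForm, LinearMap.coe_mk, AddHom.coe_mk, blk_apply]
  split_ifs <;> simp

theorem abs_coordForm_le {q d : ℕ} (s : Fin (q + 1)) {c : ℝ} (hc : |c| ≤ 2) (v : E ((q + 1) * d))
    (j : Fin d) : |coordForm d s c v j| ≤ 3 * ‖v‖ := by
  have h1 := PiLp.norm_apply_le v (finProdFinEquiv (s, j))
  have h2 := PiLp.norm_apply_le v (finProdFinEquiv (0, j))
  rw [Real.norm_eq_abs] at h1 h2
  simp only [coordForm, LinearMap.coe_mk, AddHom.coe_mk]
  refine (abs_sub _ _).trans ?_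
  rw [abs_mul]
  nlinarith [abs_nonneg (v (finProdFinEquiv (0, j))), abs_nonneg c]

/-- A subspace which contains `X_{l+u}, …, X_{l+q-1}` in each block, and whose dimension is too
small for it to contain `X_{l+q}` in addition, is not too close to `limSpace`. Suitable linear forms
vanish at the given points, so that the vectors of the subspace close to `X_{l+q} ⊗ e_j`, for all
`j`, would be independent modulo the span of these points. -/
theorem one_le_of_pt_mem {α : ℝ} (hα : 15 ≤ α) {d l u : ℕ} (hl : 1 ≤ l) (hu : u < q)
    {B : Submodule ℝ (E ((q + 1) * d))} (hB : finrank ℝ B < (q - u + 1) * d) {δ : ℝ} (hδ0 : 0 ≤ δ)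
    (hδ : NearTo (limSpace q α d) B δ)
    (hX : ∀ i, u ≤ i → i < q → ∀ j, intVec (pt q α d j (l + i)) ∈ B) :
    1 ≤ d * (3 * ((q + 1) * (lacDen α (l + q) * δ + 2 / lacRatio α (l + q)))) := by
  set ε := (q + 1) * (lacDen α (l + q) * δ + 2 / lacRatio α (l + q)) with hε
  by_contra! hlt
  set s := slot q (l + q) with hs
  have hs0 : s ≠ 0 := slot_ne_zero q _
  set T := lacDen α (l + u) with hT
  have hTpos : 0 < T := lacDen_pos _ _
  -- From `X_{l+u}` to `X_{l+q-1}`, the coordinate `s` is not modified, hence it keeps a constant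
  -- ratio `c` to the coordinate of index `0`. It changes at the step from `X_{l+q-1}` to `X_{l+q}`.
  set c : ℝ := (lacPoint q α (l + u) s : ℝ) / T with hc
  have hc2 : |c| ≤ 2 := by
    rw [hc, abs_div, abs_of_pos hTpos, div_le_iff₀ hTpos]
    exact abs_lacPoint_le q hα _ _
  set π := coordForm d s c with hπ
  have hπ0 : ∀ i, u ≤ i → i < q → ∀ j, π (intVec (pt q α d j (l + i))) = 0 := by
    intro i hui
    induction i, hui using Nat.le_induction with
    | base =>
      intro _ j
      ext j'
      rw [intVec_pt, hπ, coordForm_blk, lacPoint_zero_right_cast q hα, hc]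
      split_ifs
      · rw [div_mul_cancel₀ _ hTpos.ne', sub_self]; rfl
      · rfl
    | succ i hui ih =>
      intro hi j
      rw [← add_assoc, intVec_pt_succ q hα, map_add, map_smul, ih (by omega), smul_zero, zero_add]
      ext j'
      have hne : s ≠ slot q (l + i + 1) := by
        rw [hs, Ne, slot_eq_slot_iff]
        intro h
        have h1 : (l + q) ≡ (l + i + 1) [MOD q] := h
        have h2 : q ≡ i + 1 [MOD q] := Nat.ModEq.add_left_cancel' l (by rwa [← add_assoc])
        have h3 : (q : ℕ) % q = (i + 1) % q := h2
        rw [Nat.mod_self, Nat.mod_eq_of_lt hi] at h3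
        omega
      rw [hπ, coordForm_blk, Pi.single_eq_of_ne hne, Pi.single_eq_of_ne (slot_ne_zero q _).symm]
      simp
  -- vectors of `B` close to the last new basis vector in each block
  have hb : ∀ j, ∃ b ∈ B, ∀ j', |π b j' - (if j' = j then 1 else 0)| ≤ 3 * ε := by
    intro j
    obtain ⟨b, hb, hbx⟩ := exists_mem_norm_intVec_pt_sub_le q hα hδ0 hδ j (l + q)
    obtain ⟨m, hm⟩ : ∃ m, q = m + 1 := ⟨q - 1, by omega⟩
    have hxm : intVec (pt q α d j (l + q)) =
        lacRatio α (l + m) • intVec (pt q α d j (l + m)) + blk q d j (Pi.single s 1) := by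
      rw [hs]
      conv_lhs => rw [show l + q = l + m + 1 by omega]
      conv_rhs => rw [show l + q = l + m + 1 by omega]
      exact intVec_pt_succ q hα j _
    refine ⟨b, hb, fun j' => ?_⟩
    have h1 : π (intVec (pt q α d j (l + q))) j' = if j' = j then 1 else 0 := by
      rw [hxm, map_add, map_smul, hπ0 m (by omega) (by omega), smul_zero, zero_add, hπ,
        coordForm_blk, Pi.single_eq_same, Pi.single_eq_of_ne hs0.symm]
      simp
    rw [← h1, abs_sub_comm, ← Pi.sub_apply, ← map_sub]
    exact (abs_coordForm_le s hc2 _ j').trans (by gcongr)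
  choose b hbB hb using hb
  have hli := linearIndependent_of_near_one (fun j => π (b j)) hb hlt
  let ρ := π.comp B.subtype
  have hrange : d ≤ finrank ℝ (LinearMap.range ρ) := by
    have h1 : span ℝ (Set.range fun j => π (b j)) ≤ LinearMap.range ρ := by
      rw [span_le]
      rintro _ ⟨j, rfl⟩
      exact ⟨⟨b j, hbB j⟩, rfl⟩
    have h2 := finrank_mono h1
    rw [finrank_span_eq_card hli] at h2
    simpa using h2
  -- The span `C` of the given points is a rational subspace, contained in the kernel of `π`. By
  -- `lacDen_pow_le_height`, its dimension is at least `(q - u) d`.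
  obtain ⟨f, -, -, hf, -⟩ := exists_height_sup_span_le (bot_mem_rationalSubspaces _)
    ((Finset.univ : Finset (Fin d)) ×ˢ Finset.Ico u q) (fun p => pt q α d p.1 (l + p.2))
    (ε := (q + 1) * (2 * lacDen α (l + q)))
    (by have := lacDen_pos α (l + q); positivity) (fun p hp => by
      refine ⟨0, zero_mem _, ?_⟩
      rw [sub_zero]
      have hp2 := (Finset.mem_Ico.1 (Finset.mem_product.1 hp).2).2
      refine (norm_intVec_pt_le q hα _ _).trans ?_
      gcongr
      exact lacDen_mono hα (by omega))
  set C := ⊥ ⊔ span ℝ ((fun p : Fin d × ℕ => intVec (pt q α d p.1 (l + p.2))) ''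
    ((Finset.univ : Finset (Fin d)) ×ˢ Finset.Ico u q : Finset (Fin d × ℕ))) with hC
  have hCle : ∀ D : Submodule ℝ (E ((q + 1) * d)),
      (∀ i, u ≤ i → i < q → ∀ j, intVec (pt q α d j (l + i)) ∈ D) → C ≤ D := by
    intro D hD
    rw [hC, bot_sup_eq, span_le]
    rintro _ ⟨⟨j, i⟩, hp, rfl⟩
    have hp2 := Finset.mem_Ico.1 (Finset.mem_product.1 (Finset.mem_coe.1 hp)).2
    exact hD i hp2.1 hp2.2 j
  have hfd : (q - u) * d ≤ f := by
    obtain ⟨_, -, h⟩ := lacDen_pow_le_height q hα d u hu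
    refine (h l f hl C hf fun i hui hi j => ?_).1
    refine mem_sup_right (subset_span ⟨(j, i), ?_, rfl⟩)
    simp [hui, hi]
  have hker : f ≤ finrank ℝ (LinearMap.ker ρ) := by
    have h1 : C.comap B.subtype ≤ LinearMap.ker ρ := by
      intro x hx
      have h2 : C ≤ LinearMap.ker π := hCle _ fun i hui hi j => LinearMap.mem_ker.2 (hπ0 i hui hi j)
      exact LinearMap.mem_ker.2 (LinearMap.mem_ker.1 (h2 hx))
    have h2 := finrank_mono h1
    rwa [(Submodule.comapSubtypeEquivOfLe (hCle B hX)).finrank_eq,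
      finrank_of_mem_rationalSubspaces hf] at h2
  have := LinearMap.finrank_range_add_finrank_ker ρ
  have h1 : (q - u + 1) * d = (q - u) * d + d := by ring
  omega

theorem isIrrational_of_le {α : ℝ} (hα : 15 ≤ α) {d e : ℕ} (hd : 1 ≤ d) (hq : e ≤ q * d) :
    IsIrrational (limSpace q α d) e d := by
  intro B hB
  have hlt : e < (q + 1) * d := by
    rw [add_mul]
    omega
  have h1 := not_limSpace_le q hα hB hlt
  have h2 : limSpace q α d ⊓ B < limSpace q α d := inf_lt_left.2 h1
  have h3 := finrank_lt_finrank_of_lt h2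
  rw [finrank_limSpace q hα] at h3
  omega

/-- A subspace at angle `0` from `limSpace` would contain it. -/
theorem psi_pos {α : ℝ} (hα : 15 ≤ α) {d e : ℕ} (hd : 1 ≤ d) (hde : d ≤ e) (hq : e ≤ q * d)
    {B : Submodule ℝ (E ((q + 1) * d))} (hB : B ∈ rationalSubspaces ((q + 1) * d) e) :
    0 < psi (limSpace q α d) B d := by
  have hlt : d + e ≤ (q + 1) * d := by
    rw [add_mul]
    omega
  refine lt_of_le_of_ne (psi_nonneg _ _ _) fun h => ?_
  have h1 := nearTo_psi (finrank_limSpace q hα d) (finrank_of_mem_rationalSubspaces hB) hlt hd hde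
  rw [← h, mul_zero] at h1
  refine not_limSpace_le q hα hB (by omega) fun a ha => ?_
  obtain ⟨b, hb, hab⟩ := h1 a ha
  rw [zero_mul, norm_le_zero_iff, sub_eq_zero] at hab
  rwa [hab]

theorem tendsto_log_lacDen_div_zero {α : ℝ} (hα : 15 ≤ α) :
    Tendsto (fun k => Real.log (lacDen α k) / α ^ k) atTop (𝓝 (Real.log 2)) := by
  have := tendsto_log_lacDen_div hα 0
  simpa using this

theorem log_lacRatio (α : ℝ) (k : ℕ) :
    Real.log (lacRatio α k) = Real.log (lacDen α (k + 1)) - Real.log (lacDen α k) :=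
  Real.log_div (lacDen_pos _ _).ne' (lacDen_pos _ _).ne'

theorem fifteen_mul_le {α : ℝ} {d : ℕ} (hd : 1 ≤ d) (hα : 3 * (d : ℝ) * ((d : ℝ) + 4) ≤ α) :
    15 * (d : ℝ) ≤ α := by
  have : (1 : ℝ) ≤ d := by exact_mod_cast hd
  nlinarith

/-- The bound on `α` used by the lemmas about the sequence: it is the case `d = 1` of the hypothesis
on `α`. -/
theorem fifteen_le {α : ℝ} {d : ℕ} (hd : 1 ≤ d) (hα : 3 * (d : ℝ) * ((d : ℝ) + 4) ≤ α) :
    15 ≤ α := by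
  have : (1 : ℝ) ≤ d := by exact_mod_cast hd
  have := fifteen_mul_le hd hα
  linarith

/-- If `1 ≤ c x δ` where `δ ≤ d H ^ (-μ)`, then `H ^ μ` is at most `c x d`. -/
theorem mul_log_le_of_one_le {H μ δ ψ d c x : ℝ} (hH : 1 ≤ H) (hψ : ψ ≤ 1 / H ^ μ)
    (hδ : δ = d * ψ) (hd : 0 < d) (hc : 0 < c) (hx : 0 < x) (h : 1 ≤ c * x * δ) :
    μ * Real.log H ≤ Real.log (c * d) + Real.log x := by
  have hH0 : 0 < H := by linarith
  have hHμ : 0 < H ^ μ := Real.rpow_pos_of_pos hH0 μ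
  rw [← Real.log_rpow hH0, ← Real.log_mul (by positivity) (by positivity)]
  apply Real.log_le_log hHμ
  have h1 : c * x * δ ≤ c * x * (d * (1 / H ^ μ)) := by
    rw [hδ]
    gcongr
  have h2 := h.trans h1
  have h3 : c * x * (d * (1 / H ^ μ)) = (c * d * x) / H ^ μ := by ring
  rw [h3, le_div_iff₀ hHμ, one_mul] at h2
  exact h2

set_option maxHeartbeats 1000000 in
/-- Upper bound for the exponent in dimension `e = Q d + r`. Let `k` be such that `H(B)` lies
between `T_{k+1} / T_k` and `T_{k+2} / T_{k+1}`, up to constants. If `B` contains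
`X_{k+1}, …, X_{k+Q}` in each block, then `H(B)` is at least of the order of
`T_k ^ r T_{k+1} ^ (d - r)` by `lacDen_pow_le_height`, and `ψ` is at least of the order of
`1 / T_{k+Q+1}` by `one_le_of_pt_mem`. Otherwise, the point missed by `B` gives
`ψ ≥ 1 / (H(B) T_{k+Q})` up to a constant. In both cases `ψ ≤ H(B) ^ (-μ)` fails for large `k`. -/
theorem finite_of_lt_of_le {α μ : ℝ} {d e Q r : ℕ} (hd : 1 ≤ d)
    (hα' : 3 * (d : ℝ) * ((d : ℝ) + 4) ≤ α) (hQ : 1 ≤ Q) (hr : r < d) (he : e = Q * d + r)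
    (heq : e ≤ q * d) (hμ : α ^ (Q + 1) / (r + (d - r) * α) < μ) :
    {B ∈ rationalSubspaces ((q + 1) * d) e |
      psi (limSpace q α d) B d ≤ 1 / height B ^ μ}.Finite := by
  have hα := fifteen_le hd hα'
  have hαd := fifteen_mul_le hd hα'
  have hd1 : (1 : ℝ) ≤ d := by exact_mod_cast hd
  have hd0 : (0 : ℝ) < d := by linarith
  have hα0 : 0 < α := by linarith
  have hrd : (r : ℝ) + 1 ≤ d := by exact_mod_cast hr
  have hr0 : (0 : ℝ) ≤ r := Nat.cast_nonneg r
  have hdpos : (0 : ℝ) < r + (d - r) * α := by nlinarith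
  have hQq : Q ≤ q := by
    by_contra! h
    have : (q + 1) * d ≤ Q * d := Nat.mul_le_mul_right d h
    rw [add_mul] at this
    omega
  have hnum : α ^ (Q + 1) < μ * (r + (d - r) * α) := by rwa [div_lt_iff₀ hdpos] at hμ
  have hαQ : α ≤ α ^ Q := le_self_pow₀ (by linarith) (by omega)
  -- The inequalities needed in the two cases are `hnum`, which is the hypothesis on `μ`, and `hii`.
  have hμ1 : α ^ Q < μ * d := by
    by_contra! h
    have h1 : (r : ℝ) + (d - r) * α ≤ d * α := by nlinarith
    have h2 : 0 < μ := (by positivity : 0 < α ^ (Q + 1) / (r + (d - r) * α)).trans hμ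
    have h3 : μ * (r + (d - r) * α) ≤ α ^ Q * α := by nlinarith
    rw [pow_succ] at hnum
    linarith
  have hμ15 : 15 < μ := by nlinarith
  have hii : α ^ Q < (μ - 1) * (α - 1) := by
    have h1 : 14 * μ ≤ 15 * (μ - 1) := by linarith
    have h2 : 14 * α ≤ 15 * (α - 1) := by linarith
    have h3 : α ^ Q * 15 < μ * α := by nlinarith
    nlinarith
  set n := (q + 1) * d with hn
  have hK := one_le_heightConst n
  set K1 := heightConst n * (q + 1) with hK1
  have hq0 : (0 : ℝ) ≤ q := Nat.cast_nonneg q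
  have hK1' : 1 ≤ K1 := by nlinarith
  -- With `l = k + 1 - u`, the points `X_{l+u}, …, X_{l+q-1}` are `X_{k+1}, …, X_{k+Q}`.
  obtain ⟨u, rfl⟩ : ∃ u, q = u + Q := ⟨q - Q, by omega⟩
  obtain ⟨C, hC, hbound⟩ := lacDen_pow_le_height (u + Q) hα d u (by omega)
  have hlog2 : 0 < Real.log 2 := Real.log_pos (by norm_num)
  have t0 := tendsto_log_lacDen_div_zero hα
  have t1 := tendsto_log_lacDen_div hα
  have E1 := eventually_add_lt_of_tendsto_div hα (t1 Q)
    (G := fun k => (μ - 1) * (Real.log (lacDen α (k + 1)) - Real.log (lacDen α k)))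
    (b := (μ - 1) * (α ^ 1 * Real.log 2 - Real.log 2))
    ((((t1 1).sub t0).const_mul (μ - 1)).congr fun k => by ring) (by nlinarith)
    ((μ - 1) * Real.log (4 * K1) + Real.log (2 * K1 * d))
  have E2 := eventually_add_lt_of_tendsto_div hα (t1 (Q + 1))
    (G := fun k => μ * ((d - r) * Real.log (lacDen α (k + 1)) + r * Real.log (lacDen α k)))
    (b := μ * ((d - r) * (α ^ 1 * Real.log 2) + r * Real.log 2))
    (((((t1 1).const_mul ((d : ℝ) - r)).add (t0.const_mul (r : ℝ))).const_mul μ).congr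
      fun k => by ring) (by nlinarith)
    (μ * Real.log C + Real.log (6 * d * ((u + Q : ℕ) + 1) * d))
  have E3 := (tendsto_lacRatio hα).eventually_ge_atTop (12 * d * ((u + Q : ℕ) + 1))
  obtain ⟨M, hM⟩ := eventually_atTop.1 (E1.and (E2.and (E3.and (eventually_ge_atTop (u + 1)))))
  -- It is enough to bound the heights, by Northcott. A large height makes `k ≥ M` below.
  refine (finite_height_le n e (lacRatio α M)).subset ?_
  rintro B ⟨hB, hψ⟩
  refine ⟨hB, ?_⟩
  by_contra! hH
  have hH1 := one_le_height hB
  set H := height B with hHdef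
  have hex : ∃ k, 4 * K1 * H ≤ lacRatio α k :=
    ((tendsto_lacRatio hα).eventually_ge_atTop _).exists
  classical
  -- `k + 1` is the least index from which the term `2 / lacRatio α m` is negligible in the lower
  -- bound for `ψ` given by a point `X_m` outside `B`.
  obtain ⟨k, hk⟩ : ∃ k, Nat.find hex = k + 1 := by
    refine ⟨Nat.find hex - 1, (Nat.succ_pred_eq_of_pos ?_).symm⟩
    rw [Nat.find_pos]
    have h1 := lacRatio_mono hα (Nat.zero_le M)
    nlinarith
  have hk1 : 4 * K1 * H ≤ lacRatio α (k + 1) := hk ▸ Nat.find_spec hex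
  have hk2 : lacRatio α k < 4 * K1 * H := not_le.1 (Nat.find_min hex (by omega))
  have hkM : M ≤ k := by
    by_contra! h
    have h1 := lacRatio_mono hα (show k + 1 ≤ M by omega)
    nlinarith
  obtain ⟨e1, e2, -, hku⟩ := hM k hkM
  have e3 := (hM (k + 1 + Q) (by omega)).2.2.1
  have hlt : d + e ≤ n := by
    rw [hn, add_mul]
    omega
  have hnear := nearTo_psi (finrank_limSpace (u + Q) hα d) (finrank_of_mem_rationalSubspaces hB)
    hlt hd (by rw [he]; nlinarith)
  have hψ0 := psi_nonneg (limSpace (u + Q) α d) B d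
  set ψ := psi (limSpace (u + Q) α d) B d with hψdef
  have hδ0 : 0 ≤ d * ψ := by positivity
  by_cases hall : ∀ i, u ≤ i → i < u + Q → ∀ j, intVec (pt (u + Q) α d j (k + 1 - u + i)) ∈ B
  · have h1 := one_le_of_pt_mem (u + Q) hα (show 1 ≤ k + 1 - u by omega) (by omega)
      (by
        rw [finrank_of_mem_rationalSubspaces hB, he, show u + Q - u + 1 = Q + 1 by omega, add_mul]
        omega) hδ0 hnear hall
    rw [show k + 1 - u + (u + Q) = k + 1 + Q by omega] at h1
    have hR := lacRatio_pos α (k + 1 + Q)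
    have hT := lacDen_pos α (k + 1 + Q)
    have h2 : 1 ≤ (6 * d * ((u + Q : ℕ) + 1)) * lacDen α (k + 1 + Q) * (d * ψ) := by
      have h3 : d * (3 * (((u + Q : ℕ) + 1) * (2 / lacRatio α (k + 1 + Q)))) ≤ 1 / 2 := by
        have : d * (3 * ((((u + Q : ℕ) : ℝ) + 1) * (2 / lacRatio α (k + 1 + Q)))) =
            (6 * d * ((u + Q : ℕ) + 1)) / lacRatio α (k + 1 + Q) := by ring
        rw [this, div_le_iff₀ hR]
        linarith
      have h4 : d * (3 * ((((u + Q : ℕ) : ℝ) + 1) * (lacDen α (k + 1 + Q) * (d * ψ) +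
          2 / lacRatio α (k + 1 + Q)))) =
          (6 * d * ((u + Q : ℕ) + 1)) * lacDen α (k + 1 + Q) * (d * ψ) / 2 +
          d * (3 * ((((u + Q : ℕ) : ℝ) + 1) * (2 / lacRatio α (k + 1 + Q)))) := by ring
      rw [h4] at h1
      linarith
    have h3 := mul_log_le_of_one_le hH1 hψ rfl hd0 (by positivity) hT h2
    obtain ⟨-, h4⟩ := hbound (k + 1 - u) e (by omega) B hB hall
    have h5 : d * Real.log (lacDen α (k + 1)) ≤ Real.log C + Real.log H +
        r * (Real.log (lacDen α (k + 1)) - Real.log (lacDen α k)) := by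
      rw [show k + 1 - u + u = k + 1 by omega, show u + Q - u = Q by omega,
        show e - Q * d = r by omega] at h4
      -- If `u = 0`, then `Q = q` and `r = 0`, so that the special value of `lacStep` plays no role.
      have h5 : lacStep α (k + 1 - u) u ^ r = lacRatio α k ^ r := by
        rcases Nat.eq_zero_or_pos r with h | h
        · rw [h, pow_zero, pow_zero]
        · have hu : 0 < u := by
            by_contra! hu
            obtain rfl : u = 0 := by omega
            rw [zero_add] at heq
            omega
          obtain ⟨u', rfl⟩ : ∃ u', u = u' + 1 := ⟨u - 1, by omega⟩
          change lacRatio α (k + 1 - (u' + 1) + u') ^ r = _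
          rw [show k + 1 - (u' + 1) + u' = k by omega]
      rw [h5] at h4
      have h6 := Real.log_le_log (by have := lacDen_pos α (k + 1); positivity) h4
      have hRk := lacRatio_pos α k
      rw [Real.log_pow, Real.log_mul (by positivity) (by positivity),
        Real.log_mul (by positivity) (by positivity), Real.log_pow, log_lacRatio] at h6
      exact h6
    have h6 : μ * (d * Real.log (lacDen α (k + 1))) ≤ μ * (Real.log C + Real.log H +
        r * (Real.log (lacDen α (k + 1)) - Real.log (lacDen α k))) :=
      mul_le_mul_of_nonneg_left h5 (by linarith)
    rw [show k + (Q + 1) = k + 1 + Q by ring] at e2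
    linarith
  · push Not at hall
    obtain ⟨i, hui, hiq, j, hij⟩ := hall
    have h1 := one_le_height_mul_of_pt_notMem (u + Q) hα hB hδ0 hnear hij
    set m := k + 1 - u + i with hm
    have hmk : m ≤ k + Q := by omega
    have hR := lacRatio_pos α m
    have hRm : 4 * K1 * H ≤ lacRatio α m := hk1.trans (lacRatio_mono hα (by omega))
    have h2 : 1 ≤ (2 * K1) * (H * lacDen α (k + Q)) * (d * ψ) := by
      have h3 : K1 * H * (2 / lacRatio α m) ≤ 1 / 2 := by
        rw [mul_div_assoc', div_le_iff₀ hR]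
        linarith
      have h4 : K1 * H * (lacDen α m * (d * ψ)) ≤ K1 * H * (lacDen α (k + Q) * (d * ψ)) := by
        have := lacDen_mono hα hmk
        gcongr
      have h5 : heightConst n * H * (((u + Q : ℕ) + 1) * (lacDen α m * (d * ψ) +
          2 / lacRatio α m)) = K1 * H * (lacDen α m * (d * ψ)) + K1 * H * (2 / lacRatio α m) := by
        rw [hK1]
        ring
      rw [h5] at h1
      linarith
    have hT := lacDen_pos α (k + Q)
    have h3 := mul_log_le_of_one_le hH1 hψ rfl hd0 (by positivity) (by positivity) h2
    rw [Real.log_mul (by positivity) hT.ne'] at h3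
    have h4 := Real.log_le_log (lacRatio_pos α k) hk2.le
    rw [log_lacRatio, Real.log_mul (by positivity) (by positivity)] at h4
    have h5 : (μ - 1) * (Real.log (lacDen α (k + 1)) - Real.log (lacDen α k)) ≤
        (μ - 1) * (Real.log (4 * K1) + Real.log H) :=
      mul_le_mul_of_nonneg_left h4 (by linarith)
    linarith

theorem intVec_intBlk_single {q d : ℕ} (j : Fin d) (s : Fin (q + 1)) :
    intVec (intBlk j (Pi.single s 1)) = blk q d j (Pi.single s 1) := by
  rw [intVec_intBlk]
  congr 1
  funext t
  simp only [Pi.single_apply]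
  split_ifs <;> simp

/-- The rational subspaces which approximate `limSpace` best contain `X_k, …, X_{k+Q}` in the first
`r` blocks and `X_{k+1}, …, X_{k+Q}` in the other ones. Since `X_{i+1}` is the sum of a multiple of
`X_i` and of a canonical basis vector, only the first point of each block contributes to the
height. -/
theorem exists_good_approximation {α : ℝ} (hα : 15 ≤ α) {d e Q r : ℕ} (hQ : 1 ≤ Q) (hr : r < d)
    (he : e = Q * d + r) (heq : e ≤ (q + 1) * d) :
    ∃ C : ℝ, 0 < C ∧ ∀ k, ∃ B ∈ rationalSubspaces ((q + 1) * d) e,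
      (∀ j, intVec (pt q α d j (k + Q)) ∈ B) ∧
      height B ≤ C * (lacDen α k ^ r * lacDen α (k + 1) ^ (d - r)) := by
  set n := (q + 1) * d with hn
  have hK := one_le_heightConst n
  have hbot := bot_mem_rationalSubspaces n
  have hbot1 := one_le_height hbot
  have hq0 : (0 : ℝ) ≤ q := Nat.cast_nonneg q
  set c : ℝ := (q + 1) * 2 with hc
  have hc1 : 1 ≤ c := by linarith
  set K := heightConst n with hKdef
  refine ⟨K ^ e * K ^ (e + e) * K ^ d * K ^ d * height (⊥ : Submodule ℝ (E n)) * c ^ d * c ^ d,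
    by positivity, fun k => ?_⟩
  -- The subspace is generated by `X_k` in the blocks `j < r`, by `X_{k+1}` in the other blocks, and
  -- by canonical basis vectors: the steps `2, …, Q` in all blocks, and the step `1` in the blocks
  -- `j < r`.
  set s₁ := (Finset.univ : Finset (Fin d)).filter (fun j : Fin d => (j : ℕ) < r) with hs₁
  set s₂ := (Finset.univ : Finset (Fin d)).filter (fun j : Fin d => ¬ (j : ℕ) < r) with hs₂
  have hcard₁ : s₁.card = r := by
    rw [hs₁, Fin.card_filter_val_lt]
    omega
  have hcard₂ : s₂.card = d - r := by
    have := Finset.card_filter_add_card_filter_not (s := (Finset.univ : Finset (Fin d)))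
      (fun j : Fin d => (j : ℕ) < r)
    rw [← hs₁, ← hs₂, hcard₁] at this
    simp at this
    omega
  set s₃ := (Finset.univ : Finset (Fin d)) ×ˢ Finset.Ico 2 (Q + 1) ∪ s₁ ×ˢ {1} with hs₃
  have hcard₃ : s₃.card ≤ d * (Q - 1) + r := by
    refine (Finset.card_union_le _ _).trans ?_
    simp [Finset.card_product, hcard₁]
  have hT1 := one_le_lacDen α k
  have hT2 := one_le_lacDen α (k + 1)
  obtain ⟨f₁, -, hf₁, hV₁, hH₁⟩ := exists_height_sup_span_le hbot s₁ (fun j => pt q α d j k)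
    (ε := c * lacDen α k) (by positivity) (fun j _ => ⟨0, zero_mem _, by
      rw [sub_zero, hc, mul_assoc]
      exact norm_intVec_pt_le q hα j k⟩)
  set V₁ := (⊥ : Submodule ℝ (E n)) ⊔ span ℝ ((fun j => intVec (pt q α d j k)) '' s₁) with hV₁def
  obtain ⟨f₂, -, hf₂, hV₂, hH₂⟩ := exists_height_sup_span_le hV₁ s₂ (fun j => pt q α d j (k + 1))
    (ε := c * lacDen α (k + 1)) (by positivity) (fun j _ => ⟨0, zero_mem _, by
      rw [sub_zero, hc, mul_assoc]
      exact norm_intVec_pt_le q hα j (k + 1)⟩)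
  set V₂ := V₁ ⊔ span ℝ ((fun j => intVec (pt q α d j (k + 1))) '' s₂) with hV₂def
  obtain ⟨f₃, -, hf₃, hV₃, hH₃⟩ := exists_height_sup_span_le hV₂ s₃
    (fun p => intBlk p.1 (Pi.single (slot q (k + p.2)) 1)) (ε := 1) zero_le_one
    (fun p _ => ⟨0, zero_mem _, by rw [sub_zero, intVec_intBlk_single, norm_blk_single]⟩)
  set V₃ := V₂ ⊔ span ℝ ((fun p : Fin d × ℕ =>
    intVec (intBlk p.1 (Pi.single (slot q (k + p.2)) 1))) '' s₃) with hV₃def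
  obtain ⟨Q', rfl⟩ : ∃ Q', Q = Q' + 1 := ⟨Q - 1, by omega⟩
  have hdQ : (Q' + 1) * d = d * Q' + d := by ring
  rw [Nat.add_sub_cancel] at hcard₃
  have hf₃e : f₃ ≤ e := by omega
  obtain ⟨W, hW, hVW, hHW⟩ := exists_rational_ge hV₃ (e - f₃) (by omega)
  rw [Nat.add_sub_cancel' hf₃e] at hW
  refine ⟨W, hW, fun j => hVW ?_, ?_⟩
  · have hU : ∀ i, (2 ≤ i ∧ i < Q' + 2) ∨ (i = 1 ∧ (j : ℕ) < r) →
        blk q d j (Pi.single (slot q (k + i)) 1) ∈ V₃ := by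
      intro i hi
      rw [← intVec_intBlk_single]
      refine mem_sup_right (subset_span ⟨(j, i), ?_, rfl⟩)
      simp only [hs₃, hs₁, Finset.coe_union, Set.mem_union, Finset.mem_coe, Finset.mem_product,
        Finset.mem_univ, true_and, Finset.mem_Ico, Finset.mem_filter, Finset.mem_singleton]
      omega
    have h1 : intVec (pt q α d j (k + 1)) ∈ V₃ := by
      by_cases hj : (j : ℕ) < r
      · rw [intVec_pt_succ q hα]
        refine V₃.add_mem (V₃.smul_mem _ ?_) (hU 1 (Or.inr ⟨rfl, hj⟩))
        exact mem_sup_left (mem_sup_left (mem_sup_right (subset_span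
          ⟨j, by simpa [hs₁] using hj, rfl⟩)))
      · exact mem_sup_left (mem_sup_right (subset_span ⟨j, by simpa [hs₂] using hj, rfl⟩))
    have h2 : ∀ i ≤ Q', intVec (pt q α d j (k + (i + 1))) ∈ V₃ := by
      intro i
      induction i with
      | zero => exact fun _ => h1
      | succ i ih =>
        intro hi
        rw [← add_assoc, intVec_pt_succ q hα]
        exact V₃.add_mem (V₃.smul_mem _ (ih (by omega))) (hU (i + 1 + 1) (Or.inl (by omega)))
    exact h2 Q' le_rfl
  · rw [hcard₁, Nat.sub_zero] at hH₁
    rw [hcard₂] at hH₂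
    rw [one_pow, mul_one] at hH₃
    have hp₁ := one_le_height hV₁
    have hp₂ := one_le_height hV₂
    have hp₃ := one_le_height hV₃
    have a₁ : height V₁ ≤ K ^ d * height (⊥ : Submodule ℝ (E n)) * (c ^ d * lacDen α k ^ r) := by
      refine hH₁.trans ?_
      have h1 : (c * lacDen α k) ^ f₁ ≤ (c * lacDen α k) ^ r :=
        pow_le_pow_right₀ (by nlinarith) (by omega)
      have h2 : (c * lacDen α k) ^ r ≤ c ^ d * lacDen α k ^ r := by
        rw [mul_pow]
        gcongr
      gcongr
      exact h1.trans h2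
    have a₂ : height V₂ ≤ K ^ d * height V₁ * (c ^ d * lacDen α (k + 1) ^ (d - r)) := by
      refine hH₂.trans ?_
      have h1 : (c * lacDen α (k + 1)) ^ (f₂ - f₁) ≤ (c * lacDen α (k + 1)) ^ (d - r) :=
        pow_le_pow_right₀ (by nlinarith) (by omega)
      have h2 : (c * lacDen α (k + 1)) ^ (d - r) ≤ c ^ d * lacDen α (k + 1) ^ (d - r) := by
        rw [mul_pow]
        gcongr
        omega
      gcongr
      · omega
      · exact h1.trans h2
    have a₃ : height V₃ ≤ K ^ (e + e) * height V₂ := by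
      refine hH₃.trans ?_
      gcongr
      omega
    have a₄ : height W ≤ K ^ e * height V₃ := by
      refine hHW.trans ?_
      gcongr
      omega
    calc height W ≤ K ^ e * height V₃ := a₄
      _ ≤ K ^ e * (K ^ (e + e) * height V₂) := by gcongr
      _ ≤ K ^ e * (K ^ (e + e) *
          (K ^ d * height V₁ * (c ^ d * lacDen α (k + 1) ^ (d - r)))) := by gcongr
      _ ≤ K ^ e * (K ^ (e + e) * (K ^ d * (K ^ d * height (⊥ : Submodule ℝ (E n)) *
          (c ^ d * lacDen α k ^ r)) * (c ^ d * lacDen α (k + 1) ^ (d - r)))) := by gcongr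
      _ = _ := by ring

/-- A subspace satisfies the inequality defining the exponent as soon as the logarithms do. -/
theorem le_one_div_rpow_of_log {H μ x ψ : ℝ} (hH : 0 < H) (hx : 0 < x) (hψ : ψ ≤ 1 / x)
    (h : μ * Real.log H ≤ Real.log x) : ψ ≤ 1 / H ^ μ := by
  refine hψ.trans (one_div_le_one_div_of_le (Real.rpow_pos_of_pos hH μ) ?_)
  rw [← Real.log_le_log_iff (Real.rpow_pos_of_pos hH μ) hx, Real.log_rpow hH]
  exact h

/-- Lower bound for the exponent in dimension `e = Q d + r`, given by `exists_good_approximation`: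
the height is at most of the order of `T_k ^ r T_{k+1} ^ (d - r)` and `ψ` at most of the order of
`1 / T_{k+Q+1}`. As `ψ` never vanishes, these subspaces are infinitely many. -/
theorem infinite_of_lt_of_le {α μ : ℝ} {d e Q r : ℕ} (hd : 1 ≤ d) (hα : 15 ≤ α)
    (hQ : 1 ≤ Q) (hr : r < d) (he : e = Q * d + r) (heq : e ≤ q * d) (hμ0 : 0 < μ)
    (hμ : μ < α ^ (Q + 1) / (r + (d - r) * α)) :
    {B ∈ rationalSubspaces ((q + 1) * d) e |
      psi (limSpace q α d) B d ≤ 1 / height B ^ μ}.Infinite := by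
  have hd0 : (0 : ℝ) < d := by exact_mod_cast hd
  have hrd : (r : ℝ) + 1 ≤ d := by exact_mod_cast hr
  have hr0 : (0 : ℝ) ≤ r := Nat.cast_nonneg r
  have hdpos : (0 : ℝ) < r + (d - r) * α := by nlinarith
  have hq0 : (0 : ℝ) ≤ q := Nat.cast_nonneg q
  have hde : d ≤ e := by
    rw [he]
    nlinarith
  have hlt : d + e ≤ (q + 1) * d := by
    rw [add_mul]
    omega
  obtain ⟨C, hC, hgood⟩ := exists_good_approximation q hα hQ hr he (by omega)
  choose B hB hX hH using hgood
  set D : ℝ := d * ((q + 1) * 2) with hD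
  have hDpos : 0 < D := by positivity
  have hψ : ∀ k, psi (limSpace q α d) (B k) d ≤ 1 / (lacDen α (k + (Q + 1)) / D) := by
    intro k
    have h1 := psi_le (finrank_limSpace q hα d) (finrank_of_mem_rationalSubspaces (hB k)) hlt hd
      hde (nearTo_of_pt_mem q hα (hX k))
    refine h1.trans (le_of_eq ?_)
    rw [hD, show k + (Q + 1) = k + Q + 1 by ring]
    have := (lacDen_pos α (k + Q + 1)).ne'
    field_simp
  have t0 := tendsto_log_lacDen_div_zero hα
  have t1 := tendsto_log_lacDen_div hα
  have hlog2 : 0 < Real.log 2 := Real.log_pos (by norm_num)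
  have E1 := eventually_add_lt_of_tendsto_div hα
    (F := fun k => μ * (r * Real.log (lacDen α k) + (d - r) * Real.log (lacDen α (k + 1))))
    (a := μ * (r * Real.log 2 + (d - r) * (α ^ 1 * Real.log 2)))
    ((((t0.const_mul (r : ℝ)).add ((t1 1).const_mul ((d : ℝ) - r))).const_mul μ).congr
      fun k => by ring) (t1 (Q + 1)) (by
        rw [lt_div_iff₀ hdpos] at hμ
        nlinarith) (μ * Real.log C + Real.log D)
  refine infinite_of_forall_exists_lt (f := fun B => psi (limSpace q α d) B d)
    (fun B hB => psi_pos q hα hd hde heq hB.1) fun ε hε => ?_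
  have E2 := ((tendsto_lacDen hα).comp (tendsto_add_atTop_nat (Q + 1))).eventually_gt_atTop (D / ε)
  obtain ⟨k, hk1, hk2⟩ := (E1.and E2).exists
  refine ⟨B k, ⟨hB k, ?_⟩, ?_⟩
  · have hHpos : 0 < height (B k) := lt_of_lt_of_le one_pos (one_le_height (hB k))
    have hTk := lacDen_pos α k
    have hTk1 := lacDen_pos α (k + 1)
    have hTN := lacDen_pos α (k + (Q + 1))
    refine le_one_div_rpow_of_log hHpos (by positivity) (hψ k) ?_
    have h1 := Real.log_le_log hHpos (hH k)
    rw [Real.log_mul (by positivity) (by positivity), Real.log_mul (by positivity) (by positivity),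
      Real.log_pow, Real.log_pow, Nat.cast_sub hr.le] at h1
    rw [Real.log_div hTN.ne' hDpos.ne']
    have h2 := mul_le_mul_of_nonneg_left h1 hμ0.le
    linarith
  · refine (hψ k).trans_lt ?_
    have hTN := lacDen_pos α (k + (Q + 1))
    simp only [Function.comp] at hk2
    rw [one_div_div, div_lt_iff₀ hTN]
    rw [div_lt_iff₀ hε] at hk2
    linarith

/-- The exponents in dimension at least `d`. -/
theorem exponent_of_le {α : ℝ} {d e : ℕ} (hd : 1 ≤ d) (hα : 3 * (d : ℝ) * ((d : ℝ) + 4) ≤ α)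
    (hde : d ≤ e) (heq : e ≤ q * d) :
    exponent (limSpace q α d) e d =
      ((α ^ (e / d + 1) / (((e % d : ℕ) : ℝ) + ((d : ℝ) - ((e % d : ℕ) : ℝ)) * α) : ℝ) :
        EReal) := by
  have hα15 := fifteen_le hd hα
  have hr : e % d < d := Nat.mod_lt _ hd
  have hQ : 1 ≤ e / d := (Nat.one_le_div_iff hd).2 hde
  have he : e = e / d * d + e % d := (Nat.div_add_mod' e d).symm
  have hrd : ((e % d : ℕ) : ℝ) < d := by exact_mod_cast hr
  have hr0 : (0 : ℝ) ≤ (e % d : ℕ) := Nat.cast_nonneg _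
  refine exponent_eq_of_forall (div_pos (by positivity) (by nlinarith)) ?_ ?_
  · exact fun μ h0 hμ => infinite_of_lt_of_le q hd hα15 hQ hr he heq h0 hμ
  · exact fun μ hμ => finite_of_lt_of_le q hd hα hQ hr he heq hμ

/-! ### The exponents in dimension less than `d` -/

theorem sum_smul_pt_apply {α : ℝ} {d : ℕ} (c : Fin d → ℝ) (k : ℕ) (s : Fin (q + 1)) (j : Fin d) :
    (∑ i, c i • intVec (pt q α d i k)) (finProdFinEquiv (s, j)) = c j * lacPoint q α k s := by
  have : ∑ i, c i • intVec (pt q α d i k) =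
      ∑ i, blk q d i (c i • fun s => (lacPoint q α k s : ℝ)) := by
    simp [intVec_pt]
  rw [this, sum_blk_apply]
  simp

theorem abs_mul_lacDen_le {α : ℝ} (hα : 15 ≤ α) {d : ℕ} (c : Fin d → ℝ) (k : ℕ) (j : Fin d) :
    |c j| * lacDen α k ≤ ‖∑ i, c i • intVec (pt q α d i k)‖ := by
  have := PiLp.norm_apply_le (∑ i, c i • intVec (pt q α d i k)) (finProdFinEquiv (0, j))
  rwa [sum_smul_pt_apply, lacPoint_zero_right_cast q hα, Real.norm_eq_abs, abs_mul,
    abs_of_pos (lacDen_pos α k)] at this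

theorem linearIndependent_pt {α : ℝ} (hα : 15 ≤ α) (d k : ℕ) :
    LinearIndependent ℝ fun j => intVec (pt q α d j k) := by
  rw [Fintype.linearIndependent_iff]
  intro c hc j
  have h1 := abs_mul_lacDen_le q hα c k j
  rw [hc, norm_zero] at h1
  have := lacDen_pos α k
  have h2 : |c j| ≤ 0 := by
    by_contra! h
    nlinarith
  exact abs_nonpos_iff.1 h2

/-- The span of the points `X_k` in all the blocks is close to `limSpace`. -/
theorem nearTo_limSpace_of_le {α : ℝ} (hα : 15 ≤ α) {d : ℕ} {B : Submodule ℝ (E ((q + 1) * d))}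
    {k : ℕ} (h : B ≤ span ℝ (Set.range fun j => intVec (pt q α d j k))) :
    NearTo B (limSpace q α d) (d * ((q + 1) * 2) / lacDen α (k + 1)) := by
  intro x hx
  obtain ⟨c, rfl⟩ := Submodule.mem_span_range_iff_exists_fun ℝ |>.1 (h hx)
  refine ⟨∑ j, c j • lacDen α k • limVec q α d j, sum_mem fun j _ => smul_mem _ _ (smul_mem _ _
    (limVec_mem q α j)), ?_⟩
  rw [← Finset.sum_sub_distrib]
  refine (norm_sum_le _ _).trans ?_
  have hT := lacDen_pos α k
  have hR := lacRatio_pos α k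
  calc _ ≤ ∑ _j : Fin d, (‖∑ i, c i • intVec (pt q α d i k)‖ / lacDen α k) *
        ((q + 1) * (2 / lacRatio α k)) := by
        refine Finset.sum_le_sum fun j _ => ?_
        rw [← smul_sub, norm_smul, Real.norm_eq_abs, norm_sub_rev]
        gcongr
        · rw [le_div_iff₀ hT]
          exact abs_mul_lacDen_le q hα c k j
        · exact norm_smul_limVec_sub_le q hα j k
    _ = _ := by
        rw [← lacDen_mul_lacRatio]
        simp
        field_simp

/-- A nonzero subspace of the span of the points `X_k` in all the blocks is not too close to
`limSpace`. -/
theorem one_le_of_le_span_pt {α : ℝ} (hα : 15 ≤ α) {d : ℕ} {B : Submodule ℝ (E ((q + 1) * d))}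
    {k : ℕ} (h : B ≤ span ℝ (Set.range fun j => intVec (pt q α d j k))) (hB : B ≠ ⊥) {δ : ℝ}
    (hδ : NearTo B (limSpace q α d) δ) :
    1 ≤ 4 * d * (q + 1) * δ * lacDen α (k + 1) := by
  obtain ⟨x, hx, hx0⟩ := (Submodule.ne_bot_iff B).1 hB
  obtain ⟨a, ha, hxa⟩ := hδ x hx
  obtain ⟨c, rfl⟩ := Submodule.mem_span_range_iff_exists_fun ℝ |>.1 (h hx)
  obtain ⟨v, rfl⟩ := (mem_limSpace q).1 ha
  set x := ∑ i, c i • intVec (pt q α d i k) with hxdef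
  have hxpos : 0 < ‖x‖ := norm_pos_iff.2 hx0
  -- The next step modifies the coordinate `s` of `X_k`, whose ratio to the coordinate of index `0`
  -- is therefore at distance at least `1 / T_{k+1}` from its limit.
  set s := slot q (k + 1) with hs
  have hT := lacDen_pos α k
  have hT1 := lacDen_pos α (k + 1)
  have hgap : lacDen α k / lacDen α (k + 1) ≤
      lacDen α k * lacLimit q α s - lacPoint q α k s := by
    have h1 := (lacLimit_mem q hα (k + 1) s).1
    rw [lacPoint_succ_div q hα, if_pos hs] at h1
    have h2 := mul_le_mul_of_nonneg_left h1 hT.le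
    rw [mul_add, mul_div_cancel₀ _ hT.ne', mul_one_div] at h2
    linarith
  have hcoord : ∀ j t, |c j * lacPoint q α k t - v j * lacLimit q α t| ≤ δ * ‖x‖ := by
    intro j t
    have h1 := PiLp.norm_apply_le (x - ∑ i, v i • limVec q α d i) (finProdFinEquiv (t, j))
    have h2 : ∑ i, v i • limVec q α d i = ∑ i, blk q d i (v i • lacLimit q α) := by
      simp [limVec]
    have h3 : (x - ∑ i, v i • limVec q α d i) (finProdFinEquiv (t, j)) =
        c j * lacPoint q α k t - v j * lacLimit q α t := by
      rw [PiLp.sub_apply, hxdef, sum_smul_pt_apply, h2, sum_blk_apply]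
      simp
    rw [h3] at h1
    exact h1.trans hxa
  have hc : ∀ j, |c j| * lacDen α k ≤ 2 * δ * ‖x‖ * lacDen α (k + 1) := by
    intro j
    have h1 := hcoord j 0
    have h2 := hcoord j s
    rw [lacPoint_zero_right_cast q hα, lacLimit_zero q hα, mul_one] at h1
    have h3 : c j * (lacDen α k * lacLimit q α s - lacPoint q α k s) =
        (c j * lacDen α k - v j) * lacLimit q α s -
          (c j * lacPoint q α k s - v j * lacLimit q α s) := by ring
    have h4 : |c j| * (lacDen α k / lacDen α (k + 1)) ≤ 2 * δ * ‖x‖ := by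
      calc |c j| * (lacDen α k / lacDen α (k + 1))
          ≤ |c j| * |lacDen α k * lacLimit q α s - lacPoint q α k s| := by
            gcongr
            exact hgap.trans (le_abs_self _)
        _ = |(c j * lacDen α k - v j) * lacLimit q α s -
          (c j * lacPoint q α k s - v j * lacLimit q α s)| := by rw [← abs_mul, h3]
        _ ≤ |c j * lacDen α k - v j| * |lacLimit q α s| +
          |c j * lacPoint q α k s - v j * lacLimit q α s| := by
            rw [← abs_mul]
            exact abs_sub _ _
        _ ≤ δ * ‖x‖ * 1 + δ * ‖x‖ := by
            have h5 : |lacLimit q α s| ≤ 1 := by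
              rw [abs_of_nonneg (lacLimit_nonneg q hα s)]
              exact lacLimit_le_one q hα s
            exact add_le_add (mul_le_mul h1 h5 (abs_nonneg _) ((abs_nonneg _).trans h1)) h2
        _ = _ := by ring
    rwa [mul_div_assoc', div_le_iff₀ hT1] at h4
  have hnorm : ‖x‖ ≤ ∑ _j : Fin d, (2 * δ * ‖x‖ * lacDen α (k + 1)) * ((q + 1) * 2) := by
    conv_lhs => rw [hxdef]
    refine (norm_sum_le _ _).trans (Finset.sum_le_sum fun j _ => ?_)
    rw [norm_smul, Real.norm_eq_abs]
    calc |c j| * ‖intVec (pt q α d j k)‖ ≤ |c j| * ((q + 1) * (2 * lacDen α k)) := by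
          gcongr
          exact norm_intVec_pt_le q hα j k
      _ = (|c j| * lacDen α k) * ((q + 1) * 2) := by ring
      _ ≤ _ := mul_le_mul_of_nonneg_right (hc j) (by positivity)
  simp only [Finset.sum_const, Finset.card_univ, Fintype.card_fin, nsmul_eq_mul] at hnorm
  have h6 : ‖x‖ * 1 ≤ ‖x‖ * (4 * d * (q + 1) * δ * lacDen α (k + 1)) := by
    calc ‖x‖ * 1 = ‖x‖ := mul_one _
      _ ≤ _ := hnorm
      _ = _ := by ring
  exact le_of_mul_le_mul_left h6 hxpos

/-- If two subspaces have the same dimension, the condition of being close to each other is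
symmetric. -/
theorem NearTo.symm {n : ℕ} {V A : Submodule ℝ (E n)} {η : ℝ} (h : NearTo V A η)
    (hη : η ≤ 1 / 2) (hη0 : 0 ≤ η) (hVA : finrank ℝ V = finrank ℝ A) : NearTo A V (2 * η) := by
  rw [nearTo_iff] at h
  have hle : ∀ b ∈ V, ‖b‖ ≤ 2 * ‖A.starProjection b‖ := by
    intro b hb
    have h1 := h b hb
    have h2 : ‖b‖ ≤ ‖b - A.starProjection b‖ + ‖A.starProjection b‖ := by
      simpa using norm_add_le (b - A.starProjection b) (A.starProjection b)
    have h3 : η * ‖b‖ ≤ 1 / 2 * ‖b‖ := by gcongr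
    linarith
  let ρ : V →ₗ[ℝ] A := A.orthogonalProjectionOnto.toLinearMap.comp V.subtype
  have hρ : ∀ b : V, (ρ b : E n) = A.starProjection b := fun b => rfl
  have hinj : Function.Injective ρ := by
    rw [← LinearMap.ker_eq_bot, Submodule.eq_bot_iff]
    intro b hb
    have h1 := hle b b.2
    rw [← hρ, LinearMap.mem_ker.1 hb] at h1
    simpa using h1
  have hsurj := (LinearMap.injective_iff_surjective_of_finrank_eq_finrank hVA).1 hinj
  intro a ha
  obtain ⟨b, hb⟩ := hsurj ⟨a, ha⟩
  have hba : A.starProjection (b : E n) = a := by rw [← hρ, hb]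
  refine ⟨b, b.2, ?_⟩
  have h1 := h b b.2
  have h2 := hle b b.2
  rw [hba] at h1 h2
  rw [norm_sub_rev]
  calc _ ≤ η * ‖(b : E n)‖ := h1
    _ ≤ η * (2 * ‖a‖) := by gcongr
    _ = _ := by ring

/-- A subspace of dimension less than `d` which is close to `limSpace` can be enlarged by one of the
vectors `X_k ⊗ e_j` in such a way that it remains close to `limSpace`: some `X_k ⊗ e_j` makes a
large angle with it. -/
theorem exists_nearTo_sup_span {α : ℝ} (hα : 15 ≤ α) {d k : ℕ}
    {V : Submodule ℝ (E ((q + 1) * d))} (hV : finrank ℝ V < d) {η : ℝ} (hη0 : 0 ≤ η)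
    (hη : NearTo V (limSpace q α d) η) (hk : 4 * (d * ((q + 1) * 2)) ≤ lacDen α (k + 1)) :
    ∃ j, intVec (pt q α d j k) ∉ V ∧
      NearTo (V ⊔ span ℝ {intVec (pt q α d j k)}) (limSpace q α d)
        ((1 + 4 * d * (q + 1)) * (η + 1 / lacDen α (k + 1))) := by
  have hT := lacDen_pos α k
  have hT1 := lacDen_pos α (k + 1)
  have hd : (0 : ℝ) < d := by exact_mod_cast (by omega : 0 < d)
  -- As `dim V < d`, some nonzero `a` in `limSpace` is orthogonal to `V`. If each `X_k ⊗ e_j` were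
  -- close to `V`, then `a`, which is close to a combination of them, would be close to `V` too.
  have hfar : ∃ j, ∀ b ∈ V, lacDen α k ≤ 2 * d * ‖intVec (pt q α d j k) - b‖ := by
    by_contra! hcon
    choose b hbV hb using hcon
    let ρ : limSpace q α d →ₗ[ℝ] V :=
      V.orthogonalProjectionOnto.toLinearMap.comp (limSpace q α d).subtype
    obtain ⟨⟨a, ha⟩, ha1, ha0⟩ := (LinearMap.ker ρ).ne_bot_iff.1
      (LinearMap.ker_ne_bot_of_finrank_lt (by rwa [finrank_limSpace q hα]))
    have haP : V.starProjection a = 0 :=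
      congrArg (Subtype.val) (LinearMap.mem_ker.1 ha1)
    have ha0' : a ≠ 0 := fun h => ha0 (Subtype.ext h)
    have hapos : 0 < ‖a‖ := norm_pos_iff.2 ha0'
    obtain ⟨v, hv⟩ := (mem_limSpace q).1 ha
    have h1 := norm_sum_limVec_sub_le q hα v k
    have hvj := abs_le_norm_sum_limVec q hα v
    rw [← hv] at h1 hvj
    have h2 : ‖∑ j, (v j * (lacDen α k)⁻¹) • intVec (pt q α d j k) -
        ∑ j, (v j * (lacDen α k)⁻¹) • b j‖ ≤ ‖a‖ / 2 := by
      rw [← Finset.sum_sub_distrib]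
      refine (norm_sum_le _ _).trans ?_
      calc _ ≤ ∑ _j : Fin d, (‖a‖ * (lacDen α k)⁻¹) * (lacDen α k / (2 * d)) := by
            refine Finset.sum_le_sum fun j _ => ?_
            rw [← smul_sub, norm_smul, norm_mul, Real.norm_eq_abs, norm_inv, Real.norm_eq_abs,
              abs_of_pos hT]
            gcongr
            · exact hvj j
            · rw [le_div_iff₀ (by positivity), mul_comm]
              exact (hb j).le
        _ = _ := by
            simp
            field_simp
    have h3 := norm_sub_starProjection_le V a
      (V.sum_mem fun j (_ : j ∈ Finset.univ) => V.smul_mem (v j * (lacDen α k)⁻¹) (hbV j))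
    rw [haP, sub_zero] at h3
    have h4 : (d : ℝ) * ((q + 1) * (2 / lacDen α (k + 1))) ≤ 1 / 4 := by
      have : (d : ℝ) * ((q + 1) * (2 / lacDen α (k + 1))) =
        (d * ((q + 1) * 2)) / lacDen α (k + 1) := by ring
      rw [this, div_le_iff₀ hT1]
      linarith
    have h5 := norm_sub_le_norm_sub_add_norm_sub a
      (∑ j, (v j * (lacDen α k)⁻¹) • intVec (pt q α d j k)) (∑ j, (v j * (lacDen α k)⁻¹) • b j)
    nlinarith
  obtain ⟨j, hj⟩ := hfar
  set X := intVec (pt q α d j k) with hX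
  refine ⟨j, fun hmem => ?_, ?_⟩
  · have := hj X hmem
    rw [sub_self, norm_zero, mul_zero] at this
    linarith
  intro x hx
  obtain ⟨b, hb, y, hy, rfl⟩ := Submodule.mem_sup.1 hx
  obtain ⟨s, rfl⟩ := Submodule.mem_span_singleton.1 hy
  obtain ⟨a, ha, hab⟩ := hη b hb
  have hs : |s| * lacDen α k ≤ 2 * d * ‖b + s • X‖ := by
    by_cases hs0 : s = 0
    · simp only [hs0, abs_zero, zero_mul]
      positivity
    · have h1 := hj (-(s⁻¹ • b)) (V.neg_mem (V.smul_mem _ hb))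
      have h2 : b + s • X = s • (X - -(s⁻¹ • b)) := by
        rw [sub_neg_eq_add, smul_add, smul_smul, mul_inv_cancel₀ hs0, one_smul,
          add_comm b]
      rw [h2, norm_smul, Real.norm_eq_abs]
      calc |s| * lacDen α k ≤ |s| * (2 * d * ‖X - -(s⁻¹ • b)‖) := by gcongr
        _ = _ := by ring
  have hsX : ‖s • X‖ ≤ 4 * d * (q + 1) * ‖b + s • X‖ := by
    rw [norm_smul, Real.norm_eq_abs]
    calc |s| * ‖X‖ ≤ |s| * ((q + 1) * (2 * lacDen α k)) := by
          gcongr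
          exact norm_intVec_pt_le q hα j k
      _ = (q + 1) * 2 * (|s| * lacDen α k) := by ring
      _ ≤ (q + 1) * 2 * (2 * d * ‖b + s • X‖) := by gcongr
      _ = _ := by ring
  have hbn : ‖b‖ ≤ (1 + 4 * d * (q + 1)) * ‖b + s • X‖ := by
    have h1 : ‖b‖ ≤ ‖b + s • X‖ + ‖s • X‖ := by
      simpa using norm_sub_le (b + s • X) (s • X)
    linarith
  refine ⟨a + s • lacDen α k • limVec q α d j, add_mem ha (smul_mem _ _ (smul_mem _ _
    (limVec_mem q α j))), ?_⟩
  have h1 : b + s • X - (a + s • lacDen α k • limVec q α d j) =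
      (b - a) - s • (lacDen α k • limVec q α d j - X) := by
    rw [smul_sub]
    abel
  have h2 : ‖s • (lacDen α k • limVec q α d j - X)‖ ≤
      4 * d * (q + 1) * ‖b + s • X‖ * (1 / lacDen α (k + 1)) := by
    rw [norm_smul, Real.norm_eq_abs]
    calc _ ≤ |s| * ((q + 1) * (2 / lacRatio α k)) := by
          gcongr
          exact norm_smul_limVec_sub_le q hα j k
      _ = (|s| * lacDen α k) * ((q + 1) * 2 * (1 / lacDen α (k + 1))) := by
          have := lacRatio_pos α k
          rw [← lacDen_mul_lacRatio]
          field_simp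
      _ ≤ (2 * d * ‖b + s • X‖) * ((q + 1) * 2 * (1 / lacDen α (k + 1))) := by gcongr
      _ = _ := by ring
  rw [h1]
  refine (norm_sub_le _ _).trans ?_
  have h3 : ‖b - a‖ ≤ η * ((1 + 4 * d * (q + 1)) * ‖b + s • X‖) := hab.trans (by gcongr)
  have h4 : 0 ≤ ‖b + s • X‖ * (1 / lacDen α (k + 1)) := by positivity
  have h5 : (1 + 4 * d * (q + 1)) * (η + 1 / lacDen α (k + 1)) * ‖b + s • X‖ =
      η * ((1 + 4 * d * (q + 1)) * ‖b + s • X‖) +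
      4 * d * (q + 1) * ‖b + s • X‖ * (1 / lacDen α (k + 1)) +
      ‖b + s • X‖ * (1 / lacDen α (k + 1)) := by ring
  rw [h5]
  linarith

/-- Iteration of `exists_nearTo_sup_span`: a rational subspace close to `limSpace` is contained in
a larger one, of any dimension up to `d`, which is still close to `limSpace`. Each additional vector
multiplies the height by at most a constant times `T_k`. -/
theorem exists_nearTo_rational_ge {α : ℝ} (hα : 15 ≤ α) (d m : ℕ) :
    ∃ C : ℝ, 1 ≤ C ∧ ∀ k v, v + m ≤ d → ∀ V ∈ rationalSubspaces ((q + 1) * d) v, ∀ η, 0 ≤ η →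
      NearTo V (limSpace q α d) η → 4 * (d * ((q + 1) * 2)) ≤ lacDen α (k + 1) →
      ∃ W ∈ rationalSubspaces ((q + 1) * d) (v + m), V ≤ W ∧
        NearTo W (limSpace q α d) (C * (η + 1 / lacDen α (k + 1))) ∧
        height W ≤ C * height V * lacDen α k ^ m := by
  have hK := one_le_heightConst ((q + 1) * d)
  have hq0 : (0 : ℝ) ≤ q := Nat.cast_nonneg q
  have hd0 : (0 : ℝ) ≤ d := Nat.cast_nonneg d
  induction m with
  | zero =>
    refine ⟨1, le_rfl, fun k v _ V hV η hη0 hη _ => ⟨V, hV, le_rfl, ?_, by simp⟩⟩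
    intro x hx
    obtain ⟨a, ha, hxa⟩ := hη x hx
    refine ⟨a, ha, hxa.trans ?_⟩
    have := lacDen_pos α (k + 1)
    have : 0 ≤ 1 / lacDen α (k + 1) := by positivity
    gcongr
    linarith
  | succ m ih =>
    obtain ⟨C, hC, ih⟩ := ih
    set C' := (1 + 4 * d * (q + 1)) * (C + 1) * (heightConst ((q + 1) * d) * ((q + 1) * 2)) with hC'
    have h1 : (1 : ℝ) ≤ 1 + 4 * d * (q + 1) := by
      have : (0 : ℝ) ≤ 4 * d * (q + 1) := by positivity
      linarith
    have h2 : 1 ≤ heightConst ((q + 1) * d) * ((q + 1) * 2) := by nlinarith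
    have h3 : (1 + 4 * d * (q + 1)) * (C + 1) ≤ C' :=
      le_mul_of_one_le_right (by positivity) h2
    have h4 : C * (heightConst ((q + 1) * d) * ((q + 1) * 2)) ≤ C' := by
      rw [hC']
      gcongr
      nlinarith
    refine ⟨C', by nlinarith, fun k v hv V hV η hη0 hη hk => ?_⟩
    obtain ⟨W, hW, hVW, hWA, hH⟩ := ih k v (by omega) V hV η hη0 hη hk
    have hT1 := lacDen_pos α (k + 1)
    have hT := lacDen_pos α k
    have hτ : 0 ≤ 1 / lacDen α (k + 1) := by positivity
    obtain ⟨j, hj, hjA⟩ := exists_nearTo_sup_span q hα (k := k)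
      (by rw [finrank_of_mem_rationalSubspaces hW]; omega) (by positivity) hWA hk
    obtain ⟨h5, h6⟩ := height_sup_span_le hW hj W.zero_mem
    have hVpos := one_le_height hV
    have hWpos := one_le_height hW
    refine ⟨_, h5, hVW.trans le_sup_left, fun x hx => ?_, h6.trans ?_⟩
    · obtain ⟨a, ha, hxa⟩ := hjA x hx
      refine ⟨a, ha, hxa.trans (mul_le_mul_of_nonneg_right ?_ (norm_nonneg x))⟩
      calc (1 + 4 * d * (q + 1)) * (C * (η + 1 / lacDen α (k + 1)) + 1 / lacDen α (k + 1))
          ≤ (1 + 4 * d * (q + 1)) * ((C + 1) * (η + 1 / lacDen α (k + 1))) := by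
            gcongr
            linarith
        _ = (1 + 4 * d * (q + 1)) * (C + 1) * (η + 1 / lacDen α (k + 1)) := by ring
        _ ≤ _ := by gcongr
    · rw [sub_zero]
      calc _ ≤ heightConst ((q + 1) * d) * (C * height V * lacDen α k ^ m) *
            ((q + 1) * (2 * lacDen α k)) := by
            gcongr
            exact norm_intVec_pt_le q hα j k
        _ = C * (heightConst ((q + 1) * d) * ((q + 1) * 2)) * height V * lacDen α k ^ (m + 1) := by
            ring
        _ ≤ _ := by gcongr

/-- A rational subspace `B` of dimension `e < d` close to `limSpace` is enlarged to a rational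
subspace of dimension `d` by means of the points `X_k`. Either this subspace misses one of the
points `X_k` and `B` is not too close to `limSpace`, or it is spanned by these points, so that the
height of `B` and its distance to `limSpace` are controlled. -/
theorem height_or_of_nearTo {α : ℝ} (hα : 15 ≤ α) {d e : ℕ} (he : 1 ≤ e) (hed : e ≤ d) :
    ∃ C : ℝ, 1 ≤ C ∧ ∀ k, q ≤ k → ∀ B ∈ rationalSubspaces ((q + 1) * d) e, ∀ δ, 0 ≤ δ →
      NearTo B (limSpace q α d) δ → C * (δ + 1 / lacDen α (k + 1)) ≤ 1 →
      1 ≤ C * height B * lacDen α k ^ (d - e + 1) * (δ + 1 / lacDen α (k + 1)) ∨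
        (lacDen α k ^ e ≤ C * height B ∧ 1 ≤ C * δ * lacDen α (k + 1)) := by
  have hK := one_le_heightConst ((q + 1) * d)
  have hq : 0 < q := Nat.pos_of_ne_zero (NeZero.ne q)
  have hq0 : (0 : ℝ) ≤ q := Nat.cast_nonneg q
  have hd0 : (1 : ℝ) ≤ d := by exact_mod_cast he.trans hed
  obtain ⟨C₁, hC₁, hext⟩ := exists_nearTo_rational_ge q hα d (d - e)
  obtain ⟨C₂, hC₂, hbound⟩ := lacDen_pow_le_height q hα d (q - 1) (by omega)
  set K := heightConst ((q + 1) * d) with hKdef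
  have b₁ : 0 ≤ 4 * d * ((q : ℝ) + 1) := by positivity
  have b₂ : 0 ≤ C₂ * C₁ := by positivity
  have b₃ : 0 ≤ K * C₁ * ((q + 1) * (2 * C₁ + 2)) := by positivity
  set C := 8 * d * ((q : ℝ) + 1) + 2 * C₁ + C₂ * C₁ + K * C₁ * ((q + 1) * (2 * C₁ + 2)) with hC
  have c₁ : 8 * d * ((q : ℝ) + 1) ≤ C := by linarith
  have c₂ : 2 * C₁ ≤ C := by linarith
  have c₃ : C₂ * C₁ ≤ C := by linarith
  have c₄ : K * C₁ * ((q + 1) * (2 * C₁ + 2)) ≤ C := by linarith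
  have c₅ : 4 * d * ((q : ℝ) + 1) ≤ C := by linarith
  refine ⟨C, by linarith, fun k hk B hB δ hδ0 hδ hsmall => ?_⟩
  have hT := lacDen_pos α k
  have hT1 := lacDen_pos α (k + 1)
  set τ := 1 / lacDen α (k + 1) with hτ
  have hτ0 : 0 < τ := by positivity
  have hH := one_le_height hB
  obtain ⟨W, hW, hBW, hWA, hHW⟩ := hext k e (by omega) B hB δ hδ0 hδ (by
    have h1 : 8 * d * ((q : ℝ) + 1) * τ ≤ 1 := by
      refine le_trans ?_ hsmall
      exact mul_le_mul c₁ (by linarith) hτ0.le (by linarith)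
    rw [hτ, mul_one_div, div_le_one hT1] at h1
    linarith)
  rw [Nat.add_sub_cancel' hed] at hW
  have hHW0 := one_le_height hW
  have hη : C₁ * (δ + τ) ≤ 1 / 2 := by
    have h1 : 2 * C₁ * (δ + τ) ≤ 1 := le_trans (by gcongr) hsmall
    linarith
  have hAW := hWA.symm hη (by positivity)
    (by rw [finrank_of_mem_rationalSubspaces hW, finrank_limSpace q hα])
  by_cases hall : ∀ j, intVec (pt q α d j k) ∈ W
  -- The enlarged subspace is the span of the points `X_k ⊗ e_j`, whose height is known.
  · right
    have hWspan : span ℝ (Set.range fun j => intVec (pt q α d j k)) = W := by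
      apply Submodule.eq_of_le_of_finrank_eq
      · rw [span_le]
        rintro _ ⟨j, rfl⟩
        exact hall j
      · rw [finrank_span_eq_card (linearIndependent_pt q hα d k),
          finrank_of_mem_rationalSubspaces hW]
        simp
    constructor
    · obtain ⟨-, h1⟩ := hbound (k - (q - 1)) d (by omega) W hW fun i hi hiq j => by
        rw [show k - (q - 1) + i = k by omega]
        exact hall j
      rw [show k - (q - 1) + (q - 1) = k by omega, show q - (q - 1) = 1 by omega, one_mul,
        Nat.sub_self, pow_zero, mul_one] at h1
      have h2 : lacDen α k ^ d = lacDen α k ^ e * lacDen α k ^ (d - e) := by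
        rw [← pow_add, Nat.add_sub_cancel' hed]
      have h3 : lacDen α k ^ e * lacDen α k ^ (d - e) ≤
          (C * height B) * lacDen α k ^ (d - e) := by
        rw [← h2]
        calc _ ≤ C₂ * height W := h1
          _ ≤ C₂ * (C₁ * height B * lacDen α k ^ (d - e)) := by gcongr
          _ = (C₂ * C₁) * height B * lacDen α k ^ (d - e) := by ring
          _ ≤ _ := by gcongr
      exact le_of_mul_le_mul_right h3 (by positivity)
    · have hBbot : B ≠ ⊥ := by
        rintro rfl
        have := finrank_of_mem_rationalSubspaces hB
        rw [finrank_bot] at this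
        omega
      have h1 := one_le_of_le_span_pt q hα (hWspan ▸ hBW) hBbot hδ
      refine h1.trans ?_
      gcongr
  -- The enlarged subspace misses some `X_k ⊗ e_j`, hence cannot be too close to `limSpace`.
  · left
    push Not at hall
    obtain ⟨j, hj⟩ := hall
    have h1 := one_le_height_mul_of_pt_notMem q hα hW (by positivity) hAW hj
    refine h1.trans ?_
    have h2 : 2 / lacRatio α k = 2 * (lacDen α k * τ) := by
      have hR := lacRatio_pos α k
      rw [hτ, ← lacDen_mul_lacRatio]
      field_simp
    rw [h2]
    calc K * height W * ((q + 1) * (lacDen α k * (2 * (C₁ * (δ + τ))) + 2 * (lacDen α k * τ)))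
        ≤ K * (C₁ * height B * lacDen α k ^ (d - e)) *
          ((q + 1) * (lacDen α k * (2 * (C₁ * (δ + τ))) + 2 * (lacDen α k * (δ + τ)))) := by
          gcongr
          linarith
      _ = K * C₁ * ((q + 1) * (2 * C₁ + 2)) * height B * lacDen α k ^ (d - e + 1) * (δ + τ) := by
          rw [pow_succ]
          ring
      _ ≤ _ := by gcongr

theorem eventually_mul_lacDen_pow_lt {α : ℝ} (hα : 15 ≤ α) {s : ℕ} (hs : (s : ℝ) < α) {c : ℝ}
    (hc : 0 < c) : ∀ᶠ k in atTop, c * lacDen α k ^ s < lacDen α (k + 1) := by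
  have hlog2 : 0 < Real.log 2 := Real.log_pos (by norm_num)
  have E := eventually_add_lt_of_tendsto_div hα
    (F := fun k => s * Real.log (lacDen α k)) (a := s * Real.log 2)
    (((tendsto_log_lacDen_div_zero hα).const_mul (s : ℝ)).congr fun k => by ring)
    (tendsto_log_lacDen_div hα 1) (by rw [pow_one]; gcongr) (Real.log c)
  filter_upwards [E] with k hk
  have h1 := lacDen_pos α k
  rw [← Real.log_pow, add_comm, ← Real.log_mul hc.ne' (by positivity)] at hk
  exact (Real.log_lt_log_iff (by positivity) (lacDen_pos _ _)).1 hk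

/-- No rational subspace of dimension `e` with `1 ≤ e < d` is contained in `limSpace`: both
alternatives of `height_or_of_nearTo` fail for `δ = 0` and large `k`, because `d - e + 1 < α`. -/
theorem not_nearTo_zero {α : ℝ} {d e : ℕ} (hα : 3 * (d : ℝ) * ((d : ℝ) + 4) ≤ α) (he : 1 ≤ e)
    (hed : e < d) {B : Submodule ℝ (E ((q + 1) * d))}
    (hB : B ∈ rationalSubspaces ((q + 1) * d) e) : ¬ NearTo B (limSpace q α d) 0 := by
  intro hnear
  have hα15 := fifteen_le (by omega) hα
  have hαd := fifteen_mul_le (by omega) hα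
  have hd1 : (1 : ℝ) ≤ d := by exact_mod_cast (by omega : 1 ≤ d)
  have hs : ((d - e + 1 : ℕ) : ℝ) < α := by
    have : ((d - e + 1 : ℕ) : ℝ) ≤ d := by exact_mod_cast (by omega)
    linarith
  obtain ⟨C, hC, h⟩ := height_or_of_nearTo q hα15 he hed.le
  have hH := one_le_height hB
  obtain ⟨k, h1, h2, h3⟩ := ((eventually_mul_lacDen_pow_lt hα15 hs
    (c := C * height B) (by positivity)).and ((eventually_ge_atTop q).and
      (((tendsto_lacDen hα15).comp (tendsto_add_atTop_nat 1)).eventually_ge_atTop C))).exists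
  have hT1 := lacDen_pos α (k + 1)
  simp only [Function.comp] at h3
  rcases h k h2 B hB 0 le_rfl hnear (by rwa [zero_add, mul_one_div, div_le_one hT1]) with h4 | h4
  · rw [zero_add, mul_one_div, le_div_iff₀ hT1, one_mul] at h4
    linarith
  · rw [mul_zero, zero_mul] at h4
    linarith [h4.2]

theorem isIrrational_of_lt {α : ℝ} {d e : ℕ} (hα : 3 * (d : ℝ) * ((d : ℝ) + 4) ≤ α) (he : 1 ≤ e)
    (hed : e < d) : IsIrrational (limSpace q α d) e e := by
  intro B hB
  have h1 : ¬ B ≤ limSpace q α d := fun hle =>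
    not_nearTo_zero q hα he hed hB fun x hx => ⟨x, hle hx, by simp⟩
  have h2 : limSpace q α d ⊓ B < B := inf_lt_right.2 h1
  have h3 := finrank_lt_finrank_of_lt h2
  rw [finrank_of_mem_rationalSubspaces hB] at h3
  omega

theorem psi_pos' {α : ℝ} {d e : ℕ} (hα : 3 * (d : ℝ) * ((d : ℝ) + 4) ≤ α) (he : 1 ≤ e)
    (hed : e < d) (hq : d + e ≤ (q + 1) * d) {B : Submodule ℝ (E ((q + 1) * d))}
    (hB : B ∈ rationalSubspaces ((q + 1) * d) e) : 0 < psi (limSpace q α d) B e := by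
  refine lt_of_le_of_ne (psi_nonneg _ _ _) fun h => ?_
  have h1 := nearTo_psi' (finrank_limSpace q (fifteen_le (by omega) hα) d)
    (finrank_of_mem_rationalSubspaces hB) hq he hed.le
  rw [← h, mul_zero] at h1
  exact not_nearTo_zero q hα he hed hB h1

set_option maxHeartbeats 1000000 in
/-- Upper bound for the exponent in dimension `e < d`. Put `s = d - e + 1`, and let `k` be such that
`H(B)` lies between `T_{k+1} / T_k ^ s` and `T_{k+2} / T_{k+1} ^ s`, up to constants. In the first
case of `height_or_of_nearTo`, `ψ` is at least of the order of `1 / (H(B) T_{k+1} ^ s)`. In the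
second one, `H(B)` is at least of the order of `T_{k+1} ^ e` and `ψ` at least of the order of
`1 / T_{k+2}`. -/
theorem finite_of_lt_of_lt {α μ : ℝ} {d e : ℕ} (hα' : 3 * (d : ℝ) * ((d : ℝ) + 4) ≤ α)
    (he : 1 ≤ e) (hed : e < d) (hq : d + e ≤ (q + 1) * d) (hμ : α / e < μ) :
    {B ∈ rationalSubspaces ((q + 1) * d) e |
      psi (limSpace q α d) B e ≤ 1 / height B ^ μ}.Finite := by
  have hd : 1 ≤ d := by omega
  have hα := fifteen_le hd hα'
  have hαd := fifteen_mul_le hd hα'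
  have hd1 : (1 : ℝ) ≤ d := by exact_mod_cast hd
  have he1 : (1 : ℝ) ≤ e := by exact_mod_cast he
  have he0 : (0 : ℝ) < e := by linarith
  have hed' : (e : ℝ) + 1 ≤ d := by exact_mod_cast hed
  set s := d - e + 1 with hs
  have hsd : (s : ℝ) = d - e + 1 := by
    rw [hs]
    push_cast [Nat.cast_sub hed.le]
    ring
  have hsα : (s : ℝ) < α := by linarith
  have hμe : α < μ * e := by rwa [div_lt_iff₀ he0] at hμ
  have hμ1 : 15 < μ := by nlinarith
  -- This uses that `α` is large compared with `d ^ 2`: for `μ = α / e`, the inequality reads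
  -- `s e α ≤ (α - e) (α - s)`, and `s + e = d + 1`.
  have hkey : s * α < (μ - 1) * (α - s) := by
    have h1 : (s : ℝ) * e * α ≤ (α - e) * (α - s) := by
      have h2 : (0 : ℝ) ≤ (s - e) ^ 2 := sq_nonneg _
      have h3 : (s : ℝ) + e = d + 1 := by rw [hsd]; ring
      have h4 : 4 * ((s : ℝ) * e) ≤ (d + 1) ^ 2 := by nlinarith
      have h5 : (s : ℝ) * e + (d + 1) ≤ α := by nlinarith
      have h6 : 0 ≤ (s : ℝ) * e := by positivity
      have h7 : (α - e) * (α - s) = α * (α - (d + 1)) + s * e := by rw [← h3]; ring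
      rw [h7]
      nlinarith
    have h2 : (α - e) * (α - s) < (μ * e - e) * (α - s) := by
      have : 0 < α - s := by linarith
      gcongr
    have h3 : e * (s * α) < e * ((μ - 1) * (α - s)) := by linarith
    exact lt_of_mul_lt_mul_left h3 he0.le
  obtain ⟨C, hC, hdich⟩ := height_or_of_nearTo q hα he hed.le
  have hlog2 : 0 < Real.log 2 := Real.log_pos (by norm_num)
  have t0 := tendsto_log_lacDen_div_zero hα
  have t1 := tendsto_log_lacDen_div hα
  have E1 := eventually_add_lt_of_tendsto_div hα
    (F := fun k => s * Real.log (lacDen α (k + 1))) (a := s * (α ^ 1 * Real.log 2))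
    (((t1 1).const_mul (s : ℝ)).congr fun k => by ring)
    (G := fun k => (μ - 1) * (Real.log (lacDen α (k + 1)) - s * Real.log (lacDen α k)))
    (b := (μ - 1) * (α ^ 1 * Real.log 2 - s * Real.log 2))
    ((((t1 1).sub (t0.const_mul (s : ℝ))).const_mul (μ - 1)).congr fun k => by ring)
    (by nlinarith)
    ((μ - 1) * Real.log (2 * C) + Real.log (2 * C * e))
  have E2 := eventually_add_lt_of_tendsto_div hα (t1 2)
    (G := fun k => μ * (e * Real.log (lacDen α (k + 1))))
    (b := μ * (e * (α ^ 1 * Real.log 2)))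
    ((((t1 1).const_mul (e : ℝ)).const_mul μ).congr fun k => by ring)
    (by
      have h1 : α ^ 2 * Real.log 2 = α * (α * Real.log 2) := by ring
      have h2 : 0 < α * Real.log 2 := by positivity
      have h3 := mul_lt_mul_of_pos_right hμe h2
      rw [h1, pow_one]
      linarith)
    (μ * Real.log C + Real.log (C * e))
  have E3 := (tendsto_lacDen hα).eventually_ge_atTop (2 * C)
  obtain ⟨M, hM⟩ := eventually_atTop.1 (E1.and (E2.and (E3.and (eventually_ge_atTop q))))
  refine (finite_height_le _ e (max (lacDen α (M + 1)) (2 * C * e))).subset ?_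
  rintro B ⟨hB, hψ⟩
  refine ⟨hB, ?_⟩
  by_contra! hHM
  obtain ⟨hHM1, hHM2⟩ := max_lt_iff.1 hHM
  have hH1 := one_le_height hB
  set H := height B with hHdef
  have hex : ∃ k, 2 * C * H * lacDen α k ^ s ≤ lacDen α (k + 1) :=
    ((eventually_mul_lacDen_pow_lt hα hsα (c := 2 * C * H) (by positivity)).mono
      fun k hk => hk.le).exists
  have hnot : ∀ k ≤ M, lacDen α (k + 1) < 2 * C * H * lacDen α k ^ s := by
    intro k hk
    have h1 : lacDen α (k + 1) ≤ lacDen α (M + 1) := lacDen_mono hα (by omega)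
    have h2 : 1 ≤ lacDen α k ^ s := one_le_pow₀ (one_le_lacDen α k)
    have h3 : H ≤ 2 * C * H := by nlinarith
    calc _ < H := h1.trans_lt hHM1
      _ ≤ 2 * C * H := h3
      _ ≤ _ := le_mul_of_one_le_right (by positivity) h2
  classical
  have hfindM : M < Nat.find hex := by
    by_contra! h
    exact absurd (Nat.find_spec hex) (not_le.2 (hnot _ h))
  -- `k + 1` is the least index for which the term `1 / T_{k+2}` is negligible in the first case of
  -- `height_or_of_nearTo`.
  obtain ⟨k, hk⟩ : ∃ k, Nat.find hex = k + 1 := ⟨Nat.find hex - 1, by omega⟩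
  have hk1 : 2 * C * H * lacDen α (k + 1) ^ s ≤ lacDen α (k + 1 + 1) := hk ▸ Nat.find_spec hex
  have hk2 : lacDen α (k + 1) < 2 * C * H * lacDen α k ^ s :=
    not_le.1 (Nat.find_min hex (by omega))
  have hkM : M ≤ k := by omega
  obtain ⟨e1, e2, -, hkq⟩ := hM k hkM
  have e3 := (hM (k + 1 + 1) (by omega)).2.2.1
  have hnear := nearTo_psi' (finrank_limSpace q hα d) (finrank_of_mem_rationalSubspaces hB)
    hq he hed.le
  have hψ0 := psi_nonneg (limSpace q α d) B e
  set ψ := psi (limSpace q α d) B e with hψdef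
  have hδ0 : 0 ≤ e * ψ := by positivity
  have hT := lacDen_pos α k
  have hT1 := lacDen_pos α (k + 1)
  have hT2 := lacDen_pos α (k + 1 + 1)
  have hsmall : C * (e * ψ + 1 / lacDen α (k + 1 + 1)) ≤ 1 := by
    have h1 : ψ ≤ 1 / H := by
      refine hψ.trans (one_div_le_one_div_of_le (by linarith) ?_)
      calc H = H ^ (1 : ℝ) := (Real.rpow_one H).symm
        _ ≤ H ^ μ := Real.rpow_le_rpow_of_exponent_le hH1 (by linarith)
    have h2 : C * (e * ψ) ≤ 1 / 2 := by
      calc C * (e * ψ) ≤ C * (e * (1 / H)) := by gcongr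
        _ = C * e / H := by ring
        _ ≤ 1 / 2 := by
          rw [div_le_iff₀ (by linarith)]
          linarith
    have h3 : C * (1 / lacDen α (k + 1 + 1)) ≤ 1 / 2 := by
      rw [mul_one_div, div_le_iff₀ hT2]
      linarith
    linarith
  rcases hdich (k + 1) (by omega) B hB (e * ψ) hδ0 hnear hsmall with h | ⟨h, h'⟩
  · rw [← hs] at h
    have h2 : 1 ≤ (2 * C) * (H * lacDen α (k + 1) ^ s) * (e * ψ) := by
      have h3 : C * H * lacDen α (k + 1) ^ s * (1 / lacDen α (k + 1 + 1)) ≤ 1 / 2 := by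
        rw [mul_one_div, div_le_iff₀ hT2]
        linarith
      rw [mul_add] at h
      linarith
    have h3 := mul_log_le_of_one_le hH1 hψ rfl he0 (by positivity) (by positivity) h2
    rw [Real.log_mul (x := H) (by positivity) (by positivity), Real.log_pow] at h3
    have h4 := Real.log_le_log hT1 hk2.le
    rw [Real.log_mul (by positivity) (by positivity), Real.log_mul (by positivity) (by positivity),
      Real.log_pow] at h4
    have h5 : (μ - 1) * (Real.log (lacDen α (k + 1)) - s * Real.log (lacDen α k)) ≤
        (μ - 1) * (Real.log (2 * C) + Real.log H) :=
      mul_le_mul_of_nonneg_left (by linarith) (by linarith)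
    linarith
  · have h2 : 1 ≤ C * lacDen α (k + 1 + 1) * (e * ψ) := by linarith
    have h3 := mul_log_le_of_one_le hH1 hψ rfl he0 (by positivity) hT2 h2
    have h4 := Real.log_le_log (by positivity) h
    rw [Real.log_pow, Real.log_mul (by positivity) (by positivity)] at h4
    have h5 := mul_le_mul_of_nonneg_left h4 (by linarith : 0 ≤ μ)
    linarith

/-- Lower bound for the exponent in dimension `e < d`: the points `X_k ⊗ e_j` for `j < e` span a
subspace of height at most of the order of `T_k ^ e`, at distance of the order of `1 / T_{k+1}` from
`limSpace`. -/
theorem infinite_of_lt_of_lt {α μ : ℝ} {d e : ℕ} (hα' : 3 * (d : ℝ) * ((d : ℝ) + 4) ≤ α)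
    (he : 1 ≤ e) (hed : e < d) (hq : d + e ≤ (q + 1) * d) (hμ0 : 0 < μ) (hμ : μ < α / e) :
    {B ∈ rationalSubspaces ((q + 1) * d) e |
      psi (limSpace q α d) B e ≤ 1 / height B ^ μ}.Infinite := by
  have hα := fifteen_le (by omega) hα'
  have he0 : (0 : ℝ) < e := by exact_mod_cast he
  have hd0 : (0 : ℝ) < d := by exact_mod_cast (by omega : 0 < d)
  have hK := one_le_heightConst ((q + 1) * d)
  have hbot := bot_mem_rationalSubspaces ((q + 1) * d)
  have hbot1 := one_le_height hbot
  set c : ℝ := (q + 1) * 2 with hc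
  have hcpos : 0 < c := by positivity
  set C := heightConst ((q + 1) * d) ^ e *
    height (⊥ : Submodule ℝ (E ((q + 1) * d))) * c ^ e with hC
  have hCpos : 0 < C := by positivity
  set s := (Finset.univ : Finset (Fin d)).filter (fun j : Fin d => (j : ℕ) < e) with hs
  have hcard : s.card = e := by
    rw [hs, Fin.card_filter_val_lt]
    omega
  have hgood : ∀ k, ∃ B ∈ rationalSubspaces ((q + 1) * d) e,
      NearTo B (limSpace q α d) (d * c / lacDen α (k + 1)) ∧ height B ≤ C * lacDen α k ^ e := by
    intro k
    have hT := lacDen_pos α k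
    obtain ⟨f, -, -, hf, hH⟩ := exists_height_sup_span_le hbot s (fun j => pt q α d j k)
      (ε := c * lacDen α k) (by positivity) (fun j _ => ⟨0, zero_mem _, by
        rw [sub_zero, hc, mul_assoc]
        exact norm_intVec_pt_le q hα j k⟩)
    set B := (⊥ : Submodule ℝ (E ((q + 1) * d))) ⊔
      span ℝ ((fun j => intVec (pt q α d j k)) '' (s : Set (Fin d))) with hBdef
    have hBspan : B = span ℝ ((fun j => intVec (pt q α d j k)) '' (s : Set (Fin d))) := by
      rw [hBdef, bot_sup_eq]
    have hfe : f = e := by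
      have h1 := finrank_of_mem_rationalSubspaces hf
      have h2 := (linearIndependent_pt q hα d k).comp ((↑) : s → Fin d) Subtype.val_injective
      have h3 := finrank_span_eq_card h2
      rw [Set.range_comp, Subtype.range_coe_subtype] at h3
      simp only [Fintype.card_coe, hcard] at h3
      rw [hBspan] at h1
      exact h1.symm.trans h3
    subst hfe
    refine ⟨B, hf, nearTo_limSpace_of_le q hα ?_, ?_⟩
    · rw [hBspan]
      exact span_mono (Set.image_subset_range _ _)
    · rw [hcard, Nat.sub_zero, mul_pow] at hH
      rw [hC]
      linarith
  choose B hB hBA hBH using hgood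
  have hψ : ∀ k, psi (limSpace q α d) (B k) e ≤ 1 / (lacDen α (k + 1) / (d * c)) := by
    intro k
    rw [one_div_div]
    exact psi_le' (finrank_limSpace q hα d) (finrank_of_mem_rationalSubspaces (hB k)) hq he hed.le
      (hBA k)
  have t0 := tendsto_log_lacDen_div_zero hα
  have t1 := tendsto_log_lacDen_div hα
  have hlog2 : 0 < Real.log 2 := Real.log_pos (by norm_num)
  have E1 := eventually_add_lt_of_tendsto_div hα
    (F := fun k => μ * (e * Real.log (lacDen α k))) (a := μ * (e * Real.log 2))
    (((t0.const_mul (e : ℝ)).const_mul μ).congr fun k => by ring) (t1 1) (by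
        rw [lt_div_iff₀ he0] at hμ
        rw [pow_one, ← mul_assoc]
        gcongr) (μ * Real.log C + Real.log (d * c))
  refine infinite_of_forall_exists_lt (f := fun B => psi (limSpace q α d) B e)
    (fun B hB => psi_pos' q hα' he hed hq hB.1) fun ε hε => ?_
  have E2 := ((tendsto_lacDen hα).comp (tendsto_add_atTop_nat 1)).eventually_gt_atTop (d * c / ε)
  obtain ⟨k, hk1, hk2⟩ := (E1.and E2).exists
  have hTk := lacDen_pos α k
  have hTN := lacDen_pos α (k + 1)
  refine ⟨B k, ⟨hB k, ?_⟩, ?_⟩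
  · have hHpos : 0 < height (B k) := lt_of_lt_of_le one_pos (one_le_height (hB k))
    refine le_one_div_rpow_of_log hHpos (by positivity) (hψ k) ?_
    have h1 := Real.log_le_log hHpos (hBH k)
    rw [Real.log_mul (by positivity) (by positivity), Real.log_pow] at h1
    rw [Real.log_div hTN.ne' (by positivity)]
    have h2 := mul_le_mul_of_nonneg_left h1 hμ0.le
    linarith
  · refine (hψ k).trans_lt ?_
    simp only [Function.comp] at hk2
    rw [one_div_div, div_lt_iff₀ hTN]
    rw [div_lt_iff₀ hε] at hk2
    linarith

/-- The exponents in dimension less than `d`. -/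
theorem exponent_of_lt {α : ℝ} {d e : ℕ} (hα : 3 * (d : ℝ) * ((d : ℝ) + 4) ≤ α) (he : 1 ≤ e)
    (hed : e < d) (hq : d + e ≤ (q + 1) * d) :
    exponent (limSpace q α d) e e = ((α / (e : ℝ) : ℝ) : EReal) := by
  have hα15 := fifteen_le (by omega) hα
  refine exponent_eq_of_forall (by positivity) ?_ ?_
  · exact fun μ h0 hμ => infinite_of_lt_of_lt q hα he hed hq h0 hμ
  · exact fun μ hμ => finite_of_lt_of_lt q hα he hed hq hμ

end DiophSub

end

theorem mainTheorem3 (d q n : ℕ) (hd : 1 ≤ d) (hq : 1 ≤ q) (hn : n = (q + 1) * d)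
    (α : ℝ) (hα : 3 * (d : ℝ) * ((d : ℝ) + 4) ≤ α) :
    ∃ A : Submodule ℝ (EuclideanSpace ℝ (Fin n)),
      Module.finrank ℝ A = d ∧
      (∀ e : ℕ, d ≤ e → e ≤ n - d →
        DiophSub.IsIrrational A e d ∧
        DiophSub.exponent A e d =
          ((α ^ (e / d + 1) / (((e % d : ℕ) : ℝ) + ((d : ℝ) - ((e % d : ℕ) : ℝ)) * α) : ℝ)
            : EReal)) ∧
      (∀ e : ℕ, 1 ≤ e → e < d →
        DiophSub.IsIrrational A e e ∧
        DiophSub.exponent A e e = ((α / (e : ℝ) : ℝ) : EReal)) := by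
  subst hn
  have : NeZero q := ⟨by omega⟩
  have hα15 := DiophSub.fifteen_le hd hα
  refine ⟨DiophSub.limSpace q α d, DiophSub.finrank_limSpace q hα15 d, fun e hde he => ?_,
    fun e he hed => ?_⟩
  · have heq : e ≤ q * d := by
      rw [add_mul, one_mul, Nat.add_sub_cancel] at he
      exact he
    exact ⟨DiophSub.isIrrational_of_le q hα15 hd heq, DiophSub.exponent_of_le q hd hα hde heq⟩
  · have hqd : d + e ≤ (q + 1) * d := by
      have : 1 * d ≤ q * d := Nat.mul_le_mul_right d hq
      rw [add_mul]
      omega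
    exact ⟨DiophSub.isIrrational_of_lt q hα he hed, DiophSub.exponent_of_lt q hα he hed hqd⟩
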